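/- Let $H$ be a real separable Hilbert space and $T>0$. Let $A$ generate a strongly continuous semigroup $(e^{tA})_{t\ge 0}$ on $H$, and let $Q$ be a bounded positive symmetric operator on $H$ with positive square root $\sqrt Q$, such that $Q_\sigma=\int_0^\sigma e^{sA}Qe^{sA^*}\,ds$ is of trace class for every $\sigma\ge 0$. Let $$P_\tau[f](x)=\int_H f(y)\,\mathcal N(e^{\tau A}x,Q_\tau)(dy),\qquad \tau\ge 0,$$ be the Ornstein–Uhlenbeck semigroup, $P_{t,s}:=P_{s-t}$, and let $\mathcal L$ be its (formal) generator. A function $f:H\to\mathbb R$ is $\sqrt Q$-differentiable at $x$ with $\sqrt Q$-gradient $\nabla^{\sqrt Q}f(x)\in H^*\cong H$ if $\lim_{s\to0}\frac{f(x+s\sqrt Q\,\xi)-f(x)}{s}=\nabla^{\sqrt Q}f(x)\,\xi$ for all $\xi\in H$. Let $\mathcal G(H)$ be the class of continuous, Gâteaux differentiable $f:H\to\mathbb R$ such that $x\mapsto\nabla f(x)\xi$ is continuous for every $\xi\in H$. Assume: * (smoothing) for some $\alpha\in[0,1)$ and $c>0$, for every bounded continuous $\phi_0:H\to\mathbb R$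 and every $0<\tau\le T$, the function $P_\tau[\phi_0]$ is $\sqrt Q$-differentiable on $H$ and $|\nabla^{\sqrt Q}P_\tau[\phi_0](x)\xi|\le c\,\tau^{-\alpha}\|\phi_0\|_\infty|\xi|$ for all $x,\xi\in H$; * $\psi\in\mathcal G(H)$, $\psi(0)=0$, and for some $p\ge 2$ and some constant $C$, $|\psi(\xi_1)-\psi(\xi_2)|\le C(1+|\xi_1|^{p-1}+|\xi_2|^{p-1})|\xi_1-\xi_2|$ for all $\xi_1,\xi_2\in H$; * $l$ and $\phi$ are bounded and continuous, belong to $\mathcal G(H)$ and have bounded derivative. For $a<T$ and $\beta\in[0,1)$, a mild solution on $[a,T]$, with exponent $\beta$, of the Hamilton–Jacobi–Bellman equation $$\partial_t v=-\mathcal L v+\psi(\nabla^{\sqrt Q}v)+l,\qquad v(T,\cdot)=\phi,$$ is a bounded continuous function $v:[a,T]\times H\to\mathbb R$ such that $v(t,\cdot)$ is $\sqrt Q$-differentiable for every $t\in[a,T)$; $\nabla^{\sqrt Q}v\in C^s_\beta$, that is, $(t,x)\mapsto\nabla^{\sqrt Q}v(t,x)\xi$ is continuous on $[a,T)\times H$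 for every $\xi\in H$ and $\sup_{t\in[a,T),\,x\in H}(T-t)^\beta\|\nabla^{\sqrt Q}v(t,x)\|<\infty$; and, with absolutely convergent integrals, $$v(t,x)=P_{t,T}[\phi](x)-\int_t^TP_{t,s}\big[\psi(\nabla^{\sqrt Q}v(s,\cdot))\big](x)\,ds-\int_t^TP_{t,s}[l](x)\,ds,\qquad t\in[a,T],\ x\in H.$$ **Theorem.** There is $\delta\in(0,T)$ such that the equation has a mild solution $u$ on $[T-\delta,T]$ with exponent $0$, i.e. with $\nabla^{\sqrt Q}u\in C^s=C^s_0$ (hence with $\nabla^{\sqrt Q} u\in C^s_\beta$ for every $\beta\in[0,1)$). It is unique among all mild solutions on $[T-\delta,T]$ with exponent $0$, and more generally it coincides with every mild solution on $[T-\delta,T]$ with exponent $\beta\ge 0$ whenever $\alpha+\beta p<1$. -/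

import Mathlib

open Set Filter Topology MeasureTheory ProbabilityTheory
open scoped RealInnerProductSpace

namespace SemilinearKolmogorov

variable {H : Type*} [NormedAddCommGroup H] [InnerProductSpace ℝ H]

/-- `S t = e^{tA}` (only the values at `t ≥ 0` matter) is a strongly continuous semigroup. -/
structure IsC0Semigroup (S : ℝ → H →L[ℝ] H) : Prop where
  zero : S 0 = ContinuousLinearMap.id ℝ H
  add : ∀ s t : ℝ, 0 ≤ s → 0 ≤ t → S (s + t) = (S s).comp (S t)
  tendsto_zero : ∀ x : H, Tendsto (fun t : ℝ => S t x) (𝓝[>] 0) (𝓝 x)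

/-- The (unbounded, partially defined) operator `A` is the infinitesimal generator of `S`:
`x` lies in its domain with `A x = y` exactly when `(S t x - x) / t` tends to `y` as `t ↓ 0`. -/
def IsGenerator (A : H →ₗ.[ℝ] H) (S : ℝ → H →L[ℝ] H) : Prop :=
  ∀ x y : H, (x, y) ∈ A.graph ↔
    Tendsto (fun t : ℝ => t⁻¹ • (S t x - x)) (𝓝[>] 0) (𝓝 y)

/-- The covariance operator `Q_σ x = ∫₀^σ e^{sA} Q e^{sA*} x ds`. -/
noncomputable def covOp [CompleteSpace H] (S : ℝ → H →L[ℝ] H) (Q : H →L[ℝ] H)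
    (σ : ℝ) (x : H) : H :=
  ∫ s in (0 : ℝ)..σ, S s (Q (ContinuousLinearMap.adjoint (S s) x))

/-- A positive symmetric operator `C` is of trace class: its trace, computed in an orthonormal
basis, is finite. (For positive operators this does not depend on the basis.) -/
def HasFiniteTrace (C : H → H) : Prop :=
  ∃ (w : Set H) (b : HilbertBasis w ℝ H), Summable fun i => ⟪C (b i), b i⟫

section Gaussian

variable [MeasurableSpace H] [BorelSpace H]

/-- `μ` is a Gaussian measure on `H` with mean `m` and covariance operator `C`. -/
def IsGaussianWith [CompleteSpace H] (m : H) (C : H → H) (μ : Measure H) : Prop :=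
  IsGaussian μ ∧ ∫ y, y ∂μ = m ∧ ∀ y z : H, covarianceBilin μ y z = ⟪C y, z⟫

open Classical in
/-- The Gaussian measure `𝒩(m, C)`. It exists (and is unique) when `C` is positive, symmetric and
of trace class and `H` is separable. -/
noncomputable def gaussianMeasure [CompleteSpace H] (m : H) (C : H → H) : Measure H :=
  if h : ∃ μ : Measure H, IsGaussianWith m C μ then h.choose else 0

/-- The law `𝒩(e^{τA} x, Q_τ)` at time `τ` of the Ornstein-Uhlenbeck process started at `x`. -/
noncomputable def ouLaw [CompleteSpace H] (S : ℝ → H →L[ℝ] H) (Q : H →L[ℝ] H)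
    (τ : ℝ) (x : H) : Measure H :=
  gaussianMeasure (S τ x) (covOp S Q τ)

/-- The Ornstein-Uhlenbeck transition semigroup `P_τ[f](x) = ∫ f d𝒩(e^{τA} x, Q_τ)`. -/
noncomputable def ouSemigroup [CompleteSpace H] (S : ℝ → H →L[ℝ] H) (Q : H →L[ℝ] H)
    (τ : ℝ) (f : H → ℝ) (x : H) : ℝ :=
  ∫ y, f y ∂(ouLaw S Q τ x)

end Gaussian

/-- `f` is `R`-Gateaux differentiable at `x`, with `R`-gradient the functional `ξ ↦ ⟪g, ξ⟫`
(functionals are identified with vectors of `H` by the Riesz theorem): for every direction `ξ`,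
`(f (x + s R ξ) - f x) / s → ⟪g, ξ⟫` as `s → 0`. -/
def HasGradAlong (R : H →L[ℝ] H) (f : H → ℝ) (g x : H) : Prop :=
  ∀ ξ : H, HasLineDerivAt ℝ f ⟪g, ξ⟫ x (R ξ)

/-- `f` belongs to the class `𝒢(H)`, with Gateaux gradient `D`: `f` is continuous and Gateaux
differentiable and its derivative is strongly continuous. -/
def IsGateauxC1 (f : H → ℝ) (D : H → H) : Prop :=
  Continuous f ∧ (∀ x, HasGradAlong (ContinuousLinearMap.id ℝ H) f (D x) x) ∧
    ∀ ξ : H, Continuous fun x => ⟪D x, ξ⟫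

/-- The smoothing property of the Ornstein-Uhlenbeck semigroup on `(0, T]`: `P_τ[φ]` is
`√Q`-differentiable for all bounded continuous `φ`, with
`|∇^{√Q} P_τ[φ](x) ξ| ≤ c τ^{-α} ‖φ‖_∞ |ξ|`. Here `R = √Q`. -/
def IsSmoothing [CompleteSpace H] [MeasurableSpace H] [BorelSpace H]
    (S : ℝ → H →L[ℝ] H) (Q R : H →L[ℝ] H) (T α : ℝ) : Prop :=
  ∃ c : ℝ, 0 < c ∧ ∀ (φ : BoundedContinuousFunction H ℝ) (τ : ℝ), 0 < τ → τ ≤ T → ∀ x : H,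
    ∃ g : H, HasGradAlong R (ouSemigroup S Q τ φ) g x ∧
      ∀ ξ : H, |⟪g, ξ⟫| ≤ c / τ ^ α * ‖φ‖ * ‖ξ‖

/-- `v : [a, T] × H → ℝ` is a mild solution on `[a, T]`, with `√Q`-gradient in `C_β^s`, of
`∂ₜ v = - ℒ v + ψ(∇^{√Q} v) + l`, `v(T, ·) = φ`, where `ℒ` is the generator of the
Ornstein-Uhlenbeck semigroup. Here `R = √Q`. -/
def IsMildSolution [CompleteSpace H] [MeasurableSpace H] [BorelSpace H]
    (S : ℝ → H →L[ℝ] H) (Q R : H →L[ℝ] H) (ψ l φ : H → ℝ) (a T β : ℝ) (v : ℝ → H → ℝ) : Prop :=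
  -- `v` is continuous and bounded on `[a, T] × H`
  ContinuousOn (fun q : ℝ × H => v q.1 q.2) (Icc a T ×ˢ univ) ∧
  (∃ K : ℝ, ∀ t ∈ Icc a T, ∀ x : H, |v t x| ≤ K) ∧
  ∃ w : ℝ → H → H,
    -- `w = ∇^{√Q} v` on `[a, T) × H`
    (∀ t ∈ Ico a T, ∀ x : H, HasGradAlong R (v t) (w t x) x) ∧
    -- `w` belongs to `C_β^s([a, T] × H, H*)`
    (∀ ξ : H, ContinuousOn (fun q : ℝ × H => ⟪w q.1 q.2, ξ⟫) (Ico a T ×ˢ univ)) ∧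
    (∃ K : ℝ, ∀ t ∈ Ico a T, ∀ x : H, (T - t) ^ β * ‖w t x‖ ≤ K) ∧
    -- the variation of constants formula holds, all its integrals being absolutely convergent
    ∀ t ∈ Icc a T, ∀ x : H,
      (∀ s ∈ Ioo t T, Integrable (fun y => ψ (w s y)) (ouLaw S Q (s - t) x)) ∧
      IntervalIntegrable (fun s => ouSemigroup S Q (s - t) (fun y => ψ (w s y)) x) volume t T ∧
      IntervalIntegrable (fun s => ouSemigroup S Q (s - t) l x) volume t T ∧
      v t x = ouSemigroup S Q (T - t) φ x
        - (∫ s in t..T, ouSemigroup S Q (s - t) (fun y => ψ (w s y)) x)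
        - ∫ s in t..T, ouSemigroup S Q (s - t) l x

end SemilinearKolmogorov

/-!
Write `∇` for the gradient along `R = √Q`. The mild equation is solved through its gradient
`w = ∇v`, which satisfies the closed fixed point equation
`w(t) = ∇P_{T-t} φ - ∫_t^T ∇P_{s-t}[ψ(w(s))] ds - ∫_t^T ∇P_{s-t}[l] ds`.
Since `‖∇P_τ f‖ ≤ M τ^{-α} ‖f‖_∞` with `α < 1`, and since `ψ` is Lipschitz on bounded sets, the right
hand side is a contraction of a ball of bounded norm continuous vector fields when the time interval
is short (`IsSmoothOU.exists_isMildSolution`). The term `∇P_{T-t} φ` stays bounded up to `t = T`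
because `φ` is Lipschitz (`IsSmoothOU.exists_norm_ouGrad_le_of_lipschitz`).

Two points make this more than routine. First, a gradient in `C^s` is only weakly continuous, so for
two arbitrary mild solutions the functions `ψ(w)` are merely Borel in space, while the smoothing
hypothesis speaks of continuous functions. Secondly, the fixed point is sought among norm continuous
fields, so `∇P_τ f` has to be norm continuous. Both are settled by a stronger form of the
smoothing property (`IsOUData.exists_smoothing_const`): testing the hypothesis on the functions
`sin (λ ⟪·, y⟫)`, whose images under `P_τ` are explicit, gives
`|⟪S τ (R ξ), y⟫| ≤ const · τ^{-α} ‖ξ‖ √⟪Q_τ y, y⟫` (`IsOUData.abs_inner_le_of_smoothing`), that is,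
`S τ R` maps into the Cameron-Martin space of `𝒩(0, Q_τ)`. Hence `𝒩(0, Q_τ)` splits off a
one-dimensional Gaussian component in the direction of `S τ (R ξ)` (`IsOUData.exists_split`), and
the Cameron-Martin formula on the line bounds the increments of `P_τ f` along `R ξ`, for bounded
Borel `f`, by the supremum of `f` and also by its `L²`-norm for the transition law. The `L²`-bound
and dominated convergence give the norm continuity of the gradient (`IsSmoothOU.tendsto_ouGrad`).

The joint continuity of `P_τ f(x)` in `(τ, x)` comes from realizing the laws `𝒩(S τ x, Q_τ)` as the
laws of `S τ x + X τ` for a mean-square continuous process `X` (`IsOUData.exists_process`), built from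
an isonormal process over `L²(ℝ; H)` and the Hilbert-Schmidt factors `1_{(0, τ]} R S(·)*` of `Q_τ`.

For uniqueness, let `w₁, w₂` be the gradients of two solutions with the same exponent `β`. The growth of
`ψ` gives `|ψ(w₁(s)) - ψ(w₂(s))| ≤ const · N (T - s)^{-βp}` if `(T - s)^β ‖w₁ - w₂‖ ≤ N`, and since
`α + βp < 1` the Borel form of the smoothing property turns this into the bound
`(T - t)^β ‖w₁(t) - w₂(t)‖ ≤ N / 2` on a short interval whose length does not depend on its position.
Iterating, first in `N` and then over the intervals, yields `w₁ = w₂`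
(`IsSmoothOU.eq_of_isMildSolution`).
-/

namespace SemilinearKolmogorov

/-! ### Isonormal Gaussian processes -/

section Isonormal

variable {Ω : Type*} [MeasurableSpace Ω] {P : Measure Ω}
variable {K : Type*} [NormedAddCommGroup K] [InnerProductSpace ℝ K]

/-- `W` is an isonormal Gaussian process over the Hilbert space `K`: a linear isometry of `K` into
`L²(P)` all of whose values are centred Gaussian variables. By linearity the Gaussian character is
encoded by the characteristic function at `1`. -/
def IsIsonormal (P : Measure Ω) (W : K →ₗᵢ[ℝ] Lp ℝ 2 P) : Prop :=
  ∀ k : K, ∫ ω, Complex.exp ((W k ω : ℂ) * Complex.I) ∂P = Complex.exp (-(‖k‖ : ℂ) ^ 2 / 2)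

lemma norm_exp_mul_I_sub_le (a b : ℝ) :
    ‖Complex.exp (a * Complex.I) - Complex.exp (b * Complex.I)‖ ≤ |a - b| := by
  have h : Complex.exp (a * Complex.I) - Complex.exp (b * Complex.I)
      = Complex.exp (b * Complex.I) * (Complex.exp (Complex.I * ((a - b : ℝ) : ℂ)) - 1) := by
    rw [mul_sub, ← Complex.exp_add]; push_cast; ring_nf
  rw [h, norm_mul, Complex.norm_exp_ofReal_mul_I, one_mul]
  exact Real.norm_exp_I_mul_ofReal_sub_one_le

lemma integrable_exp_mul_I [IsProbabilityMeasure P] (f : Lp ℝ 2 P) :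
    Integrable (fun ω => Complex.exp ((f ω : ℂ) * Complex.I)) P := by
  refine Integrable.of_bound (C := 1) ?_ (ae_of_all _ fun ω => ?_)
  · exact Complex.continuous_exp.comp_aestronglyMeasurable
      ((Complex.continuous_ofReal.comp_aestronglyMeasurable (Lp.aestronglyMeasurable f)).mul_const _)
  · rw [Complex.norm_exp_ofReal_mul_I]

lemma continuous_integral_exp_mul_I [IsProbabilityMeasure P] :
    Continuous fun f : Lp ℝ 2 P => ∫ ω, Complex.exp ((f ω : ℂ) * Complex.I) ∂P := by
  refine LipschitzWith.continuous (K := 1) (LipschitzWith.of_dist_le_mul fun f g => ?_)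
  rw [dist_eq_norm, dist_eq_norm, ← integral_sub (integrable_exp_mul_I f) (integrable_exp_mul_I g)]
  have hfg : MemLp (f - g : Lp ℝ 2 P) 2 P := Lp.memLp _
  calc ‖∫ ω, (Complex.exp ((f ω : ℂ) * Complex.I) - Complex.exp ((g ω : ℂ) * Complex.I)) ∂P‖
      ≤ ∫ ω, ‖(f - g : Lp ℝ 2 P) ω‖ ∂P := by
        refine norm_integral_le_of_norm_le (hfg.integrable one_le_two).norm ?_
        filter_upwards [Lp.coeFn_sub f g] with ω hω
        rw [hω]
        exact norm_exp_mul_I_sub_le _ _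
    _ ≤ (1 : NNReal) * ‖f - g‖ := by
        rw [NNReal.coe_one, one_mul, Lp.norm_def, integral_norm_eq_lintegral_enorm hfg.1,
          ← eLpNorm_one_eq_lintegral_enorm]
        exact ENNReal.toReal_mono hfg.2.ne (eLpNorm_le_eLpNorm_of_exponent_le one_le_two hfg.1)

lemma coeFn_sum_smul {ι : Type*} (s : Finset ι) (c : ι → ℝ) (f : ι → Lp ℝ 2 P) :
    (∑ i ∈ s, c i • f i : Lp ℝ 2 P) =ᵐ[P] fun ω => ∑ i ∈ s, c i * f i ω := by
  classical
  induction s using Finset.induction_on with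
  | empty => simpa using! Lp.coeFn_zero ℝ 2 P
  | insert a s ha ih =>
    rw [Finset.sum_insert ha]
    filter_upwards [Lp.coeFn_add (c a • f a) (∑ i ∈ s, c i • f i), Lp.coeFn_smul (c a) (f a), ih]
      with ω h1 h2 h3
    rw [h1, Finset.sum_insert ha, Pi.add_apply, h2, h3, Pi.smul_apply, smul_eq_mul]

/-- Every real Hilbert space carries an isonormal Gaussian process: expand along a Hilbert basis,
with independent standard Gaussian coefficients. -/
theorem exists_isIsonormal (K : Type*) [NormedAddCommGroup K] [InnerProductSpace ℝ K]
    [CompleteSpace K] :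
    ∃ (ι : Set K) (P : Measure (ι → ℝ)) (_ : IsProbabilityMeasure P)
      (W : K →ₗᵢ[ℝ] Lp ℝ 2 P), IsIsonormal P W := by
  obtain ⟨ι, e, -⟩ := exists_hilbertBasis ℝ K
  let P : Measure (ι → ℝ) := Measure.infinitePi fun _ => gaussianReal 0 1
  have hev : ∀ i : ι, P.map (fun ω => ω i) = gaussianReal 0 1 := fun i =>
    Measure.infinitePi_map_eval (fun _ => gaussianReal 0 1) i
  have hgl : ∀ i : ι, HasGaussianLaw (fun ω : ι → ℝ => ω i) P := fun i => by
    refine ⟨?_⟩; rw [hev]; infer_instance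
  have hind : iIndepFun (fun (i : ι) (ω : ι → ℝ) => ω i) P :=
    iIndepFun_infinitePi (X := fun (_ : ι) (x : ℝ) => x) fun _ => measurable_id
  have hmem : ∀ i : ι, MemLp (fun ω : ι → ℝ => ω i) 2 P := fun i => (hgl i).memLp_two
  have hmean : ∀ i : ι, ∫ ω, ω i ∂P = 0 := fun i => by
    have := integral_map (μ := P) (φ := fun ω : ι → ℝ => ω i) (f := fun x : ℝ => x)
      (measurable_pi_apply i).aemeasurable (by fun_prop)
    rw [← this, hev, integral_id_gaussianReal]
  have hsq : ∀ i : ι, ∫ ω, ω i * ω i ∂P = 1 := fun i => by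
    have := integral_map (μ := P) (φ := fun ω : ι → ℝ => ω i) (f := fun x : ℝ => x * x)
      (measurable_pi_apply i).aemeasurable (by fun_prop)
    rw [← this, hev]
    have h2 := variance_id_gaussianReal (μ := 0) (v := 1)
    rw [variance_eq_integral aemeasurable_id] at h2
    simpa [pow_two] using h2
  let ξ : ι → Lp ℝ 2 P := fun i => (hmem i).toLp
  have hξ : Orthonormal ℝ ξ := by
    classical
    rw [orthonormal_iff_ite]
    intro i j
    rw [L2.inner_def]
    have : ∫ ω, ⟪ξ i ω, ξ j ω⟫ ∂P = ∫ ω, ω i * ω j ∂P := by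
      refine integral_congr_ae ?_
      filter_upwards [(hmem i).coeFn_toLp, (hmem j).coeFn_toLp] with ω hi hj
      simp only [ξ, hi, hj]
      simp [mul_comm]
    rw [this]
    split_ifs with hij
    · subst hij; exact hsq i
    · have := (hind.indepFun hij).integral_fun_mul_eq_mul_integral
        (measurable_pi_apply i).aestronglyMeasurable (measurable_pi_apply j).aestronglyMeasurable
      rw [this, hmean, zero_mul]
  obtain ⟨W, hWe⟩ : ∃ W : K →ₗᵢ[ℝ] Lp ℝ 2 P, ∀ i, W (e i) = ξ i := by
    classical
    refine ⟨hξ.orthogonalFamily.linearIsometry.comp e.repr.toLinearIsometry, fun i => ?_⟩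
    have h1 := hξ.orthogonalFamily.linearIsometry_apply_single (i := i) (1 : ℝ)
    rw [← e.repr_self i] at h1
    refine h1.trans ?_
    simp
  refine ⟨ι, P, inferInstance, W, ?_⟩
  have hclosed : IsClosed {k : K | ∫ ω, Complex.exp ((W k ω : ℂ) * Complex.I) ∂P
      = Complex.exp (-(‖k‖ : ℂ) ^ 2 / 2)} :=
    isClosed_eq (continuous_integral_exp_mul_I.comp W.continuous) (by fun_prop)
  have hdense : Dense (Submodule.span ℝ (range e) : Set K) :=
    Submodule.dense_iff_topologicalClosure_eq_top.mpr e.dense_span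
  intro k
  refine hclosed.closure_subset_iff.2 ?_ (hdense k)
  intro x hx
  obtain ⟨c, rfl⟩ := Finsupp.mem_span_range_iff_exists_finsupp.1 hx
  have hWx : W (c.sum fun i a => a • e i) =ᵐ[P] fun ω => ∑ i ∈ c.support, c i * ω i := by
    rw [Finsupp.sum, map_sum]
    simp only [map_smul, hWe]
    have h2 : ∀ᵐ ω ∂P, ∀ i ∈ c.support, ξ i ω = ω i :=
      (Finset.eventually_all _).2 fun i _ => (hmem i).coeFn_toLp
    filter_upwards [coeFn_sum_smul c.support c ξ, h2] with ω h1 h2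
    rw [h1]
    exact Finset.sum_congr rfl fun i hi => by rw [h2 i hi]
  have hnorm : ‖c.sum fun i a => a • e i‖ ^ 2 = ∑ i ∈ c.support, c i ^ 2 := by
    rw [← real_inner_self_eq_norm_sq, Finsupp.sum, e.orthonormal.inner_sum]
    simp [pow_two]
  have hind' : iIndepFun (fun (i : ι) (ω : ι → ℝ) => c i * ω i) P :=
    hind.comp (fun i x => c i * x) fun i => by fun_prop
  have hcf := iIndepFun.charFun_map_fun_finsetSum_eq_prod
    (X := fun (i : ι) (ω : ι → ℝ) => c i * ω i)
    (fun i _ => ((measurable_pi_apply (X := fun _ : ι => ℝ) i).const_mul (c i)).aemeasurable)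
    (hind'.restrict c.support)
  have hcf1 := congrFun hcf 1
  rw [charFun_apply_real, integral_map] at hcf1
  · have : ∫ ω, Complex.exp ((W (c.sum fun i a => a • e i) ω : ℂ) * Complex.I) ∂P
        = ∫ ω, Complex.exp (((1 : ℝ) : ℂ) * ((∑ i ∈ c.support, c i * ω i : ℝ) : ℂ) * Complex.I) ∂P := by
      refine integral_congr_ae ?_
      filter_upwards [hWx] with ω hω
      rw [hω]; simp
    change _ = _
    rw [this, hcf1, Finset.prod_apply, ← Complex.ofReal_pow, hnorm]
    have hterm : ∀ i ∈ c.support, charFun (P.map fun ω : ι → ℝ => c i * ω i) 1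
        = Complex.exp (((-(c i) ^ 2 / 2 : ℝ)) : ℂ) := fun i _ => by
      rw [charFun_map_mul_comp (measurable_pi_apply i).aemeasurable, hev, charFun_gaussianReal]
      congr 1
      push_cast
      simp [neg_div]
    rw [Finset.prod_congr rfl hterm, ← Complex.exp_sum]
    congr 1
    push_cast
    rw [← Finset.sum_div, Finset.sum_neg_distrib]
  · exact (Finset.measurable_sum _ fun i _ =>
      (measurable_pi_apply (X := fun _ : ι => ℝ) i).const_mul (c i)).aemeasurable
  · fun_prop

/-! ### Gaussian vectors with prescribed Hilbert-Schmidt factor -/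

variable {H : Type*} [NormedAddCommGroup H] [InnerProductSpace ℝ H] [CompleteSpace H]
  {κ : Type*}

omit [CompleteSpace H] in
lemma inner_compLp_toSpanSingleton (u v : H) (f g : Lp ℝ 2 P) :
    ⟪(ContinuousLinearMap.toSpanSingleton ℝ u).compLpL 2 P f,
      (ContinuousLinearMap.toSpanSingleton ℝ v).compLpL 2 P g⟫ = ⟪u, v⟫ * ⟪f, g⟫ := by
  rw [L2.inner_def, L2.inner_def, ← integral_const_mul]
  refine integral_congr_ae ?_
  filter_upwards [(ContinuousLinearMap.toSpanSingleton ℝ u).coeFn_compLpL f,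
    (ContinuousLinearMap.toSpanSingleton ℝ v).coeFn_compLpL g] with ω h1 h2
  rw [h1, h2]
  simp only [ContinuousLinearMap.toSpanSingleton_apply, real_inner_smul_left,
    real_inner_smul_right, RCLike.inner_apply, conj_trivial]
  ring

omit [CompleteSpace H] in
lemma orthogonalFamily_compLp (b : HilbertBasis κ ℝ H) :
    ∃ V : κ → Lp ℝ 2 P →ₗᵢ[ℝ] Lp H 2 P,
      (∀ j f, V j f = (ContinuousLinearMap.toSpanSingleton ℝ (b j)).compLpL 2 P f) ∧
      OrthogonalFamily ℝ (fun _ : κ => Lp ℝ 2 P) V := by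
  classical
  have hb := orthonormal_iff_ite.1 b.orthonormal
  refine ⟨fun j => LinearMap.isometryOfInner
    ((ContinuousLinearMap.toSpanSingleton ℝ (b j)).compLpL 2 P : Lp ℝ 2 P →L[ℝ] Lp H 2 P).toLinearMap
    fun f g => ?_, fun j f => rfl, fun i j hij f g => ?_⟩
  · refine (inner_compLp_toSpanSingleton (b j) (b j) f g).trans ?_
    rw [hb, if_pos rfl, one_mul]
  · refine (inner_compLp_toSpanSingleton (b i) (b j) f g).trans ?_
    rw [hb, if_neg hij, zero_mul]

/-- The `H`-valued Gaussian vector `∑ⱼ W(J bⱼ) bⱼ` of an isonormal process `W` over `K` and an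
operator `J : H → K`, where `b` is a Hilbert basis of `H`. The series converges in `L²(P; H)` when
`J` is Hilbert-Schmidt, and the vector is then centred Gaussian with covariance `J* J`. -/
noncomputable def gaussianVec (W : K →ₗᵢ[ℝ] Lp ℝ 2 P) (b : HilbertBasis κ ℝ H) (J : H →L[ℝ] K) :
    Lp H 2 P :=
  ∑' j, (ContinuousLinearMap.toSpanSingleton ℝ (b j)).compLpL 2 P (W (J (b j)))

variable {W : K →ₗᵢ[ℝ] Lp ℝ 2 P} {b : HilbertBasis κ ℝ H} {J J' : H →L[ℝ] K}

lemma hasSum_gaussianVec (hJ : Summable fun j => ‖J (b j)‖ ^ 2) :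
    HasSum (fun j => (ContinuousLinearMap.toSpanSingleton ℝ (b j)).compLpL 2 P (W (J (b j))))
      (gaussianVec W b J) := by
  obtain ⟨V, hV, hVo⟩ := orthogonalFamily_compLp (P := P) b
  refine Summable.hasSum ?_
  have := (hVo.summable_iff_norm_sq_summable fun j => W (J (b j))).2 (by simpa using hJ)
  simpa only [hV] using this

lemma norm_sq_gaussianVec (hJ : Summable fun j => ‖J (b j)‖ ^ 2) :
    ‖gaussianVec W b J‖ ^ 2 = ∑' j, ‖J (b j)‖ ^ 2 := by
  obtain ⟨V, hV, hVo⟩ := orthogonalFamily_compLp (P := P) b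
  have h1 := (hasSum_gaussianVec (W := W) hJ).norm.pow 2
  have h2 : Tendsto (fun s : Finset κ => ∑ j ∈ s, ‖J (b j)‖ ^ 2) atTop
      (𝓝 (‖gaussianVec W b J‖ ^ 2)) := by
    refine h1.congr fun s => ?_
    have := hVo.norm_sum (fun j => W (J (b j))) s
    simpa only [hV, W.norm_map] using this
  exact tendsto_nhds_unique h2 hJ.hasSum

lemma gaussianVec_sub (hJ : Summable fun j => ‖J (b j)‖ ^ 2)
    (hJ' : Summable fun j => ‖J' (b j)‖ ^ 2) :
    gaussianVec W b J - gaussianVec W b J' = gaussianVec W b (J - J') := by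
  refine ((hasSum_gaussianVec hJ).sub (hasSum_gaussianVec hJ')).tsum_eq.symm.trans ?_
  simp only [gaussianVec, _root_.sub_apply, map_sub]

lemma inner_gaussianVec (hJ : Summable fun j => ‖J (b j)‖ ^ 2) (y : H) :
    (fun ω => ⟪y, gaussianVec W b J ω⟫) =ᵐ[P] W (J y) := by
  have h1 := ((innerSL ℝ y).compLpL 2 P : Lp H 2 P →L[ℝ] Lp ℝ 2 P).hasSum
    (hasSum_gaussianVec (W := W) hJ)
  have h2 := (W.toContinuousLinearMap.comp J).hasSum (b.hasSum_repr y)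
  have h3 : (innerSL ℝ y).compLpL 2 P (gaussianVec W b J) = W (J y) := by
    refine h1.unique ?_
    change HasSum _ ((W.toContinuousLinearMap.comp J) y)
    convert h2 using 2 with j
    have h4 : (W.toContinuousLinearMap.comp J) (b.repr y j • b j) = ⟪b j, y⟫ • W (J (b j)) := by
      rw [map_smul, b.repr_apply_apply]; rfl
    rw [h4]
    apply Lp.ext
    filter_upwards [(innerSL ℝ y).coeFn_compLpL
        ((ContinuousLinearMap.toSpanSingleton ℝ (b j)).compLpL 2 P (W (J (b j)))),
      (ContinuousLinearMap.toSpanSingleton ℝ (b j)).coeFn_compLpL (W (J (b j))),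
      Lp.coeFn_smul ⟪b j, y⟫ (W (J (b j)))] with ω h5 h6 h7
    rw [h5, h6, h7]
    simp [real_inner_comm, mul_comm]
  rw [← h3]
  filter_upwards [(innerSL ℝ y).coeFn_compLpL (gaussianVec W b J)] with ω hω
  rw [hω, innerSL_apply_apply]

/-- The Gaussian vector `gaussianVec W b J` is centred Gaussian with covariance `J* J`. -/
lemma charFun_map_gaussianVec [MeasurableSpace H] [BorelSpace H] (hW : IsIsonormal P W)
    (hJ : Summable fun j => ‖J (b j)‖ ^ 2) (y : H) :
    charFun (P.map (gaussianVec W b J)) y = Complex.exp (-(‖J y‖ : ℂ) ^ 2 / 2) := by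
  rw [charFun_apply, integral_map (Lp.aestronglyMeasurable _).aemeasurable, ← hW (J y)]
  · refine integral_congr_ae ?_
    filter_upwards [inner_gaussianVec (W := W) hJ y] with ω hω
    rw [← hω, real_inner_comm]
  · exact Continuous.aestronglyMeasurable (by fun_prop)

end Isonormal

/-! ### Weak measurability -/

section Pettis

variable {H : Type*} [NormedAddCommGroup H] [InnerProductSpace ℝ H] [CompleteSpace H]

omit [CompleteSpace H] in
lemma countable_of_orthonormal [TopologicalSpace.SeparableSpace H] {ι : Type*} {v : ι → H}
    (hv : Orthonormal ℝ v) : Countable ι := by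
  have hd : (univ : Set ι).PairwiseDisjoint fun i => Metric.ball (v i) (1 / 2) := by
    intro i _ j _ hij
    refine Metric.ball_disjoint_ball ?_
    have h1 : ‖v i - v j‖ ^ 2 = 2 := by
      rw [norm_sub_sq_real, hv.norm_eq_one, hv.norm_eq_one, hv.inner_eq_zero hij]; norm_num
    rw [dist_eq_norm]
    nlinarith [norm_nonneg (v i - v j)]
  exact countable_univ_iff.1 (hd.countable_of_isOpen (fun i _ => Metric.isOpen_ball)
    fun i _ => ⟨v i, Metric.mem_ball_self (by norm_num)⟩)

/-- Pettis' theorem for a separable Hilbert space: weakly measurable maps are measurable. -/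
lemma measurable_of_forall_inner [TopologicalSpace.SeparableSpace H] [MeasurableSpace H]
    [BorelSpace H] {α : Type*} [MeasurableSpace α] {f : α → H}
    (hf : ∀ y : H, Measurable fun a => ⟪f a, y⟫) : Measurable f := by
  obtain ⟨ι, e, -⟩ := exists_hilbertBasis ℝ H
  have : Countable ι := countable_of_orthonormal e.orthonormal
  have : SecondCountableTopology H := UniformSpace.secondCountable_of_separable H
  refine measurable_of_tendsto_metrizable' (atTop : Filter (Finset ι))
    (f := fun s a => ∑ i ∈ s, ⟪f a, e i⟫ • e i) (fun s => ?_) ?_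
  · exact Finset.measurable_sum _ fun i _ => (hf (e i)).smul_const (e i)
  · refine tendsto_pi_nhds.2 fun a => ?_
    have := e.hasSum_repr (f a)
    simpa only [HasSum, SummationFilter.unconditional_filter, e.repr_apply_apply, real_inner_comm]
      using this

end Pettis

/-! ### Strongly continuous semigroups -/

section Semigroup

variable {H : Type*} [NormedAddCommGroup H] [InnerProductSpace ℝ H] [CompleteSpace H]
  {S : ℝ → H →L[ℝ] H}

omit [CompleteSpace H] in
lemma IsC0Semigroup.tendsto_nhdsGE (hS : IsC0Semigroup S) (x : H) :
    Tendsto (fun t => S t x) (𝓝[≥] 0) (𝓝 x) := by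
  rw [← Ioi_insert, nhdsWithin_insert]
  refine Tendsto.sup ?_ (hS.tendsto_zero x)
  have : S 0 x = x := by rw [hS.zero]; rfl
  simpa [this] using tendsto_pure_nhds (fun t => S t x) 0

lemma IsC0Semigroup.exists_norm_le_near_zero (hS : IsC0Semigroup S) :
    ∃ η > 0, ∃ M : ℝ, ∀ t ∈ Icc 0 η, ‖S t‖ ≤ M := by
  by_contra! h
  choose t ht hlt using fun n : ℕ => h (1 / ((n : ℝ) + 1)) (by positivity) n
  have h0 : Tendsto t atTop (𝓝[≥] 0) := by
    refine tendsto_nhdsWithin_iff.2 ⟨?_, Eventually.of_forall fun n => (ht n).1⟩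
    exact squeeze_zero (fun n => (ht n).1) (fun n => (ht n).2) tendsto_one_div_add_atTop_nhds_zero_nat
  obtain ⟨C, hC⟩ := banach_steinhaus (g := fun n => S (t n)) fun x => by
    obtain ⟨C, hC⟩ := ((hS.tendsto_nhdsGE x).comp h0).norm.bddAbove_range
    exact ⟨C, fun n => hC ⟨n, rfl⟩⟩
  obtain ⟨n, hn⟩ := exists_nat_gt C
  linarith [hC n, hlt n]

lemma IsC0Semigroup.exists_norm_le (hS : IsC0Semigroup S) (T : ℝ) :
    ∃ M : ℝ, 0 ≤ M ∧ ∀ t ∈ Icc 0 T, ‖S t‖ ≤ M := by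
  obtain ⟨η, hη, M, hM⟩ := hS.exists_norm_le_near_zero
  have hM0 : 0 ≤ M := (norm_nonneg _).trans (hM 0 ⟨le_rfl, hη.le⟩)
  have key : ∀ n : ℕ, ∃ B : ℝ, 0 ≤ B ∧ ∀ t ∈ Icc 0 (n * η), ‖S t‖ ≤ B := by
    intro n
    induction n with
    | zero => exact ⟨M, hM0, fun t ht => hM t ⟨ht.1, by simpa using ht.2.trans (by simpa using hη.le)⟩⟩
    | succ n ih =>
      obtain ⟨B, hB0, hB⟩ := ih
      refine ⟨max M (M * B), le_max_of_le_left hM0, fun t ht => ?_⟩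
      rcases le_total t η with h | h
      · exact le_max_of_le_left (hM t ⟨ht.1, h⟩)
      · have h1 : S t = (S η).comp (S (t - η)) := by
          rw [← hS.add η (t - η) hη.le (by linarith)]; congr 1; ring
        have h2 : t - η ∈ Icc 0 (n * η) := ⟨by linarith, by have := ht.2; push_cast at this; linarith⟩
        rw [h1]
        refine le_max_of_le_right ((ContinuousLinearMap.opNorm_comp_le _ _).trans ?_)
        exact mul_le_mul (hM η ⟨hη.le, le_rfl⟩) (hB _ h2) (norm_nonneg _) hM0
  obtain ⟨n, hn⟩ := exists_nat_gt (T / η)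
  obtain ⟨B, hB0, hB⟩ := key n
  exact ⟨B, hB0, fun t ht => hB t ⟨ht.1, ht.2.trans ((div_lt_iff₀ hη).1 hn).le⟩⟩

/-- A strongly continuous semigroup is jointly continuous in time and space. -/
lemma IsC0Semigroup.continuousOn (hS : IsC0Semigroup S) :
    ContinuousOn (fun q : ℝ × H => S q.1 q.2) (Ici 0 ×ˢ univ) := by
  rintro ⟨t₀, x₀⟩ ⟨ht₀, -⟩
  simp only [mem_Ici] at ht₀
  obtain ⟨M, hM0, hM⟩ := hS.exists_norm_le (t₀ + 1)
  have hincr : ∀ t ∈ Icc 0 (t₀ + 1), ‖S t x₀ - S t₀ x₀‖ ≤ M * ‖S |t - t₀| x₀ - x₀‖ := by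
    have h : ∀ a b : ℝ, 0 ≤ a → a ≤ b → b ≤ t₀ + 1 →
        ‖S b x₀ - S a x₀‖ ≤ M * ‖S (b - a) x₀ - x₀‖ := fun a b ha hab hb => by
      have h1 : S b x₀ = S a (S (b - a) x₀) := by
        rw [← ContinuousLinearMap.comp_apply, ← hS.add a (b - a) ha (by linarith)]
        congr 2; ring
      rw [h1, ← map_sub]
      exact (S a).le_of_opNorm_le (hM a ⟨ha, by linarith⟩) _
    intro t ht
    rcases le_total t t₀ with h1 | h1
    · rw [norm_sub_rev, abs_sub_comm, abs_of_nonneg (by linarith)]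
      exact h t t₀ ht.1 h1 (by linarith)
    · rw [abs_of_nonneg (by linarith)]
      exact h t₀ t ht₀ h1 ht.2
  have hmain : ∀ᶠ q : ℝ × H in 𝓝[Ici 0 ×ˢ univ] (t₀, x₀),
      ‖S q.1 q.2 - S t₀ x₀‖ ≤ M * ‖q.2 - x₀‖ + M * ‖S |q.1 - t₀| x₀ - x₀‖ := by
    have h1 : ∀ᶠ q : ℝ × H in 𝓝[Ici 0 ×ˢ univ] (t₀, x₀), q.1 < t₀ + 1 :=
      nhdsWithin_le_nhds ((continuous_fst.tendsto (t₀, x₀)).eventually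
        (gt_mem_nhds (by simp : (t₀, x₀).1 < t₀ + 1)))
    filter_upwards [h1, self_mem_nhdsWithin] with q hq hq0
    have hq' : q.1 ∈ Icc 0 (t₀ + 1) := ⟨hq0.1, hq.le⟩
    calc ‖S q.1 q.2 - S t₀ x₀‖ = ‖S q.1 (q.2 - x₀) + (S q.1 x₀ - S t₀ x₀)‖ := by
          rw [map_sub]; congr 1; abel
      _ ≤ _ := (norm_add_le _ _).trans
        (add_le_add ((S q.1).le_of_opNorm_le (hM _ hq') _) (hincr _ hq'))
  rw [ContinuousWithinAt, tendsto_iff_norm_sub_tendsto_zero]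
  refine squeeze_zero' (Eventually.of_forall fun _ => norm_nonneg _) hmain ?_
  have h1 : Tendsto (fun q : ℝ × H => |q.1 - t₀|) (𝓝[Ici 0 ×ˢ univ] (t₀, x₀)) (𝓝[≥] 0) := by
    refine tendsto_nhdsWithin_iff.2 ⟨?_, Eventually.of_forall fun q => mem_Ici.2 (abs_nonneg _)⟩
    have : Continuous fun q : ℝ × H => |q.1 - t₀| := by fun_prop
    simpa using (this.tendsto (t₀, x₀)).mono_left nhdsWithin_le_nhds
  have h2 : Tendsto (fun q : ℝ × H => ‖q.2 - x₀‖) (𝓝[Ici 0 ×ˢ univ] (t₀, x₀)) (𝓝 0) := by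
    have : Continuous fun q : ℝ × H => ‖q.2 - x₀‖ := by fun_prop
    simpa using (this.tendsto (t₀, x₀)).mono_left nhdsWithin_le_nhds
  have h3 := (((hS.tendsto_nhdsGE x₀).sub_const x₀).norm).comp h1
  simpa using (h2.const_mul M).add (h3.const_mul M)

lemma IsC0Semigroup.continuousOn_apply (hS : IsC0Semigroup S) (x : H) :
    ContinuousOn (fun t => S t x) (Ici 0) :=
  hS.continuousOn.comp (f := fun t : ℝ => (t, x)) (by fun_prop) fun t ht => ⟨ht, mem_univ _⟩

end Semigroup

/-! ### Splitting a Gaussian measure along an admissible direction -/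

section Split

variable {H : Type*} [NormedAddCommGroup H] [InnerProductSpace ℝ H] [CompleteSpace H]
  {K : Type*} [NormedAddCommGroup K] [InnerProductSpace ℝ K] [CompleteSpace K] {κ : Type*}

omit [CompleteSpace H] in
/-- A vector `h` dominated by `J` in the sense `|⟪h, y⟫| ≤ m ‖J y‖` is of the form `J* k` with
`‖k‖ ≤ m`. -/
lemma exists_inner_eq_of_abs_inner_le (J : H →L[ℝ] K) {h : H} {m : ℝ} (hm : 0 ≤ m)
    (hb : ∀ y, |⟪h, y⟫| ≤ m * ‖J y‖) : ∃ k : K, ‖k‖ ≤ m ∧ ∀ y, ⟪h, y⟫ = ⟪k, J y⟫ := by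
  let f : H →ₗ[ℝ] K := J.toLinearMap
  have hker : LinearMap.ker f ≤ LinearMap.ker (innerₗ H h) := fun y hy => by
    have hy' : J y = 0 := hy
    have := hb y
    rw [hy', norm_zero, mul_zero] at this
    simpa using this
  let g : LinearMap.range f →ₗ[ℝ] ℝ :=
    (Submodule.liftQ _ (innerₗ H h) hker).comp f.quotKerEquivRange.symm.toLinearMap
  have hg : ∀ y, g ⟨J y, y, rfl⟩ = ⟪h, y⟫ := fun y => by
    have h1 : f.quotKerEquivRange.symm ⟨J y, y, rfl⟩ = (LinearMap.ker f).mkQ y :=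
      f.quotKerEquivRange_symm_apply_image y ⟨y, rfl⟩
    simp [g, h1]
  let G : LinearMap.range f →L[ℝ] ℝ := g.mkContinuous m fun z => by
    obtain ⟨z, y, rfl⟩ := z
    rw [show (⟨f y, y, rfl⟩ : LinearMap.range f) = ⟨J y, y, rfl⟩ from rfl, hg, Real.norm_eq_abs]
    exact hb y
  obtain ⟨F, hF, hFn⟩ := exists_extension_norm_eq _ G
  refine ⟨(InnerProductSpace.toDual ℝ K).symm F, ?_, fun y => ?_⟩
  · rw [LinearIsometryEquiv.norm_map, hFn]
    exact LinearMap.mkContinuous_norm_le _ hm _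
  · rw [InnerProductSpace.toDual_symm_apply]
    exact ((hF ⟨J y, y, rfl⟩).trans (hg y)).symm

variable [MeasurableSpace H] [BorelSpace H]

lemma exists_measure_charFun_eq (b : HilbertBasis κ ℝ H) (J : H →L[ℝ] K)
    (hJ : Summable fun j => ‖J (b j)‖ ^ 2) :
    ∃ ν : Measure H, IsProbabilityMeasure ν ∧
      ∀ y, charFun ν y = Complex.exp (-(‖J y‖ : ℂ) ^ 2 / 2) := by
  obtain ⟨ι, P, hP, W, hW⟩ := exists_isIsonormal K
  exact ⟨P.map (gaussianVec W b J),
    Measure.isProbabilityMeasure_map (Lp.aestronglyMeasurable _).aemeasurable,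
    charFun_map_gaussianVec hW hJ⟩

/-- If `|⟪h, y⟫| ≤ m ‖J y‖`, then the centred Gaussian measure with covariance `J* J` is the law of
`ζ v + Y`, where `ζ` is standard normal and independent of `Y`, and `h = s v` with `0 ≤ s ≤ m`. -/
lemma exists_split (b : HilbertBasis κ ℝ H) (J : H →L[ℝ] K)
    (hJ : Summable fun j => ‖J (b j)‖ ^ 2) {h : H} {m : ℝ} (hm : 0 ≤ m)
    (hb : ∀ y, |⟪h, y⟫| ≤ m * ‖J y‖) :
    ∃ (ν : Measure H) (v : H) (s : ℝ), IsProbabilityMeasure ν ∧ 0 ≤ s ∧ s ≤ m ∧ h = s • v ∧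
      ∀ y, Complex.exp (-(⟪v, y⟫ : ℂ) ^ 2 / 2) * charFun ν y
        = Complex.exp (-(‖J y‖ : ℂ) ^ 2 / 2) := by
  obtain ⟨k, hk, hkJ⟩ := exists_inner_eq_of_abs_inner_le J hm hb
  -- `e` is the unit vector in the direction of `k`, or `0` if `k = 0`
  set e : K := ‖k‖⁻¹ • k with he
  have hke : k = ‖k‖ • e := by
    rcases eq_or_ne k 0 with h0 | h0
    · simp [h0]
    · rw [he, smul_smul, mul_inv_cancel₀ (norm_ne_zero_iff.2 h0), one_smul]
  have hee : ⟪e, e⟫ * ‖k‖ = ‖k‖ := by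
    rcases eq_or_ne k 0 with h0 | h0
    · simp [h0]
    · have : ‖k‖ ≠ 0 := norm_ne_zero_iff.2 h0
      rw [he, real_inner_smul_left, real_inner_smul_right, real_inner_self_eq_norm_sq]
      field_simp
  have hee' : ∀ z : K, ⟪e, e⟫ * ⟪e, z⟫ = ⟪e, z⟫ := fun z => by
    rw [show ⟪e, z⟫ = ‖k‖⁻¹ * ⟪k, z⟫ by rw [he, real_inner_smul_left]]
    rcases eq_or_ne ‖k‖ 0 with h0 | h0
    · simp [h0]
    · have : ⟪e, e⟫ = 1 := by simpa [h0] using hee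
      rw [this, one_mul]
  let J' : H →L[ℝ] K := J - ((innerSL ℝ e).comp J).smulRight e
  have hJ'n : ∀ y, ‖J' y‖ ^ 2 = ‖J y‖ ^ 2 - ⟪e, J y⟫ ^ 2 := fun y => by
    have : J' y = J y - ⟪e, J y⟫ • e := by simp [J']
    rw [this, norm_sub_sq_real, norm_smul, mul_pow, Real.norm_eq_abs, sq_abs,
      real_inner_smul_right, real_inner_comm e (J y), ← real_inner_self_eq_norm_sq e]
    have := hee' (J y)
    linear_combination ⟪e, J y⟫ * this
  obtain ⟨ν, hν, hνc⟩ := exists_measure_charFun_eq b J' (hJ.of_nonneg_of_le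
    (fun j => by positivity) fun j => by rw [hJ'n]; linarith [sq_nonneg ⟪e, J (b j)⟫])
  refine ⟨ν, (ContinuousLinearMap.adjoint J) e, ‖k‖, hν, norm_nonneg k, hk, ?_, fun y => ?_⟩
  · refine ext_inner_right ℝ fun y => ?_
    rw [hkJ, real_inner_smul_left, ContinuousLinearMap.adjoint_inner_left, ← real_inner_smul_left,
      ← hke]
  · rw [hνc, ← Complex.exp_add, ContinuousLinearMap.adjoint_inner_left]
    congr 1
    have := hJ'n y
    rw [← Complex.ofReal_pow ‖J' y‖, this]
    push_cast
    ring

end Split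

/-! ### The covariance of the Ornstein-Uhlenbeck process -/

section Covariance

variable {H : Type*} [NormedAddCommGroup H] [InnerProductSpace ℝ H] [CompleteSpace H]
  [TopologicalSpace.SeparableSpace H] [MeasurableSpace H] [BorelSpace H]
  {S : ℝ → H →L[ℝ] H} {Q R : H →L[ℝ] H}

open ContinuousLinearMap (adjoint)

lemma measurable_indicator_adjoint (hS : IsC0Semigroup S) (B : H →L[ℝ] H) (y : H) (τ : ℝ) :
    Measurable ((Ioc 0 τ).indicator fun s => B (adjoint (S s) y)) := by
  classical
  refine measurable_of_forall_inner fun z => ?_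
  have h1 : (fun s => ⟪(Ioc 0 τ).indicator (fun s => B (adjoint (S s) y)) s, z⟫)
      = (Ioc 0 τ).piecewise (fun s => ⟪y, S s (adjoint B z)⟫) fun _ => 0 := by
    ext s
    by_cases hs : s ∈ Ioc 0 τ
    · rw [indicator_of_mem hs, piecewise_eq_of_mem _ _ _ hs, ← ContinuousLinearMap.adjoint_inner_right,
        ContinuousLinearMap.adjoint_inner_left]
    · rw [indicator_of_notMem hs, piecewise_eq_of_notMem _ _ _ hs, inner_zero_left]
  rw [h1]
  refine ContinuousOn.measurable_piecewise ?_ continuousOn_const measurableSet_Ioc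
  exact continuousOn_const.inner ((hS.continuousOn_apply _).mono fun s hs => hs.1.le)

omit [TopologicalSpace.SeparableSpace H] [MeasurableSpace H] [BorelSpace H] in
lemma exists_norm_adjoint_le (hS : IsC0Semigroup S) (B : H →L[ℝ] H) (τ : ℝ) :
    ∃ M : ℝ, 0 ≤ M ∧ ∀ s ∈ Ioc 0 τ, ∀ y, ‖B (adjoint (S s) y)‖ ≤ M * ‖y‖ := by
  obtain ⟨M, hM0, hM⟩ := hS.exists_norm_le τ
  refine ⟨‖B‖ * M, by positivity, fun s hs y => ?_⟩
  rw [mul_assoc]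
  refine B.le_opNorm_of_le ((adjoint (S s)).le_of_opNorm_le ?_ y)
  rw [LinearIsometryEquiv.norm_map]
  exact hM s ⟨hs.1.le, hs.2⟩

lemma memLp_indicator_adjoint (hS : IsC0Semigroup S) (B : H →L[ℝ] H) (y : H) (τ : ℝ) :
    MemLp ((Ioc 0 τ).indicator fun s => B (adjoint (S s) y)) 2 volume := by
  obtain ⟨M, hM0, hM⟩ := exists_norm_adjoint_le hS B τ
  have h1 : MemLp ((Ioc 0 τ).indicator fun s => B (adjoint (S s) y)) 2 (volume.restrict (Ioc 0 τ)) := by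
    have : SecondCountableTopology H := UniformSpace.secondCountable_of_separable H
    refine MemLp.of_bound (measurable_indicator_adjoint hS B y τ).aestronglyMeasurable (M * ‖y‖) ?_
    filter_upwards [ae_restrict_mem measurableSet_Ioc] with s hs
    rw [indicator_of_mem hs]
    exact hM s hs y
  have h2 := (memLp_indicator_iff_restrict (f := (Ioc 0 τ).indicator fun s => B (adjoint (S s) y))
    (measurableSet_Ioc (a := (0 : ℝ)) (b := τ))).2 h1
  rwa [indicator_indicator, inter_self] at h2

/-- The factor `J_τ y = 1_{(0, τ]} R S(·)* y` of the covariance operators: `J_τ* J_τ = Q_τ`. -/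
lemma exists_covFactor (hS : IsC0Semigroup S) (R : H →L[ℝ] H) :
    ∃ J : ℝ → H →L[ℝ] Lp H 2 (volume : Measure ℝ), ∀ τ y,
      J τ y =ᵐ[volume] (Ioc 0 τ).indicator fun s => R (adjoint (S s) y) := by
  have h : ∀ τ, ∃ J : H →L[ℝ] Lp H 2 (volume : Measure ℝ), ∀ y,
      J y =ᵐ[volume] (Ioc 0 τ).indicator fun s => R (adjoint (S s) y) := fun τ => by
    obtain ⟨M, hM0, hM⟩ := exists_norm_adjoint_le hS R τ
    let J₀ : H →ₗ[ℝ] Lp H 2 (volume : Measure ℝ) :=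
      { toFun := fun y => (memLp_indicator_adjoint hS R y τ).toLp
        map_add' := fun y z => by
          rw [← MemLp.toLp_add]
          refine MemLp.toLp_congr _ _ (ae_of_all _ fun s => ?_)
          by_cases hs : s ∈ Ioc 0 τ <;> simp [hs]
        map_smul' := fun c y => by
          rw [RingHom.id_apply, ← MemLp.toLp_const_smul]
          refine MemLp.toLp_congr _ _ (ae_of_all _ fun s => ?_)
          by_cases hs : s ∈ Ioc 0 τ <;> simp [hs] }
    refine ⟨J₀.mkContinuous (√(volume.real (Ioc 0 τ)) * M) fun y => ?_, fun y =>
      (memLp_indicator_adjoint hS R y τ).coeFn_toLp⟩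
    have h1 : ‖J₀ y‖ ^ 2 ≤ (√(volume.real (Ioc 0 τ)) * M * ‖y‖) ^ 2 := by
      rw [mul_assoc, mul_pow, Real.sq_sqrt measureReal_nonneg, ← real_inner_self_eq_norm_sq,
        L2.inner_def]
      have h2 : ∫ s, ⟪J₀ y s, J₀ y s⟫ ≤ ∫ s, (Ioc 0 τ).indicator (fun _ => (M * ‖y‖) ^ 2) s := by
        refine integral_mono_of_nonneg (ae_of_all _ fun s => real_inner_self_nonneg) ?_ ?_
        · exact (integrable_indicator_iff measurableSet_Ioc).2 (integrableOn_const (by simp))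
        · filter_upwards [(memLp_indicator_adjoint hS R y τ).coeFn_toLp] with s hs
          rw [show J₀ y s = (Ioc 0 τ).indicator (fun s => R (adjoint (S s) y)) s from hs]
          by_cases h3 : s ∈ Ioc 0 τ
          · rw [indicator_of_mem h3, indicator_of_mem h3, real_inner_self_eq_norm_sq]
            exact pow_le_pow_left₀ (norm_nonneg _) (hM s h3 y) 2
          · simp [h3]
      rw [integral_indicator measurableSet_Ioc, setIntegral_const, smul_eq_mul] at h2
      exact h2
    exact le_of_sq_le_sq h1 (by positivity)
  choose J hJ using h
  exact ⟨J, hJ⟩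

omit [TopologicalSpace.SeparableSpace H] [MeasurableSpace H] [BorelSpace H] in
lemma inner_covFactor {J : ℝ → H →L[ℝ] Lp H 2 (volume : Measure ℝ)}
    (hJ : ∀ τ y, J τ y =ᵐ[volume] (Ioc 0 τ).indicator fun s => R (adjoint (S s) y))
    {σ τ : ℝ} (hσ : 0 ≤ σ) (hστ : σ ≤ τ) (y z : H) :
    ⟪J σ y, J τ z⟫ = ∫ s in (0 : ℝ)..σ, ⟪R (adjoint (S s) y), R (adjoint (S s) z)⟫ := by
  rw [L2.inner_def, intervalIntegral.integral_of_le hσ, ← integral_indicator measurableSet_Ioc]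
  refine integral_congr_ae ?_
  filter_upwards [hJ σ y, hJ τ z] with s h1 h2
  rw [h1, h2]
  by_cases hs : s ∈ Ioc 0 σ
  · rw [indicator_of_mem hs, indicator_of_mem hs, indicator_of_mem (show s ∈ Ioc 0 τ from ⟨hs.1, hs.2.trans hστ⟩)]
  · rw [indicator_of_notMem hs, indicator_of_notMem hs, inner_zero_left]

lemma inner_covOp (hS : IsC0Semigroup S) (hR : R.IsPositive) (hRQ : R.comp R = Q)
    {τ : ℝ} (hτ : 0 ≤ τ) (y z : H) :
    ⟪covOp S Q τ y, z⟫
      = ∫ s in (0 : ℝ)..τ, ⟪R (adjoint (S s) y), R (adjoint (S s) z)⟫ := by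
  have hadj : ∀ u v : H, ⟪R u, v⟫ = ⟪u, R v⟫ := fun u v => by
    have h1 : adjoint R = R := hR.isSelfAdjoint.adjoint_eq
    rw [← ContinuousLinearMap.adjoint_inner_right, h1]
  have hpt : ∀ s (u v : H), ⟪S s (Q (adjoint (S s) u)), v⟫
      = ⟪R (adjoint (S s) u), R (adjoint (S s) v)⟫ := fun s u v => by
    rw [← ContinuousLinearMap.adjoint_inner_right, ← hRQ, ContinuousLinearMap.comp_apply, hadj]
  have hint : IntervalIntegrable (fun s => S s (Q (adjoint (S s) y))) volume 0 τ := by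
    rw [intervalIntegrable_iff_integrableOn_Ioc_of_le hτ]
    obtain ⟨M, hM0, hM⟩ := exists_norm_adjoint_le hS Q τ
    obtain ⟨M', hM'0, hM'⟩ := hS.exists_norm_le τ
    have : SecondCountableTopology H := UniformSpace.secondCountable_of_separable H
    have hmeas : Measurable ((Ioc 0 τ).indicator fun s => S s (Q (adjoint (S s) y))) := by
      refine measurable_of_forall_inner fun v => ?_
      have h1 : Measurable fun s => ⟪(Ioc 0 τ).indicator (fun s => R (adjoint (S s) y)) s,
          (Ioc 0 τ).indicator (fun s => R (adjoint (S s) v)) s⟫ :=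
        (measurable_indicator_adjoint hS R y τ).inner (measurable_indicator_adjoint hS R v τ)
      convert h1 using 2 with s
      by_cases hs : s ∈ Ioc 0 τ
      · rw [indicator_of_mem hs, indicator_of_mem hs, indicator_of_mem hs, hpt]
      · rw [indicator_of_notMem hs, indicator_of_notMem hs, inner_zero_left, inner_zero_left]
    refine IntegrableOn.of_bound (C := M' * (M * ‖y‖)) (by simp) ?_ ?_
    · exact (aestronglyMeasurable_indicator_iff measurableSet_Ioc).1 hmeas.aestronglyMeasurable
    · filter_upwards [ae_restrict_mem measurableSet_Ioc] with s hs
      exact (S s).le_of_opNorm_le_of_le (hM' s ⟨hs.1.le, hs.2⟩) (hM s hs y)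
  rw [covOp, real_inner_comm, ← innerSL_apply_apply ℝ,
    ← ContinuousLinearMap.intervalIntegral_comp_comm _ hint]
  refine intervalIntegral.integral_congr fun s _ => ?_
  simp only [innerSL_apply_apply]
  rw [real_inner_comm, hpt]

/-- The covariances `Q_τ`, `τ ≤ T`, in terms of Hilbert-Schmidt factors on a common space. -/
lemma exists_factor (hS : IsC0Semigroup S) (hR : R.IsPositive) (hRQ : R.comp R = Q) {T : ℝ}
    (hT : 0 ≤ T) (htr : HasFiniteTrace (covOp S Q T)) :
    ∃ (J : ℝ → H →L[ℝ] Lp H 2 (volume : Measure ℝ)) (w : Set H) (b : HilbertBasis w ℝ H),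
      (∀ σ τ y z, 0 ≤ σ → σ ≤ τ → ⟪J σ y, J τ z⟫ = ⟪covOp S Q σ y, z⟫) ∧
      (∀ σ τ y, 0 ≤ σ → σ ≤ τ → ‖J σ y‖ ≤ ‖J τ y‖) ∧
      (∀ y, ContinuousOn (fun τ => ‖J τ y‖ ^ 2) (Icc 0 T)) ∧
      ∀ τ ∈ Icc 0 T, Summable fun j => ‖J τ (b j)‖ ^ 2 := by
  obtain ⟨J, hJ⟩ := exists_covFactor hS R
  obtain ⟨w, b, hb⟩ := htr
  have h1 : ∀ σ τ y z, 0 ≤ σ → σ ≤ τ → ⟪J σ y, J τ z⟫ = ⟪covOp S Q σ y, z⟫ :=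
    fun σ τ y z hσ hστ => by rw [inner_covFactor hJ hσ hστ, inner_covOp hS hR hRQ hσ]
  have h2 : ∀ σ τ y, 0 ≤ σ → σ ≤ τ → ‖J σ y‖ ≤ ‖J τ y‖ := fun σ τ y hσ hστ => by
    have h3 : ‖J σ y‖ * ‖J σ y‖ ≤ ‖J σ y‖ * ‖J τ y‖ := by
      rw [← real_inner_self_eq_norm_mul_norm, h1 σ σ y y hσ le_rfl, ← h1 σ τ y y hσ hστ]
      exact real_inner_le_norm _ _
    rcases (norm_nonneg (J σ y)).eq_or_lt' with h0 | h0
    · rw [h0]; exact norm_nonneg _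
    · exact le_of_mul_le_mul_left h3 h0
  refine ⟨J, w, b, h1, h2, fun y => ?_, fun τ hτ => ?_⟩
  · have h3 : ∀ τ ∈ Icc 0 T, ‖J τ y‖ ^ 2
        = ∫ s in (0 : ℝ)..τ, ⟪R (adjoint (S s) y), R (adjoint (S s) y)⟫ := fun τ hτ => by
      rw [← real_inner_self_eq_norm_sq, inner_covFactor hJ hτ.1 le_rfl]
    refine ContinuousOn.congr ?_ h3
    rw [← uIcc_of_le hT]
    refine intervalIntegral.continuousOn_primitive_interval (μ := volume) ?_
    have := (memLp_two_iff_integrable_sq_norm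
      (measurable_indicator_adjoint hS R y T).aestronglyMeasurable).1
      (memLp_indicator_adjoint hS R y T)
    rw [uIcc_of_le hT, integrableOn_Icc_iff_integrableOn_Ioc,
      ← integrable_indicator_iff measurableSet_Ioc]
    refine this.congr (ae_of_all _ fun s => ?_)
    by_cases hs : s ∈ Ioc 0 T
    · simp only [indicator_of_mem hs, real_inner_self_eq_norm_sq]
    · simp [hs]
  · refine hb.of_nonneg_of_le (fun j => by positivity) fun j => ?_
    rw [← h1 T T _ _ hT le_rfl, real_inner_self_eq_norm_sq]
    exact pow_le_pow_left₀ (norm_nonneg _) (h2 _ _ _ hτ.1 hτ.2) 2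

end Covariance

/-! ### The laws of the Ornstein-Uhlenbeck process -/

section Law

variable {H : Type*} [NormedAddCommGroup H] [InnerProductSpace ℝ H] [CompleteSpace H]
  [TopologicalSpace.SeparableSpace H] [MeasurableSpace H] [BorelSpace H]
  {S : ℝ → H →L[ℝ] H} {Q R : H →L[ℝ] H} {T : ℝ}

open ContinuousLinearMap (adjoint)

/-- The standing assumptions on the Ornstein-Uhlenbeck process on `[0, T]`: `S` is a strongly
continuous semigroup, `R` is the positive square root of `Q` and `Q_T` has finite trace. -/
structure IsOUData (S : ℝ → H →L[ℝ] H) (Q R : H →L[ℝ] H) (T : ℝ) : Prop where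
  semigroup : IsC0Semigroup S
  isPositive : R.IsPositive
  comp_self : R.comp R = Q
  pos : 0 < T
  trace : HasFiniteTrace (covOp S Q T)

/-- A finite measure whose characteristic function is that of a Gaussian measure with mean `m` and
covariance `C = J* J` is the measure `𝒩(m, C)`. -/
lemma gaussianMeasure_eq {K : Type*} [NormedAddCommGroup K] [InnerProductSpace ℝ K]
    {m : H} {C : H → H} {J : H →L[ℝ] K} (hC : ∀ y z, ⟪C y, z⟫ = ⟪J y, J z⟫)
    {μ : Measure H} [IsFiniteMeasure μ]
    (hμ : ∀ y, charFun μ y = Complex.exp (⟪y, m⟫ * Complex.I - (‖J y‖ : ℂ) ^ 2 / 2)) :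
    gaussianMeasure m C = μ := by
  have : SecondCountableTopology H := UniformSpace.secondCountable_of_separable H
  let f : H →L[ℝ] H →L[ℝ] ℝ := (innerSL ℝ (E := K)).bilinearComp J J
  have hf : ∀ y z, f y z = ⟪J y, J z⟫ := fun y z => by simp [f]
  have hpos : f.toBilinForm.IsPosSemidef :=
    ⟨⟨fun y z => by simpa [hf] using real_inner_comm _ _⟩, ⟨fun y => by simp [hf]⟩⟩
  have hμ' : ∀ y, charFun μ y = Complex.exp (⟪y, m⟫ * Complex.I - f y y / 2) := fun y => by
    rw [hμ, hf, real_inner_self_eq_norm_sq]; push_cast; rfl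
  have hG : IsGaussianWith m C μ := by
    obtain ⟨h1, h2⟩ := gaussian_charFun_congr m f hpos hμ'
    refine ⟨isGaussian_iff_gaussian_charFun.2 ⟨m, f, hpos, hμ'⟩, h1.symm, fun y z => ?_⟩
    rw [← h2, hf, hC]
  have hex : ∃ μ : Measure H, IsGaussianWith m C μ := ⟨μ, hG⟩
  rw [gaussianMeasure, dif_pos hex]
  obtain ⟨g1, g2, g3⟩ := hex.choose_spec
  obtain ⟨k1, k2, k3⟩ := hG
  refine IsGaussian.ext (by simpa using g2.trans k2.symm) ?_
  ext y z
  rw [g3, k3]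

/-- The Ornstein-Uhlenbeck transition laws are the laws of `S τ x + X τ` for a mean-square
continuous process `X`. -/
theorem IsOUData.exists_process (hd : IsOUData S Q R T) :
    ∃ (ι : Set (Lp H 2 (volume : Measure ℝ))) (P : Measure (ι → ℝ)) (_ : IsProbabilityMeasure P)
      (X : ℝ → Lp H 2 P), ContinuousOn X (Icc 0 T) ∧
      ∀ τ ∈ Icc 0 T, ∀ x, ouLaw S Q τ x = P.map fun ω => S τ x + X τ ω := by
  obtain ⟨J, w, b, h1, h2, h3, h4⟩ :=
    exists_factor hd.semigroup hd.isPositive hd.comp_self hd.pos.le hd.trace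
  obtain ⟨ι, P, hP, W, hW⟩ := exists_isIsonormal (Lp H 2 (volume : Measure ℝ))
  refine ⟨ι, P, hP, fun τ => gaussianVec W b (J τ), fun σ hσ => ?_, fun τ hτ x => ?_⟩
  · have hdiff : ∀ τ ∈ Icc 0 T, ∀ y, ‖(J τ - J σ) y‖ ^ 2 = |‖J τ y‖ ^ 2 - ‖J σ y‖ ^ 2| := by
      have aux : ∀ p q, 0 ≤ p → p ≤ q → ∀ y, ‖(J q - J p) y‖ ^ 2 = ‖J q y‖ ^ 2 - ‖J p y‖ ^ 2 := by
        intro p q hp hpq y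
        rw [_root_.sub_apply, norm_sub_sq_real, real_inner_comm, h1 p q y y hp hpq,
          ← h1 p p y y hp le_rfl, real_inner_self_eq_norm_sq]
        ring
      intro τ hτ y
      have hmono : ∀ p q, 0 ≤ p → p ≤ q → ‖J p y‖ ^ 2 ≤ ‖J q y‖ ^ 2 := fun p q hp hpq =>
        pow_le_pow_left₀ (norm_nonneg _) (h2 p q y hp hpq) 2
      rcases le_total σ τ with h | h
      · rw [aux σ τ hσ.1 h, abs_of_nonneg (sub_nonneg.2 (hmono σ τ hσ.1 h))]
      · rw [← neg_sub (J σ), _root_.neg_apply, norm_neg, aux τ σ hτ.1 h, abs_sub_comm,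
          abs_of_nonneg (sub_nonneg.2 (hmono τ σ hτ.1 h))]
    have hsum : ∀ τ ∈ Icc 0 T, ‖gaussianVec W b (J τ) - gaussianVec W b (J σ)‖ ^ 2
        = ∑' j, |‖J τ (b j)‖ ^ 2 - ‖J σ (b j)‖ ^ 2| := fun τ hτ => by
      have hs : Summable fun j => ‖(J τ - J σ) (b j)‖ ^ 2 := by
        simp only [hdiff τ hτ]
        exact ((h4 τ hτ).sub (h4 σ hσ)).abs
      rw [gaussianVec_sub (h4 τ hτ) (h4 σ hσ), norm_sq_gaussianVec hs]
      exact tsum_congr fun j => hdiff τ hτ _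
    have hlim : Tendsto (fun τ => ∑' j, |‖J τ (b j)‖ ^ 2 - ‖J σ (b j)‖ ^ 2|) (𝓝[Icc 0 T] σ)
        (𝓝 (∑' _ : w, (0 : ℝ))) := by
      refine tendsto_tsum_of_dominated_convergence (bound := fun j => ‖J T (b j)‖ ^ 2)
        (h4 T ⟨hd.pos.le, le_rfl⟩) (fun j => ?_) ?_
      · have := (((h3 (b j)) σ hσ).sub_const (‖J σ (b j)‖ ^ 2)).abs
        simpa using this
      · filter_upwards [self_mem_nhdsWithin] with τ hτ j
        have e1 := pow_le_pow_left₀ (norm_nonneg _) (h2 τ T (b j) hτ.1 hτ.2) 2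
        have e2 := pow_le_pow_left₀ (norm_nonneg _) (h2 σ T (b j) hσ.1 hσ.2) 2
        rw [Real.norm_eq_abs, abs_abs, abs_le]
        constructor <;> nlinarith [sq_nonneg ‖J τ (b j)‖, sq_nonneg ‖J σ (b j)‖]
    rw [tsum_zero] at hlim
    rw [ContinuousWithinAt, tendsto_iff_norm_sub_tendsto_zero]
    have h5 : Tendsto (fun τ => √(‖gaussianVec W b (J τ) - gaussianVec W b (J σ)‖ ^ 2))
        (𝓝[Icc 0 T] σ) (𝓝 (√0)) := by
      refine (Real.continuous_sqrt.tendsto 0).comp (hlim.congr' ?_)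
      filter_upwards [self_mem_nhdsWithin] with τ hτ using (hsum τ hτ).symm
    simpa [Real.sqrt_sq] using h5
  · have hX : AEMeasurable (gaussianVec W b (J τ)) P := (Lp.aestronglyMeasurable _).aemeasurable
    have : SecondCountableTopology H := UniformSpace.secondCountable_of_separable H
    have hX' : AEMeasurable (fun ω => S τ x + gaussianVec W b (J τ) ω) P := hX.const_add _
    have : IsProbabilityMeasure (P.map fun ω => S τ x + gaussianVec W b (J τ) ω) :=
      Measure.isProbabilityMeasure_map hX'
    refine gaussianMeasure_eq (J := J τ) (fun y z => (h1 τ τ y z hτ.1 le_rfl).symm) fun y => ?_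
    have hmap : (P.map fun ω => S τ x + gaussianVec W b (J τ) ω)
        = (P.map (gaussianVec W b (J τ))).map (S τ x + ·) :=
      (AEMeasurable.map_map_of_aemeasurable (by fun_prop) hX).symm
    rw [hmap, charFun_map_const_add, charFun_map_gaussianVec hW (h4 τ hτ), ← Complex.exp_add,
      real_inner_comm]
    congr 1
    ring

lemma IsOUData.isProbabilityMeasure (hd : IsOUData S Q R T) {τ : ℝ} (hτ : τ ∈ Icc 0 T) (x : H) :
    IsProbabilityMeasure (ouLaw S Q τ x) := by
  have : SecondCountableTopology H := UniformSpace.secondCountable_of_separable H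
  obtain ⟨ι, P, hP, X, -, hX⟩ := hd.exists_process
  rw [hX τ hτ]
  exact Measure.isProbabilityMeasure_map ((Lp.aestronglyMeasurable _).aemeasurable.const_add _)

lemma IsOUData.charFun_ouLaw (hd : IsOUData S Q R T) {τ : ℝ} (hτ : τ ∈ Icc 0 T) (x y : H) :
    charFun (ouLaw S Q τ x) y
      = Complex.exp (⟪S τ x, y⟫ * Complex.I - ⟪covOp S Q τ y, y⟫ / 2) := by
  obtain ⟨J, w, b, h1, h2, h3, h4⟩ :=
    exists_factor hd.semigroup hd.isPositive hd.comp_self hd.pos.le hd.trace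
  obtain ⟨ν, hν, hνc⟩ := exists_measure_charFun_eq b (J τ) (h4 τ hτ)
  have : SecondCountableTopology H := UniformSpace.secondCountable_of_separable H
  have : IsProbabilityMeasure (ν.map (S τ x + ·)) :=
    Measure.isProbabilityMeasure_map (by fun_prop)
  have hc : ∀ y, charFun (ν.map (S τ x + ·)) y
      = Complex.exp (⟪y, S τ x⟫ * Complex.I - (‖J τ y‖ : ℂ) ^ 2 / 2) := fun y => by
    rw [charFun_map_const_add, hνc, ← Complex.exp_add, real_inner_comm]
    congr 1
    ring
  rw [ouLaw, gaussianMeasure_eq (fun y z => (h1 τ τ y z hτ.1 le_rfl).symm) hc, hc,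
    ← h1 τ τ y y hτ.1 le_rfl, real_inner_self_eq_norm_sq, real_inner_comm]
  push_cast
  rfl

lemma IsOUData.ouLaw_eq_map (hd : IsOUData S Q R T) {τ : ℝ} (hτ : τ ∈ Icc 0 T) (x : H) :
    ouLaw S Q τ x = (ouLaw S Q τ 0).map (S τ x + ·) := by
  have : SecondCountableTopology H := UniformSpace.secondCountable_of_separable H
  have := hd.isProbabilityMeasure hτ x
  have := hd.isProbabilityMeasure hτ 0
  have : IsProbabilityMeasure ((ouLaw S Q τ 0).map (S τ x + ·)) :=
    Measure.isProbabilityMeasure_map (by fun_prop)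
  refine Measure.ext_of_charFun (funext fun y => ?_)
  rw [charFun_map_const_add, hd.charFun_ouLaw hτ, hd.charFun_ouLaw hτ, ← Complex.exp_add, map_zero,
    inner_zero_left]
  congr 1
  push_cast
  ring

lemma IsOUData.ouSemigroup_eq_zero (hd : IsOUData S Q R T) {τ : ℝ} (hτ : τ ∈ Icc 0 T)
    {f : H → ℝ} (hf : Measurable f) (x : H) :
    ouSemigroup S Q τ f x = ouSemigroup S Q τ (fun y => f (S τ x + y)) 0 := by
  have : SecondCountableTopology H := UniformSpace.secondCountable_of_separable H
  rw [ouSemigroup, hd.ouLaw_eq_map hτ, integral_map (by fun_prop) hf.aestronglyMeasurable]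
  rfl

lemma IsOUData.inner_covOp_add (hd : IsOUData S Q R T) {σ τ : ℝ} (hσ : 0 ≤ σ) (hτ : 0 ≤ τ) (y : H) :
    ⟪covOp S Q (τ + σ) y, y⟫
      = ⟪covOp S Q σ y, y⟫ + ⟪covOp S Q τ (adjoint (S σ) y), adjoint (S σ) y⟫ := by
  have hS := hd.semigroup
  rw [inner_covOp hS hd.isPositive hd.comp_self (add_nonneg hτ hσ),
    inner_covOp hS hd.isPositive hd.comp_self hσ, inner_covOp hS hd.isPositive hd.comp_self hτ]
  have hint : ∀ a b, 0 ≤ a → a ≤ b → IntervalIntegrable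
      (fun s => ⟪R (adjoint (S s) y), R (adjoint (S s) y)⟫) volume a b := fun a b ha hab => by
    rw [intervalIntegrable_iff_integrableOn_Ioc_of_le hab]
    refine IntegrableOn.mono_set ?_ (Ioc_subset_Ioc_left ha)
    have := (memLp_two_iff_integrable_sq_norm
      (measurable_indicator_adjoint hS R y b).aestronglyMeasurable).1
      (memLp_indicator_adjoint hS R y b)
    rw [← integrable_indicator_iff measurableSet_Ioc]
    refine this.congr (ae_of_all _ fun s => ?_)
    by_cases hs : s ∈ Ioc 0 b
    · simp only [indicator_of_mem hs, real_inner_self_eq_norm_sq]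
    · simp [hs]
  rw [← intervalIntegral.integral_add_adjacent_intervals (hint 0 σ le_rfl hσ)
    (hint σ (τ + σ) hσ (by linarith))]
  congr 1
  have := intervalIntegral.integral_comp_add_right (a := 0) (b := τ)
    (fun s => ⟪R (adjoint (S s) y), R (adjoint (S s) y)⟫) σ
  rw [zero_add] at this
  rw [← this]
  refine intervalIntegral.integral_congr fun s hs => ?_
  rw [uIcc_of_le hτ] at hs
  have h1 : adjoint (S (s + σ)) y = adjoint (S s) (adjoint (S σ) y) := by
    rw [add_comm, hS.add σ s hσ hs.1, ContinuousLinearMap.adjoint_comp,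
      ContinuousLinearMap.comp_apply]
  simp only [h1]

/-- The Chapman-Kolmogorov equation of the Ornstein-Uhlenbeck process. -/
lemma IsOUData.ouLaw_add (hd : IsOUData S Q R T) {σ τ : ℝ} (hσ : 0 ≤ σ) (hτ : 0 ≤ τ)
    (hT : τ + σ ≤ T) (x : H) :
    ouLaw S Q (τ + σ) x
      = ((ouLaw S Q τ x).prod (ouLaw S Q σ 0)).map fun p => S σ p.1 + p.2 := by
  have : SecondCountableTopology H := UniformSpace.secondCountable_of_separable H
  have hσ' : σ ∈ Icc 0 T := ⟨hσ, by linarith⟩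
  have hτ' : τ ∈ Icc 0 T := ⟨hτ, by linarith⟩
  have hadd : τ + σ ∈ Icc 0 T := ⟨by linarith, hT⟩
  have := hd.isProbabilityMeasure hσ' 0
  have := hd.isProbabilityMeasure hτ' x
  have := hd.isProbabilityMeasure hadd x
  have : IsProbabilityMeasure ((ouLaw S Q τ x).map (S σ)) :=
    Measure.isProbabilityMeasure_map (by fun_prop)
  have hmap : ((ouLaw S Q τ x).prod (ouLaw S Q σ 0)).map (fun p => S σ p.1 + p.2)
      = (((ouLaw S Q τ x).map (S σ)).prod (ouLaw S Q σ 0)).map fun p => p.1 + p.2 := by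
    have h1 := Measure.map_prod_map (ouLaw S Q τ x) (ouLaw S Q σ 0)
      (f := S σ) (g := id) (by fun_prop) measurable_id
    rw [Measure.map_id] at h1
    rw [h1, Measure.map_map (by fun_prop) (by fun_prop)]
    rfl
  have : IsProbabilityMeasure
      ((((ouLaw S Q τ x).map (S σ)).prod (ouLaw S Q σ 0)).map fun p => p.1 + p.2) :=
    Measure.isProbabilityMeasure_map (by fun_prop)
  rw [hmap]
  refine Measure.ext_of_charFun (funext fun y => ?_)
  have h2 : charFun ((ouLaw S Q τ x).map (S σ)) y = charFun (ouLaw S Q τ x) (adjoint (S σ) y) := by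
    rw [charFun_apply, charFun_apply, integral_map (by fun_prop)
      (Continuous.aestronglyMeasurable (by fun_prop))]
    simp only [ContinuousLinearMap.adjoint_inner_right]
  rw [charFun_map_add_prod_eq_mul, Pi.mul_apply, h2, hd.charFun_ouLaw hadd, hd.charFun_ouLaw hτ',
    hd.charFun_ouLaw hσ', ← Complex.exp_add, hd.inner_covOp_add hσ hτ, map_zero, inner_zero_left,
    ContinuousLinearMap.adjoint_inner_right (S σ) (S τ x) y, add_comm τ σ, hd.semigroup.add σ τ hσ hτ,
    ContinuousLinearMap.comp_apply]
  congr 1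
  push_cast
  ring

lemma IsOUData.ouSemigroup_add (hd : IsOUData S Q R T) {σ τ : ℝ} (hσ : 0 ≤ σ) (hτ : 0 ≤ τ)
    (hT : τ + σ ≤ T) {f : H → ℝ} (hf : Measurable f) {B : ℝ} (hB : ∀ x, |f x| ≤ B) (x : H) :
    ouSemigroup S Q (τ + σ) f x = ouSemigroup S Q τ (ouSemigroup S Q σ f) x := by
  have : SecondCountableTopology H := UniformSpace.secondCountable_of_separable H
  have hσ' : σ ∈ Icc 0 T := ⟨hσ, by linarith⟩
  have hτ' : τ ∈ Icc 0 T := ⟨hτ, by linarith⟩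
  have := hd.isProbabilityMeasure hσ' 0
  have := hd.isProbabilityMeasure hτ' x
  rw [ouSemigroup, hd.ouLaw_add hσ hτ hT, integral_map (by fun_prop) hf.aestronglyMeasurable,
    integral_prod]
  · refine integral_congr_ae (ae_of_all _ fun y => ?_)
    exact (hd.ouSemigroup_eq_zero hσ' hf y).symm
  · exact Integrable.of_bound (hf.comp (by fun_prop)).aestronglyMeasurable B
      (ae_of_all _ fun p => hB _)

/-- If `|⟪h, y⟫| ≤ m √⟪Q_τ y, y⟫`, then the Ornstein-Uhlenbeck law at time `τ` has an independent
one-dimensional Gaussian component in the direction of `h`, in which `h` has size at most `m`. -/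
lemma IsOUData.exists_split (hd : IsOUData S Q R T) {τ : ℝ} (hτ : τ ∈ Icc 0 T) {h : H} {m : ℝ}
    (hm : 0 ≤ m) (hb : ∀ y, |⟪h, y⟫| ≤ m * √⟪covOp S Q τ y, y⟫) :
    ∃ (ν : Measure H) (v : H) (s : ℝ), IsProbabilityMeasure ν ∧ 0 ≤ s ∧ s ≤ m ∧ h = s • v ∧
      ouLaw S Q τ 0 = ((gaussianReal 0 1).prod ν).map fun p => p.1 • v + p.2 := by
  have : SecondCountableTopology H := UniformSpace.secondCountable_of_separable H
  obtain ⟨J, w, b, h1, h2, h3, h4⟩ :=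
    exists_factor hd.semigroup hd.isPositive hd.comp_self hd.pos.le hd.trace
  obtain ⟨ν, v, s, hν, hs0, hsm, hhs, hc⟩ := SemilinearKolmogorov.exists_split b (J τ) (h4 τ hτ) hm
    (h := h) fun y => by
      have := hb y
      rwa [← h1 τ τ y y hτ.1 le_rfl, real_inner_self_eq_norm_sq, Real.sqrt_sq (norm_nonneg _)] at this
  refine ⟨ν, v, s, hν, hs0, hsm, hhs, ?_⟩
  have := hd.isProbabilityMeasure hτ 0
  have hL : Continuous fun z : ℝ => z • v := by fun_prop
  have : IsProbabilityMeasure ((gaussianReal 0 1).map fun z : ℝ => z • v) :=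
    Measure.isProbabilityMeasure_map (by fun_prop)
  have hmap : ((gaussianReal 0 1).prod ν).map (fun p : ℝ × H => p.1 • v + p.2)
      = (((gaussianReal 0 1).map fun z : ℝ => z • v).prod ν).map fun p => p.1 + p.2 := by
    have h1 := Measure.map_prod_map (gaussianReal 0 1) ν
      (f := fun z : ℝ => z • v) (g := id) (by fun_prop) measurable_id
    rw [Measure.map_id] at h1
    rw [h1, Measure.map_map (by fun_prop) (by fun_prop)]
    rfl
  have : IsProbabilityMeasure
      ((((gaussianReal 0 1).map fun z : ℝ => z • v).prod ν).map fun p => p.1 + p.2) :=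
    Measure.isProbabilityMeasure_map (by fun_prop)
  rw [hmap]
  refine Measure.ext_of_charFun (funext fun y => ?_)
  have h5 : charFun ((gaussianReal 0 1).map fun z : ℝ => z • v) y
      = Complex.exp (-(⟪v, y⟫ : ℂ) ^ 2 / 2) := by
    have h6 := charFun_gaussianReal (μ := 0) (v := 1) ⟪v, y⟫
    rw [charFun_apply_real] at h6
    rw [charFun_apply, integral_map (by fun_prop) (Continuous.aestronglyMeasurable (by fun_prop))]
    rw [show Complex.exp (-(⟪v, y⟫ : ℂ) ^ 2 / 2)
      = Complex.exp (⟪v, y⟫ * (0 : ℝ) * Complex.I - (1 : NNReal) * ⟪v, y⟫ ^ 2 / 2) by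
        congr 1; simp [neg_div], ← h6]
    refine integral_congr_ae (ae_of_all _ fun z => ?_)
    simp only [real_inner_smul_left]
    push_cast
    ring_nf
  rw [charFun_map_add_prod_eq_mul, Pi.mul_apply, h5, hc, hd.charFun_ouLaw hτ,
    ← h1 τ τ y y hτ.1 le_rfl, real_inner_self_eq_norm_sq, map_zero, inner_zero_left]
  congr 1
  push_cast
  ring

end Law

/-! ### Translation of one-dimensional Gaussian components -/

section Translation

lemma abs_integral_mul_le_sqrt_mul_sqrt {Ω : Type*} [MeasurableSpace Ω] {μ : Measure Ω}
    {f g : Ω → ℝ} (hf : MemLp f 2 μ) (hg : MemLp g 2 μ) :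
    |∫ ω, f ω * g ω ∂μ| ≤ √(∫ ω, f ω ^ 2 ∂μ) * √(∫ ω, g ω ^ 2 ∂μ) := by
  have key : ∀ {u v : Ω → ℝ} (hu : MemLp u 2 μ) (hv : MemLp v 2 μ),
      ⟪hu.toLp, hv.toLp⟫ = ∫ ω, u ω * v ω ∂μ := fun {u v} hu hv => by
    rw [L2.inner_def]
    refine integral_congr_ae ?_
    filter_upwards [hu.coeFn_toLp, hv.coeFn_toLp] with ω h1 h2
    rw [h1, h2]
    simp [mul_comm]
  have hn : ∀ {u : Ω → ℝ} (hu : MemLp u 2 μ), ‖hu.toLp‖ = √(∫ ω, u ω ^ 2 ∂μ) := fun {u} hu => by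
    rw [← Real.sqrt_sq (norm_nonneg (MemLp.toLp u hu)), ← real_inner_self_eq_norm_sq, key hu hu]
    simp only [pow_two]
  rw [← key hf hg, ← hn hf, ← hn hg]
  exact abs_real_inner_le_norm _ _

/-- The one-dimensional Cameron-Martin formula. -/
lemma integral_gaussianReal_add (g : ℝ → ℝ) (s : ℝ) :
    ∫ z, g (z + s) ∂(gaussianReal 0 1)
      = ∫ z, g z * Real.exp (s * z - s ^ 2 / 2) ∂(gaussianReal 0 1) := by
  rw [integral_gaussianReal_eq_integral_smul one_ne_zero,
    integral_gaussianReal_eq_integral_smul one_ne_zero,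
    ← integral_sub_right_eq_self _ s]
  refine integral_congr_ae (ae_of_all _ fun z => ?_)
  simp only [sub_add_cancel, smul_eq_mul]
  have : gaussianPDFReal 0 1 (z - s) = gaussianPDFReal 0 1 z * Real.exp (s * z - s ^ 2 / 2) := by
    rw [gaussianPDFReal, gaussianPDFReal, mul_assoc (√_)⁻¹, ← Real.exp_add]
    congr 2
    simp
    ring
  rw [this]
  ring

lemma integrable_exp_sub (s : ℝ) :
    Integrable (fun z => Real.exp (s * z - s ^ 2 / 2)) (gaussianReal 0 1) := by
  simp only [Real.exp_sub]
  exact (integrable_exp_mul_gaussianReal s).div_const _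

lemma integral_exp_sub (s : ℝ) : ∫ z, Real.exp (s * z - s ^ 2 / 2) ∂(gaussianReal 0 1) = 1 := by
  have := integral_gaussianReal_add (fun _ => 1) s
  simpa using this.symm

lemma memLp_exp_sub (s : ℝ) :
    MemLp (fun z => Real.exp (s * z - s ^ 2 / 2)) 2 (gaussianReal 0 1) := by
  rw [memLp_two_iff_integrable_sq (by fun_prop)]
  refine ((integrable_exp_sub (2 * s)).mul_const (Real.exp (s ^ 2))).congr (ae_of_all _ fun z => ?_)
  simp only [← Real.exp_add, ← Real.exp_nat_mul]
  congr 1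
  push_cast
  ring

lemma integral_exp_sub_sub_one_sq (s : ℝ) :
    ∫ z, (Real.exp (s * z - s ^ 2 / 2) - 1) ^ 2 ∂(gaussianReal 0 1) = Real.exp (s ^ 2) - 1 := by
  have h1 : ∀ z : ℝ, (Real.exp (s * z - s ^ 2 / 2) - 1) ^ 2
      = Real.exp (2 * s * z - (2 * s) ^ 2 / 2) * Real.exp (s ^ 2)
        - 2 * Real.exp (s * z - s ^ 2 / 2) + 1 := fun z => by
    rw [sub_sq, ← Real.exp_add, ← Real.exp_nat_mul]
    ring_nf
  simp only [h1]
  rw [integral_add, integral_sub, integral_mul_const, integral_exp_sub, integral_const_mul,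
    integral_exp_sub]
  · simp; ring
  · exact (integrable_exp_sub _).mul_const _
  · exact (integrable_exp_sub _).const_mul _
  · exact ((integrable_exp_sub _).mul_const _).sub ((integrable_exp_sub _).const_mul _)
  · exact integrable_const _

/-- Translating the Gaussian coordinate by `s` changes the mean of a bounded function by at most
`√(e^{s²} - 1)` times its `L²`-norm. -/
lemma abs_integral_translate_sub_le {E : Type*} [MeasurableSpace E] {ν : Measure E}
    [IsProbabilityMeasure ν] {g : ℝ × E → ℝ} (hg : Measurable g) {B : ℝ} (hB : ∀ p, |g p| ≤ B)
    (s : ℝ) :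
    |∫ p, g (p.1 + s, p.2) ∂((gaussianReal 0 1).prod ν) - ∫ p, g p ∂((gaussianReal 0 1).prod ν)|
      ≤ √(∫ p, g p ^ 2 ∂((gaussianReal 0 1).prod ν)) * √(Real.exp (s ^ 2) - 1) := by
  set γ := gaussianReal 0 1
  have hgL : MemLp g 2 (γ.prod ν) := MemLp.of_bound hg.aestronglyMeasurable B (ae_of_all _ hB)
  have hE : MemLp (fun p : ℝ × E => Real.exp (s * p.1 - s ^ 2 / 2)) 2 (γ.prod ν) :=
    (memLp_exp_sub s).comp_fst ν
  have hE1 : MemLp (fun p : ℝ × E => Real.exp (s * p.1 - s ^ 2 / 2) - 1) 2 (γ.prod ν) :=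
    hE.sub (memLp_const 1)
  have hgE : Integrable (fun p : ℝ × E => g p * Real.exp (s * p.1 - s ^ 2 / 2)) (γ.prod ν) :=
    hgL.integrable_mul hE
  have h1 : ∫ p, g (p.1 + s, p.2) ∂(γ.prod ν)
      = ∫ p, g p * Real.exp (s * p.1 - s ^ 2 / 2) ∂(γ.prod ν) := by
    rw [integral_prod_symm _ hgE, integral_prod_symm]
    · exact integral_congr_ae (ae_of_all _ fun y => integral_gaussianReal_add (fun z => g (z, y)) s)
    · exact Integrable.of_bound (hg.comp (by fun_prop)).aestronglyMeasurable B
        (ae_of_all _ fun p => hB _)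
  have h2 : ∫ p, (Real.exp (s * p.1 - s ^ 2 / 2) - 1) ^ 2 ∂(γ.prod ν) = Real.exp (s ^ 2) - 1 := by
    rw [integral_fun_fst (μ := γ) (ν := ν) (fun z => (Real.exp (s * z - s ^ 2 / 2) - 1) ^ 2),
      integral_exp_sub_sub_one_sq]
    simp
  rw [h1, ← integral_sub hgE (hgL.integrable one_le_two), ← h2]
  refine le_trans (le_of_eq ?_) (abs_integral_mul_le_sqrt_mul_sqrt hgL hE1)
  congr 1
  refine integral_congr_ae (ae_of_all _ fun p => ?_)
  simp only
  ring

lemma sqrt_exp_sq_sub_one_le {s : ℝ} (hs : |s| ≤ 1) : √(Real.exp (s ^ 2) - 1) ≤ 2 * |s| := by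
  have h0 : |s ^ 2| ≤ 1 := by
    rw [abs_pow]; exact pow_le_one₀ (abs_nonneg _) hs
  have h1 : |Real.exp (s ^ 2) - 1| ≤ 2 * |s ^ 2| := Real.abs_exp_sub_one_le h0
  refine Real.sqrt_le_iff.2 ⟨by positivity, ?_⟩
  rw [mul_pow, sq_abs]
  rw [abs_of_nonneg (sq_nonneg s)] at h1
  nlinarith [(abs_le.1 h1).2, sq_nonneg s]

end Translation

section Smoothing

variable {H : Type*} [NormedAddCommGroup H] [InnerProductSpace ℝ H] [CompleteSpace H]
  [TopologicalSpace.SeparableSpace H] [MeasurableSpace H] [BorelSpace H]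
  {S : ℝ → H →L[ℝ] H} {Q R : H →L[ℝ] H} {T α : ℝ}

lemma abs_integral_le_of_abs_le {E : Type*} [MeasurableSpace E] {μ : Measure E}
    [IsProbabilityMeasure μ] {f : E → ℝ} {B : ℝ}
    (hB : ∀ x, |f x| ≤ B) : |∫ y, f y ∂μ| ≤ B := by
  simpa using norm_integral_le_of_norm_le_const (μ := μ) (f := f) (ae_of_all _ hB)

/-! ### The strong form of the smoothing property -/

/-- Testing the smoothing property on `sin (λ ⟪·, y⟫)` and optimizing over `λ` shows that the range
of `S τ R` lies in the Cameron-Martin space of the Ornstein-Uhlenbeck law at time `τ`. -/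
lemma IsOUData.abs_inner_le_of_smoothing (hd : IsOUData S Q R T) {τ : ℝ} (hτ : τ ∈ Ioc 0 T) {c : ℝ}
    (hc : ∀ (φ : BoundedContinuousFunction H ℝ) (x : H),
      ∃ g : H, HasGradAlong R (ouSemigroup S Q τ φ) g x ∧ ∀ ξ : H, |⟪g, ξ⟫| ≤ c * ‖φ‖ * ‖ξ‖)
    (hc0 : 0 ≤ c) (ξ y : H) :
    |⟪S τ (R ξ), y⟫| ≤ Real.exp (1 / 2) * c * ‖ξ‖ * √⟪covOp S Q τ y, y⟫ := by
  have : SecondCountableTopology H := UniformSpace.secondCountable_of_separable H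
  have hτ' : τ ∈ Icc 0 T := ⟨hτ.1.le, hτ.2⟩
  set q := ⟪covOp S Q τ y, y⟫ with hq
  have hq0 : 0 ≤ q := by
    obtain ⟨J, w, b, h1, -⟩ :=
      exists_factor hd.semigroup hd.isPositive hd.comp_self hd.pos.le hd.trace
    rw [hq, ← h1 τ τ y y hτ'.1 le_rfl]
    exact real_inner_self_nonneg
  have key : ∀ lam : ℝ, |lam| * |⟪S τ (R ξ), y⟫| * Real.exp (-(lam ^ 2 * q / 2)) ≤ c * ‖ξ‖ := by
    intro lam
    let φ : BoundedContinuousFunction H ℝ := BoundedContinuousFunction.ofNormedAddCommGroup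
      (fun z => Real.sin (lam * ⟪z, y⟫)) (by fun_prop) 1 fun z => Real.abs_sin_le_one _
    have hφ : ‖φ‖ ≤ 1 := BoundedContinuousFunction.norm_ofNormedAddCommGroup_le (by fun_prop) zero_le_one
      fun z => Real.abs_sin_le_one _
    have hP : ∀ x, ouSemigroup S Q τ φ x
        = Real.sin (lam * ⟪S τ x, y⟫) * Real.exp (-(lam ^ 2 * q / 2)) := fun x => by
      have := hd.isProbabilityMeasure hτ' x
      have h1 := hd.charFun_ouLaw hτ' x (lam • y)
      obtain ⟨J, w, b, hJ, -⟩ :=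
        exists_factor hd.semigroup hd.isPositive hd.comp_self hd.pos.le hd.trace
      rw [charFun_apply, ← hJ τ τ _ _ hτ'.1 le_rfl, map_smul, real_inner_smul_right,
        real_inner_smul_left, real_inner_smul_right, hJ τ τ _ _ hτ'.1 le_rfl, ← hq] at h1
      have h2 : Integrable (fun z => Complex.exp (((lam * ⟪z, y⟫ : ℝ) : ℂ) * Complex.I))
          (ouLaw S Q τ x) :=
        Integrable.of_bound (Continuous.aestronglyMeasurable (by fun_prop)) 1
          (ae_of_all _ fun z => by rw [Complex.norm_exp_ofReal_mul_I])
      have h3 : ouSemigroup S Q τ φ x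
          = (∫ z, Complex.exp (((lam * ⟪z, y⟫ : ℝ) : ℂ) * Complex.I) ∂(ouLaw S Q τ x)).im := by
        rw [← RCLike.im_eq_complex_im, ← integral_im h2]
        refine integral_congr_ae (ae_of_all _ fun z => ?_)
        simp only [RCLike.im_eq_complex_im, Complex.exp_ofReal_mul_I_im]
        rfl
      simp only [real_inner_smul_right] at h1
      rw [h3, h1, show ((lam * ⟪S τ x, y⟫ : ℝ) : ℂ) * Complex.I - ((lam * (lam * q) : ℝ) : ℂ) / 2
        = ((-(lam ^ 2 * q / 2) : ℝ) : ℂ) + ((lam * ⟪S τ x, y⟫ : ℝ) : ℂ) * Complex.I by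
          push_cast; ring, Complex.exp_add, ← Complex.ofReal_exp, Complex.im_ofReal_mul,
        Complex.exp_ofReal_mul_I_im, mul_comm]
    obtain ⟨g, hg, hgb⟩ := hc φ 0
    have hder : HasLineDerivAt ℝ (ouSemigroup S Q τ φ)
        (lam * ⟪S τ (R ξ), y⟫ * Real.exp (-(lam ^ 2 * q / 2))) 0 (R ξ) := by
      rw [show ouSemigroup S Q τ φ = _ from funext hP, HasLineDerivAt]
      have h1 : HasDerivAt (fun t : ℝ => lam * (t * ⟪S τ (R ξ), y⟫)) (lam * ⟪S τ (R ξ), y⟫) 0 := by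
        simpa using ((hasDerivAt_id (0 : ℝ)).mul_const ⟪S τ (R ξ), y⟫).const_mul lam
      have h2 := (h1.sin).mul_const (Real.exp (-(lam ^ 2 * q / 2)))
      simpa [real_inner_smul_left] using h2
    have heq : ⟪g, ξ⟫ = lam * ⟪S τ (R ξ), y⟫ * Real.exp (-(lam ^ 2 * q / 2)) :=
      HasDerivAt.unique (hg ξ) hder
    have h4 := hgb ξ
    rw [heq, abs_mul, abs_mul, abs_of_pos (Real.exp_pos _)] at h4
    refine h4.trans (mul_le_mul_of_nonneg_right ?_ (norm_nonneg _))
    exact mul_le_of_le_one_right hc0 hφ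
  rcases hq0.eq_or_lt' with h0 | h0
  · -- the degenerate case: let `lam → ∞`
    rw [h0, Real.sqrt_zero, mul_zero]
    by_contra! hlt
    have h1 := key ((c * ‖ξ‖ + 1) / |⟪S τ (R ξ), y⟫|)
    rw [h0, mul_zero, zero_div, neg_zero, Real.exp_zero, mul_one, abs_div, abs_abs,
      div_mul_cancel₀ _ hlt.ne', abs_of_nonneg (by positivity)] at h1
    linarith
  · -- the optimal `lam`
    have hs : 0 < √q := Real.sqrt_pos.2 h0
    have h1 := key (1 / √q)
    rw [div_pow, one_pow, Real.sq_sqrt hq0, div_mul_cancel₀ _ h0.ne', abs_of_pos (by positivity),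
      Real.exp_neg, one_div_mul_eq_div, ← div_eq_mul_inv, div_div, div_le_iff₀ (by positivity)] at h1
    linarith

/-- The smoothing property for bounded Borel functions: the increments of `P_τ f` in the directions
`R ξ` are controlled by the supremum of `f` and, for small increments, by its `L²`-norm with respect
to the transition law. -/
theorem IsOUData.exists_smoothing_const (hd : IsOUData S Q R T) (hsm : IsSmoothing S Q R T α) :
    ∃ M : ℝ, 0 < M ∧ ∀ τ ∈ Ioc 0 T, ∀ f : H → ℝ, Measurable f → ∀ B, (∀ x, |f x| ≤ B) → ∀ x ξ : H,
      (∀ r : ℝ, |ouSemigroup S Q τ f (x + r • R ξ) - ouSemigroup S Q τ f x|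
        ≤ M / τ ^ α * B * ‖ξ‖ * |r|) ∧
      ∀ᶠ r : ℝ in 𝓝 0, |ouSemigroup S Q τ f (x + r • R ξ) - ouSemigroup S Q τ f x|
        ≤ M / τ ^ α * √(ouSemigroup S Q τ (fun y => f y ^ 2) x) * ‖ξ‖ * |r| := by
  have : SecondCountableTopology H := UniformSpace.secondCountable_of_separable H
  obtain ⟨c, hc0, hc⟩ := hsm
  refine ⟨2 * (Real.exp (1 / 2) * c), by positivity, fun τ hτ f hf B hB x ξ => ?_⟩
  have hτ' : τ ∈ Icc 0 T := ⟨hτ.1.le, hτ.2⟩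
  have hτα : 0 < τ ^ α := Real.rpow_pos_of_pos hτ.1 _
  have hB0 : 0 ≤ B := (abs_nonneg _).trans (hB 0)
  set m := Real.exp (1 / 2) * (c / τ ^ α) * ‖ξ‖ with hm
  have hm0 : 0 ≤ m := by positivity
  obtain ⟨ν, v, s, hν, hs0, hsm, hsv, hlaw⟩ := hd.exists_split hτ' hm0
    (hd.abs_inner_le_of_smoothing hτ (hc · τ hτ.1 hτ.2) (by positivity) ξ)
  let g : ℝ × H → ℝ := fun p => f (S τ x + (p.1 • v + p.2))
  have hg : Measurable g := hf.comp (by fun_prop)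
  have hP : ∀ (F : H → ℝ), Measurable F → ∀ r : ℝ, ouSemigroup S Q τ F (x + r • R ξ)
      = ∫ p, F (S τ x + ((p.1 + r * s) • v + p.2)) ∂((gaussianReal 0 1).prod ν) := fun F hF r => by
    have hF' : Measurable fun y => F (S τ (x + r • R ξ) + y) := hF.comp (by fun_prop)
    rw [hd.ouSemigroup_eq_zero hτ' hF, ouSemigroup, hlaw, integral_map (by fun_prop)
      hF'.aestronglyMeasurable]
    refine integral_congr_ae (ae_of_all _ fun p => ?_)
    simp only [map_add, map_smul, hsv]
    congr 1
    module
  have hP0 : ∀ (F : H → ℝ), Measurable F → ouSemigroup S Q τ F x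
      = ∫ p, F (S τ x + (p.1 • v + p.2)) ∂((gaussianReal 0 1).prod ν) := fun F hF => by
    simpa using hP F hF 0
  have hmain : ∀ r : ℝ, |r| * m ≤ 1 → |ouSemigroup S Q τ f (x + r • R ξ) - ouSemigroup S Q τ f x|
      ≤ 2 * m * √(ouSemigroup S Q τ (fun y => f y ^ 2) x) * |r| := fun r hr => by
    have h1 := abs_integral_translate_sub_le (ν := ν) hg (fun p => hB _) (r * s)
    have h2 : |r * s| ≤ |r| * m := by
      rw [abs_mul, abs_of_nonneg hs0]; exact mul_le_mul_of_nonneg_left hsm (abs_nonneg _)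
    rw [hP f hf, hP0 f hf, hP0 _ (hf.pow_const 2)]
    refine h1.trans ?_
    rw [mul_comm]
    calc √(Real.exp ((r * s) ^ 2) - 1) * √(∫ p, g p ^ 2 ∂((gaussianReal 0 1).prod ν))
        ≤ 2 * (|r| * m) * √(∫ p, g p ^ 2 ∂((gaussianReal 0 1).prod ν)) := by
          gcongr
          exact (sqrt_exp_sq_sub_one_le (h2.trans hr)).trans (by linarith)
      _ = _ := by ring
  have hsup : ∀ y, |ouSemigroup S Q τ f y| ≤ B := fun y => by
    have := hd.isProbabilityMeasure hτ' y
    exact abs_integral_le_of_abs_le hB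
  have hsq : √(ouSemigroup S Q τ (fun y => f y ^ 2) x) ≤ B := by
    have := hd.isProbabilityMeasure hτ' x
    refine Real.sqrt_le_iff.2 ⟨hB0, ?_⟩
    have h1 : |ouSemigroup S Q τ (fun y => f y ^ 2) x| ≤ B ^ 2 :=
      abs_integral_le_of_abs_le fun y => by
        rw [abs_pow]; exact pow_le_pow_left₀ (abs_nonneg _) (hB y) 2
    exact (le_abs_self _).trans h1
  have hconst : 2 * (Real.exp (1 / 2) * c) / τ ^ α * ‖ξ‖ = 2 * m := by rw [hm]; ring
  refine ⟨fun r => ?_, ?_⟩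
  · rw [show 2 * (Real.exp (1 / 2) * c) / τ ^ α * B * ‖ξ‖ * |r| = 2 * m * B * |r| by
      rw [← hconst]; ring]
    rcases le_total (|r| * m) 1 with h | h
    · refine (hmain r h).trans ?_
      gcongr
    · have h1 := abs_sub (ouSemigroup S Q τ f (x + r • R ξ)) (ouSemigroup S Q τ f x)
      nlinarith [hsup x, hsup (x + r • R ξ)]
  · have h1 : ∀ᶠ r : ℝ in 𝓝 0, |r| * m < 1 := by
      have : Continuous fun r : ℝ => |r| * m := by fun_prop
      exact (this.tendsto 0).eventually (gt_mem_nhds (by simp))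
    filter_upwards [h1] with r hr
    refine (hmain r hr.le).trans (le_of_eq ?_)
    rw [← hconst]
    ring

end Smoothing

section Gradient

variable {H : Type*} [NormedAddCommGroup H] [InnerProductSpace ℝ H] [CompleteSpace H]
  [TopologicalSpace.SeparableSpace H] [MeasurableSpace H] [BorelSpace H]
  {S : ℝ → H →L[ℝ] H} {Q R : H →L[ℝ] H} {T α M : ℝ}

/-! ### Continuity of the Ornstein-Uhlenbeck semigroup -/

/-- Joint weak continuity of the transition laws, tested on bounded functions that converge
continuously. -/
theorem IsOUData.tendsto_ouSemigroup (hd : IsOUData S Q R T) {A : Type*} {l : Filter A}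
    [l.IsCountablyGenerated] {τ : A → ℝ} {τ₀ : ℝ} (hτ₀ : τ₀ ∈ Icc 0 T) (hτ : ∀ᶠ a in l, τ a ∈ Icc 0 T)
    (hτl : Tendsto τ l (𝓝 τ₀)) {x : A → H} {x₀ : H} (hx : Tendsto x l (𝓝 x₀))
    {F : A → H → ℝ} {F₀ : H → ℝ} (hF : ∀ᶠ a in l, Measurable (F a)) (hF₀ : Measurable F₀) {B : ℝ}
    (hB : ∀ᶠ a in l, ∀ y, |F a y| ≤ B)
    (hFl : ∀ y, Tendsto (fun q : A × H => F q.1 q.2) (l ×ˢ 𝓝 y) (𝓝 (F₀ y))) :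
    Tendsto (fun a => ouSemigroup S Q (τ a) (F a) (x a)) l (𝓝 (ouSemigroup S Q τ₀ F₀ x₀)) := by
  have : SecondCountableTopology H := UniformSpace.secondCountable_of_separable H
  obtain ⟨ι, P, hP, X, hXc, hX⟩ := hd.exists_process
  have hXm : ∀ σ z, AEMeasurable (fun ω => S σ z + X σ ω) P := fun σ z =>
    (Lp.aestronglyMeasurable _).aemeasurable.const_add _
  have hrep : ∀ σ ∈ Icc 0 T, ∀ z, ∀ f : H → ℝ, Measurable f →
      ouSemigroup S Q σ f z = ∫ ω, f (S σ z + X σ ω) ∂P := fun σ hσ z f hf => by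
    rw [ouSemigroup, hX σ hσ, integral_map (hXm σ z) hf.aestronglyMeasurable]
  refine tendsto_of_seq_tendsto fun u hu => ?_
  refine tendsto_of_subseq_tendsto fun ns hns => ?_
  have hv : Tendsto (fun n => u (ns n)) atTop l := hu.comp hns
  have hτv : Tendsto (fun n => τ (u (ns n))) atTop (𝓝[Icc 0 T] τ₀) :=
    tendsto_nhdsWithin_iff.2 ⟨hτl.comp hv, hv.eventually hτ⟩
  have hXv : Tendsto (fun n => X (τ (u (ns n)))) atTop (𝓝 (X τ₀)) :=
    (hXc τ₀ hτ₀).tendsto.comp hτv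
  obtain ⟨ms, hms, hae⟩ := (tendstoInMeasure_of_tendsto_Lp hXv).exists_seq_tendsto_ae
  refine ⟨ms, ?_⟩
  have hw : Tendsto (fun n => u (ns (ms n))) atTop l := hv.comp hms.tendsto_atTop
  have hSx : Tendsto (fun n => S (τ (u (ns (ms n)))) (x (u (ns (ms n))))) atTop (𝓝 (S τ₀ x₀)) := by
    have h1 : Tendsto (fun n => (τ (u (ns (ms n))), x (u (ns (ms n))))) atTop
        (𝓝[Ici 0 ×ˢ univ] (τ₀, x₀)) := by
      refine tendsto_nhdsWithin_iff.2 ⟨(hτl.comp hw).prodMk_nhds (hx.comp hw), ?_⟩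
      filter_upwards [hw.eventually hτ] with n hn using ⟨hn.1, mem_univ _⟩
    exact (hd.semigroup.continuousOn (τ₀, x₀) ⟨hτ₀.1, mem_univ _⟩).tendsto.comp h1
  rw [hrep τ₀ hτ₀ x₀ F₀ hF₀]
  have hev : (fun n => ∫ ω, F (u (ns (ms n))) (S (τ (u (ns (ms n)))) (x (u (ns (ms n))))
      + X (τ (u (ns (ms n)))) ω) ∂P)
      =ᶠ[atTop] fun n => ouSemigroup S Q (τ (u (ns (ms n)))) (F (u (ns (ms n)))) (x (u (ns (ms n)))) := by
    filter_upwards [hw.eventually hτ, hw.eventually hF] with n h1 h2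
    exact (hrep _ h1 _ _ h2).symm
  refine Tendsto.congr' hev ?_
  refine tendsto_integral_filter_of_dominated_convergence (fun _ => B) ?_ ?_ (integrable_const B) ?_
  · filter_upwards [hw.eventually hF] with n hn
    exact (hn.comp_aemeasurable (hXm _ _)).aestronglyMeasurable
  · filter_upwards [hw.eventually hB] with n hn
    exact ae_of_all _ fun ω => hn _
  · filter_upwards [hae] with ω hω
    exact (hFl (S τ₀ x₀ + X τ₀ ω)).comp (hw.prodMk (hSx.add hω))

/-! ### The gradient of the Ornstein-Uhlenbeck semigroup -/

omit [CompleteSpace H] [TopologicalSpace.SeparableSpace H] [MeasurableSpace H] [BorelSpace H] in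
lemma HasGradAlong.unique {f : H → ℝ} {g g' x : H} (h : HasGradAlong R f g x)
    (h' : HasGradAlong R f g' x) : g = g' :=
  ext_inner_right ℝ fun ξ => HasDerivAt.unique (h ξ) (h' ξ)

omit [CompleteSpace H] [TopologicalSpace.SeparableSpace H] [MeasurableSpace H] [BorelSpace H] in
lemma HasGradAlong.sub {f f' : H → ℝ} {g g' x : H} (h : HasGradAlong R f g x)
    (h' : HasGradAlong R f' g' x) : HasGradAlong R (fun y => f y - f' y) (g - g') x := fun ξ => by
  rw [inner_sub_left]
  exact HasDerivAt.sub (h ξ) (h' ξ)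

omit [CompleteSpace H] [TopologicalSpace.SeparableSpace H] [MeasurableSpace H] [BorelSpace H] in
/-- A gradient is bounded by any Lipschitz constant along its direction. -/
lemma HasGradAlong.norm_le {f : H → ℝ} {g x : H} (h : HasGradAlong R f g x) {L : ℝ} (hL : 0 ≤ L)
    (hf : ∀ ξ : H, ∀ᶠ r : ℝ in 𝓝 0, |f (x + r • R ξ) - f x| ≤ L * ‖ξ‖ * |r|) : ‖g‖ ≤ L := by
  have h1 : |⟪g, g⟫| ≤ L * ‖g‖ := by
    have := HasDerivAt.le_of_lip' (h g) (C := L * ‖g‖) (by positivity) (by simpa using hf g)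
    simpa using this
  rw [real_inner_self_eq_norm_mul_norm, abs_of_nonneg (by positivity)] at h1
  rcases (norm_nonneg g).eq_or_lt' with h0 | h0
  · rw [h0]; exact hL
  · exact le_of_mul_le_mul_right h1 h0

open Classical in
/-- The gradient `∇^R P_τ f (x)` of the Ornstein-Uhlenbeck semigroup, with value `0` where it does
not exist. -/
noncomputable def ouGrad (S : ℝ → H →L[ℝ] H) (Q R : H →L[ℝ] H) (τ : ℝ) (f : H → ℝ) (x : H) : H :=
  if h : ∃ g, HasGradAlong R (ouSemigroup S Q τ f) g x then h.choose else 0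

/-- The Ornstein-Uhlenbeck process on `[0, T]` together with the smoothing property of its
semigroup, where `M` is a constant for the two bounds of `IsOUData.exists_smoothing_const`. -/
structure IsSmoothOU (S : ℝ → H →L[ℝ] H) (Q R : H →L[ℝ] H) (T α M : ℝ) : Prop
    extends IsOUData S Q R T where
  smoothing : IsSmoothing S Q R T α
  const_pos : 0 < M
  sup_bound : ∀ τ ∈ Ioc 0 T, ∀ f : H → ℝ, Measurable f → ∀ B, (∀ x, |f x| ≤ B) → ∀ x ξ : H,
    ∀ r : ℝ, |ouSemigroup S Q τ f (x + r • R ξ) - ouSemigroup S Q τ f x|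
      ≤ M / τ ^ α * B * ‖ξ‖ * |r|
  sq_bound : ∀ τ ∈ Ioc 0 T, ∀ f : H → ℝ, Measurable f → ∀ B, (∀ x, |f x| ≤ B) → ∀ x ξ : H,
    ∀ᶠ r : ℝ in 𝓝 0, |ouSemigroup S Q τ f (x + r • R ξ) - ouSemigroup S Q τ f x|
      ≤ M / τ ^ α * √(ouSemigroup S Q τ (fun y => f y ^ 2) x) * ‖ξ‖ * |r|

lemma IsOUData.exists_isSmoothOU (hd : IsOUData S Q R T) (hsm : IsSmoothing S Q R T α) :
    ∃ M, IsSmoothOU S Q R T α M := by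
  obtain ⟨M, hM, h⟩ := hd.exists_smoothing_const hsm
  exact ⟨M, hd, hsm, hM, fun τ hτ f hf B hB x ξ => (h τ hτ f hf B hB x ξ).1,
    fun τ hτ f hf B hB x ξ => (h τ hτ f hf B hB x ξ).2⟩

omit [TopologicalSpace.SeparableSpace H] in
lemma HasGradAlong.ouGrad_eq {τ : ℝ} {f : H → ℝ} {x g : H}
    (h : HasGradAlong R (ouSemigroup S Q τ f) g x) : ouGrad S Q R τ f x = g := by
  have hex : ∃ g, HasGradAlong R (ouSemigroup S Q τ f) g x := ⟨g, h⟩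
  rw [ouGrad, dif_pos hex]
  exact hex.choose_spec.unique h

omit [TopologicalSpace.SeparableSpace H] in
lemma IsSmoothOU.hasGradAlong (hd : IsSmoothOU S Q R T α M) {τ : ℝ} (hτ : τ ∈ Ioc 0 T) {f : H → ℝ}
    (hf : Continuous f) {B : ℝ} (hB : ∀ y, |f y| ≤ B) (x : H) :
    HasGradAlong R (ouSemigroup S Q τ f) (ouGrad S Q R τ f x) x := by
  obtain ⟨c, -, hc⟩ := hd.smoothing
  obtain ⟨g, hg, -⟩ := hc (BoundedContinuousFunction.ofNormedAddCommGroup f hf B hB) τ hτ.1 hτ.2 x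
  have hg' : HasGradAlong R (ouSemigroup S Q τ f) g x := hg
  rwa [hg'.ouGrad_eq]

omit [TopologicalSpace.SeparableSpace H] in
/-- The `L²`-bound on the gradient of the Ornstein-Uhlenbeck semigroup. -/
lemma IsSmoothOU.norm_ouGrad_le_sqrt (hd : IsSmoothOU S Q R T α M) {τ : ℝ} (hτ : τ ∈ Ioc 0 T)
    {f : H → ℝ} (hf : Continuous f) {B : ℝ} (hB : ∀ y, |f y| ≤ B) (x : H) :
    ‖ouGrad S Q R τ f x‖ ≤ M / τ ^ α * √(ouSemigroup S Q τ (fun y => f y ^ 2) x) := by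
  have hM := hd.const_pos
  have hτα := Real.rpow_pos_of_pos hτ.1 α
  exact (hd.hasGradAlong hτ hf hB x).norm_le (by positivity)
    fun ξ => hd.sq_bound τ hτ f hf.measurable B hB x ξ

omit [TopologicalSpace.SeparableSpace H] in
lemma IsSmoothOU.norm_ouGrad_le (hd : IsSmoothOU S Q R T α M) {τ : ℝ} (hτ : τ ∈ Ioc 0 T)
    {f : H → ℝ} (hf : Continuous f) {B : ℝ} (hB : ∀ y, |f y| ≤ B) (x : H) :
    ‖ouGrad S Q R τ f x‖ ≤ M / τ ^ α * B := by
  have hM := hd.const_pos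
  have hτα := Real.rpow_pos_of_pos hτ.1 α
  have hB0 : 0 ≤ B := (abs_nonneg _).trans (hB 0)
  exact (hd.hasGradAlong hτ hf hB x).norm_le (by positivity)
    fun ξ => Eventually.of_forall fun r => hd.sup_bound τ hτ f hf.measurable B hB x ξ r

lemma IsOUData.integrable_ouLaw (hd : IsOUData S Q R T) {τ : ℝ} (hτ : τ ∈ Icc 0 T) {f : H → ℝ}
    (hf : Measurable f) {B : ℝ} (hB : ∀ y, |f y| ≤ B) (x : H) : Integrable f (ouLaw S Q τ x) := by
  have := hd.isProbabilityMeasure hτ x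
  exact Integrable.of_bound hf.aestronglyMeasurable B (ae_of_all _ hB)

lemma IsOUData.abs_ouSemigroup_le (hd : IsOUData S Q R T) {τ : ℝ} (hτ : τ ∈ Icc 0 T) {f : H → ℝ}
    {B : ℝ} (hB : ∀ y, |f y| ≤ B) (x : H) : |ouSemigroup S Q τ f x| ≤ B := by
  have := hd.isProbabilityMeasure hτ x
  exact abs_integral_le_of_abs_le hB

lemma IsOUData.ouSemigroup_sub (hd : IsOUData S Q R T) {τ : ℝ} (hτ : τ ∈ Icc 0 T) {f g : H → ℝ}
    (hf : Measurable f) {B : ℝ} (hB : ∀ y, |f y| ≤ B) (hg : Measurable g) {B' : ℝ}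
    (hB' : ∀ y, |g y| ≤ B') (x : H) :
    ouSemigroup S Q τ (fun y => f y - g y) x = ouSemigroup S Q τ f x - ouSemigroup S Q τ g x :=
  integral_sub (hd.integrable_ouLaw hτ hf hB x) (hd.integrable_ouLaw hτ hg hB' x)

lemma IsSmoothOU.ouGrad_sub (hd : IsSmoothOU S Q R T α M) {τ : ℝ} (hτ : τ ∈ Ioc 0 T)
    {f g : H → ℝ} (hf : Continuous f) {B : ℝ} (hB : ∀ y, |f y| ≤ B) (hg : Continuous g) {B' : ℝ}
    (hB' : ∀ y, |g y| ≤ B') (x : H) :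
    ouGrad S Q R τ (fun y => f y - g y) x = ouGrad S Q R τ f x - ouGrad S Q R τ g x := by
  refine HasGradAlong.ouGrad_eq ?_
  rw [show ouSemigroup S Q τ (fun y => f y - g y)
    = fun z => ouSemigroup S Q τ f z - ouSemigroup S Q τ g z from
    funext (hd.ouSemigroup_sub (Ioc_subset_Icc_self hτ) hf.measurable hB hg.measurable hB')]
  exact (hd.hasGradAlong hτ hf hB x).sub (hd.hasGradAlong hτ hg hB' x)

lemma IsSmoothOU.ouGrad_eq_zero (hd : IsSmoothOU S Q R T α M) {τ : ℝ} (hτ : τ ∈ Ioc 0 T)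
    {f : H → ℝ} (hf : Continuous f) {B : ℝ} (hB : ∀ y, |f y| ≤ B) (x : H) :
    ouGrad S Q R τ f x = ouGrad S Q R τ (fun y => f (S τ x + y)) 0 := by
  refine (HasGradAlong.ouGrad_eq fun ξ => ?_).symm
  refine HasDerivAt.congr_of_eventuallyEq (hd.hasGradAlong hτ hf hB x ξ)
    (Eventually.of_forall fun t => ?_)
  have hτ' := Ioc_subset_Icc_self hτ
  have hf' : Continuous fun y => f (S τ x + y) := by fun_prop
  simp only [zero_add]
  rw [hd.ouSemigroup_eq_zero hτ' hf'.measurable, hd.ouSemigroup_eq_zero hτ' hf.measurable]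
  simp only [map_add, add_assoc]

/-- Norm continuity of the gradient at a fixed time: a consequence of the `L²`-bound and dominated
convergence. -/
theorem IsSmoothOU.tendsto_ouGrad (hd : IsSmoothOU S Q R T α M) {τ : ℝ} (hτ : τ ∈ Ioc 0 T)
    {A : Type*} {l : Filter A} [l.IsCountablyGenerated] {x : A → H} {x₀ : H}
    {F : A → H → ℝ} {F₀ : H → ℝ} (hF : ∀ᶠ a in l, Continuous (F a)) (hF₀ : Continuous F₀) {B : ℝ}
    (hB : ∀ᶠ a in l, ∀ y, |F a y| ≤ B) (hB₀ : ∀ y, |F₀ y| ≤ B)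
    (hFl : ∀ y, Tendsto (fun a => F a (S τ (x a) + y)) l (𝓝 (F₀ (S τ x₀ + y)))) :
    Tendsto (fun a => ouGrad S Q R τ (F a) (x a)) l (𝓝 (ouGrad S Q R τ F₀ x₀)) := by
  have hτ' := Ioc_subset_Icc_self hτ
  have hP := hd.isProbabilityMeasure hτ' 0
  rw [tendsto_iff_norm_sub_tendsto_zero]
  have hle : ∀ᶠ a in l, ‖ouGrad S Q R τ (F a) (x a) - ouGrad S Q R τ F₀ x₀‖
      ≤ M / τ ^ α * √(∫ y, (F a (S τ (x a) + y) - F₀ (S τ x₀ + y)) ^ 2 ∂(ouLaw S Q τ 0)) := by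
    filter_upwards [hF, hB] with a h1 h2
    have c1 : Continuous fun y => F a (S τ (x a) + y) := by fun_prop
    have c2 : Continuous fun y => F₀ (S τ x₀ + y) := by fun_prop
    rw [hd.ouGrad_eq_zero hτ h1 h2, hd.ouGrad_eq_zero hτ hF₀ hB₀,
      ← hd.ouGrad_sub hτ c1 (fun y => h2 _) c2 (fun y => hB₀ _)]
    exact hd.norm_ouGrad_le_sqrt hτ (c1.sub c2) (B := B + B)
      (fun y => (abs_sub _ _).trans (add_le_add (h2 _) (hB₀ _))) 0
  refine squeeze_zero' (Eventually.of_forall fun _ => norm_nonneg _) hle ?_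
  have hlim : Tendsto (fun a => ∫ y, (F a (S τ (x a) + y) - F₀ (S τ x₀ + y)) ^ 2 ∂(ouLaw S Q τ 0)) l
      (𝓝 (∫ _, (0 : ℝ) ∂(ouLaw S Q τ 0))) := by
    refine tendsto_integral_filter_of_dominated_convergence (fun _ => (B + B) ^ 2) ?_ ?_
      (integrable_const _) (ae_of_all _ fun y => ?_)
    · filter_upwards [hF] with a h1
      have : Continuous fun y => (F a (S τ (x a) + y) - F₀ (S τ x₀ + y)) ^ 2 := by fun_prop
      exact this.measurable.aestronglyMeasurable
    · filter_upwards [hB] with a h2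
      refine ae_of_all _ fun y => ?_
      rw [norm_pow]
      exact pow_le_pow_left₀ (norm_nonneg _)
        ((abs_sub _ _).trans (add_le_add (h2 _) (hB₀ _))) 2
    · have := ((hFl y).sub_const (F₀ (S τ x₀ + y))).pow 2
      simpa using this
  rw [integral_zero] at hlim
  have := ((Real.continuous_sqrt.tendsto 0).comp hlim).const_mul (M / τ ^ α)
  simpa using this

end Gradient

/-! ### Integrals with a singular kernel -/

section Kernel

lemma intervalIntegrable_div_rpow {α : ℝ} (hα1 : α < 1) (c t b : ℝ) (htb : t ≤ b) :
    IntervalIntegrable (fun s => c / (s - t) ^ α) volume t b := by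
  have h1 : IntervalIntegrable (fun s : ℝ => s ^ (-α)) volume 0 (b - t) :=
    intervalIntegral.intervalIntegrable_rpow' (by linarith)
  have h2 := (h1.comp_sub_right t).const_mul c
  simp only [zero_add, sub_add_cancel] at h2
  refine h2.congr fun s hs => ?_
  rw [uIoc_of_le htb] at hs
  simp only [Real.rpow_neg (sub_nonneg.2 hs.1.le), div_eq_mul_inv]

lemma integral_div_rpow {α : ℝ} (hα1 : α < 1) (c t b : ℝ) (htb : t ≤ b) :
    ∫ s in t..b, c / (s - t) ^ α = c * ((b - t) ^ (1 - α) / (1 - α)) := by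
  have h1 : ∫ s in t..b, c / (s - t) ^ α = ∫ s in t..b, c * (s - t) ^ (-α) := by
    refine intervalIntegral.integral_congr fun s hs => ?_
    rw [uIcc_of_le htb] at hs
    simp only [Real.rpow_neg (sub_nonneg.2 hs.1), div_eq_mul_inv]
  rw [h1, intervalIntegral.integral_const_mul,
    intervalIntegral.integral_comp_sub_right (fun s => s ^ (-α)) t, sub_self,
    integral_rpow (Or.inl (by linarith)), Real.zero_rpow (by linarith), sub_zero,
    show -α + 1 = 1 - α by ring]

/-- Continuity of `(t, x) ↦ ∫₀^{b-t} k r t x dr` for a kernel that is continuous in `(t, x)` for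
fixed `r` and dominated by an integrable function of `r`. -/
lemma continuousOn_integral_kernel {X E : Type*} [TopologicalSpace X] [FirstCountableTopology X]
    [NormedAddCommGroup E] [NormedSpace ℝ E] {a b : ℝ} {k : ℝ → ℝ → X → E} {g : ℝ → ℝ}
    (hg : IntegrableOn g (Ioo 0 (b - a)))
    (hk : ∀ t ∈ Icc a b, ∀ x, ∀ r ∈ Ioo 0 (b - t), ‖k r t x‖ ≤ g r)
    (hm : ∀ t ∈ Icc a b, ∀ x, AEStronglyMeasurable (fun r => k r t x) (volume.restrict (Ioo 0 (b - t))))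
    (hc : ∀ r, 0 < r → ContinuousOn (fun q : ℝ × X => k r q.1 q.2) (Ico a (b - r) ×ˢ univ)) :
    ContinuousOn (fun q : ℝ × X => ∫ r in (0 : ℝ)..(b - q.1), k r q.1 q.2) (Icc a b ×ˢ univ) := by
  have heq : ∀ q ∈ Icc a b ×ˢ (univ : Set X), ∫ r in (0 : ℝ)..(b - q.1), k r q.1 q.2
      = ∫ r, (Ioo 0 (b - q.1)).indicator (fun r => k r q.1 q.2) r := fun q hq => by
    rw [intervalIntegral.integral_of_le (by linarith [hq.1.2]), integral_Ioc_eq_integral_Ioo,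
      integral_indicator measurableSet_Ioo]
  refine ContinuousOn.congr ?_ heq
  rintro ⟨t₀, x₀⟩ ⟨ht₀, -⟩
  simp only at ht₀
  refine tendsto_integral_filter_of_dominated_convergence ((Ioo 0 (b - a)).indicator g) ?_ ?_
    ((integrable_indicator_iff measurableSet_Ioo).2 hg) ?_
  · filter_upwards [self_mem_nhdsWithin] with q hq
    exact (aestronglyMeasurable_indicator_iff measurableSet_Ioo).2 (hm q.1 hq.1 q.2)
  · filter_upwards [self_mem_nhdsWithin] with q hq
    refine ae_of_all _ fun r => ?_
    by_cases hr : r ∈ Ioo 0 (b - q.1)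
    · rw [indicator_of_mem hr,
        indicator_of_mem (show r ∈ Ioo 0 (b - a) from ⟨hr.1, by linarith [hr.2, hq.1.1]⟩)]
      exact hk q.1 hq.1 q.2 r hr
    · rw [indicator_of_notMem hr, norm_zero]
      refine indicator_apply_nonneg fun hr' => ?_
      have ha : a ∈ Icc a b := ⟨le_rfl, ht₀.1.trans ht₀.2⟩
      exact (norm_nonneg _).trans (hk a ha x₀ r hr')
  · -- the only exceptional `r` is the endpoint `b - t₀`
    have hne : ∀ᵐ r : ℝ, r ≠ b - t₀ := by simp [ae_iff]
    filter_upwards [hne] with r hr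
    have hfst : Tendsto (fun q : ℝ × X => q.1) (𝓝[Icc a b ×ˢ univ] (t₀, x₀)) (𝓝 t₀) :=
      (continuous_fst.tendsto (t₀, x₀)).mono_left nhdsWithin_le_nhds
    rcases le_or_gt r 0 with h0 | h0
    · simp only [indicator_of_notMem (show r ∉ Ioo 0 (b - _) from fun h => h0.not_gt h.1)]
      exact tendsto_const_nhds
    rcases lt_or_gt_of_ne hr with h1 | h1
    · have hmem : ∀ᶠ q : ℝ × X in 𝓝[Icc a b ×ˢ univ] (t₀, x₀), q.1 < b - r :=
        hfst.eventually (gt_mem_nhds (by linarith))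
      have hev : (fun q : ℝ × X => k r q.1 q.2) =ᶠ[𝓝[Icc a b ×ˢ univ] (t₀, x₀)]
          fun q => (Ioo 0 (b - q.1)).indicator (fun r => k r q.1 q.2) r := by
        filter_upwards [hmem] with q hq
        rw [indicator_of_mem (show r ∈ Ioo 0 (b - q.1) from ⟨h0, by linarith⟩)]
      rw [indicator_of_mem (show r ∈ Ioo 0 (b - t₀) from ⟨h0, h1⟩)]
      refine Tendsto.congr' hev ?_
      refine ((hc r h0) (t₀, x₀) ⟨⟨ht₀.1, by linarith⟩, mem_univ _⟩).tendsto.mono_left ?_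
      refine nhdsWithin_le_iff.2 ?_
      filter_upwards [hmem, self_mem_nhdsWithin] with q hq hq' using ⟨⟨hq'.1.1, hq⟩, mem_univ _⟩
    · have hmem : ∀ᶠ q : ℝ × X in 𝓝[Icc a b ×ˢ univ] (t₀, x₀), b - r < q.1 :=
        hfst.eventually (lt_mem_nhds (by linarith))
      rw [indicator_of_notMem (show r ∉ Ioo 0 (b - t₀) from fun h => by linarith [h.2])]
      refine tendsto_const_nhds.congr' ?_
      filter_upwards [hmem] with q hq
      rw [indicator_of_notMem fun h => by linarith [h.2]]

end Kernel

/-! ### The Duhamel integral -/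

section Duhamel

variable {H : Type*} [NormedAddCommGroup H] [InnerProductSpace ℝ H] [CompleteSpace H]
  [TopologicalSpace.SeparableSpace H] [MeasurableSpace H] [BorelSpace H]
  {S : ℝ → H →L[ℝ] H} {Q R : H →L[ℝ] H} {T α M a b B : ℝ} {F : ℝ → H → ℝ}

/-- `F` is a function on `[a, b) × H` that is continuous and bounded by `B`. -/
structure IsForcing (F : ℝ → H → ℝ) (a b B : ℝ) : Prop where
  continuousOn : ContinuousOn (fun q : ℝ × H => F q.1 q.2) (Ico a b ×ˢ univ)
  abs_le : ∀ s ∈ Ico a b, ∀ y, |F s y| ≤ B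

omit [CompleteSpace H] [TopologicalSpace.SeparableSpace H] [MeasurableSpace H] [BorelSpace H]
  [InnerProductSpace ℝ H] in
lemma IsForcing.continuous (hF : IsForcing F a b B) {s : ℝ} (hs : s ∈ Ico a b) :
    Continuous (F s) :=
  hF.continuousOn.comp_continuous (f := fun y : H => (s, y)) (by fun_prop)
    fun y => ⟨hs, mem_univ _⟩

omit [CompleteSpace H] [TopologicalSpace.SeparableSpace H] [MeasurableSpace H] [BorelSpace H]
  [InnerProductSpace ℝ H] in
lemma IsForcing.tendsto (hF : IsForcing F a b B) {A : Type*} {l : Filter A} {s : A → ℝ} {s₀ : ℝ}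
    (hs₀ : s₀ ∈ Ico a b) (hs : Tendsto s l (𝓝[Ico a b] s₀)) (y : H) :
    Tendsto (fun q : A × H => F (s q.1) q.2) (l ×ˢ 𝓝 y) (𝓝 (F s₀ y)) := by
  have h1 := (hF.continuousOn (s₀, y) ⟨hs₀, mem_univ _⟩).tendsto
  rw [nhdsWithin_prod_eq, nhdsWithin_univ] at h1
  exact h1.comp (hs.prodMap tendsto_id)

lemma IsOUData.continuousOn_ouSemigroup_forcing (hd : IsOUData S Q R T) (hF : IsForcing F a b B)
    (hab : b - a ≤ T) {t : ℝ} (ht : a ≤ t) (x : H) :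
    ContinuousOn (fun s => ouSemigroup S Q (s - t) (F s) x) (Ico t b) := by
  intro s hs
  have hsub : Ico t b ⊆ Ico a b := Ico_subset_Ico_left ht
  refine hd.tendsto_ouSemigroup (B := B) (x := fun _ => x) ⟨by linarith [hs.1], by linarith [hs.2]⟩ ?_
    ?_ tendsto_const_nhds ?_ (hF.continuous (hsub hs)).measurable ?_
    (hF.tendsto (hsub hs) (tendsto_id.mono_right (nhdsWithin_mono _ hsub)))
  · filter_upwards [self_mem_nhdsWithin] with r hr
    exact ⟨by linarith [hr.1], by linarith [hr.2]⟩
  · have : Continuous fun r : ℝ => r - t := by fun_prop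
    exact (this.tendsto s).mono_left nhdsWithin_le_nhds
  · filter_upwards [self_mem_nhdsWithin] with r hr using (hF.continuous (hsub hr)).measurable
  · filter_upwards [self_mem_nhdsWithin] with r hr using hF.abs_le r (hsub hr)

lemma IsOUData.aestronglyMeasurable_ouSemigroup_forcing (hd : IsOUData S Q R T)
    (hF : IsForcing F a b B) (hab : b - a ≤ T) {t : ℝ} (ht : a ≤ t) (x : H) :
    AEStronglyMeasurable (fun s => ouSemigroup S Q (s - t) (F s) x) (volume.restrict (Ioo t b)) :=
  ((hd.continuousOn_ouSemigroup_forcing hF hab ht x).mono Ioo_subset_Ico_self).aestronglyMeasurable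
    measurableSet_Ioo

lemma IsOUData.intervalIntegrable_ouSemigroup_forcing (hd : IsOUData S Q R T)
    (hF : IsForcing F a b B) (hab : b - a ≤ T) {t : ℝ} (ht : t ∈ Icc a b) (x : H) :
    IntervalIntegrable (fun s => ouSemigroup S Q (s - t) (F s) x) volume t b := by
  rw [intervalIntegrable_iff_integrableOn_Ioo_of_le ht.2]
  refine IntegrableOn.of_bound (C := B) (by simp)
    (hd.aestronglyMeasurable_ouSemigroup_forcing hF hab ht.1 x) ?_
  filter_upwards [ae_restrict_mem measurableSet_Ioo] with s hs
  exact hd.abs_ouSemigroup_le ⟨by linarith [hs.1], by linarith [hs.2, ht.1]⟩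
    (hF.abs_le s ⟨ht.1.trans hs.1.le, hs.2⟩) x

lemma IsSmoothOU.aestronglyMeasurable_ouGrad_forcing (hd : IsSmoothOU S Q R T α M)
    (hF : IsForcing F a b B) (hab : b - a ≤ T) {t : ℝ} (ht : a ≤ t) (x : H) :
    AEStronglyMeasurable (fun s => ouGrad S Q R (s - t) (F s) x) (volume.restrict (Ioo t b)) := by
  classical
  have : SecondCountableTopology H := UniformSpace.secondCountable_of_separable H
  refine (aestronglyMeasurable_indicator_iff measurableSet_Ioo).1 ?_
  refine (measurable_of_forall_inner fun ξ => ?_).aestronglyMeasurable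
  -- the inner product with `ξ` is a limit of difference quotients, which are continuous in `s`
  let D : ℕ → ℝ → ℝ := fun n => (Ioo t b).piecewise (fun s => ((n : ℝ) + 1) *
    (ouSemigroup S Q (s - t) (F s) (x + (1 / ((n : ℝ) + 1)) • R ξ)
      - ouSemigroup S Q (s - t) (F s) x)) fun _ => 0
  have hcont : ∀ z, ContinuousOn (fun s => ouSemigroup S Q (s - t) (F s) z) (Ioo t b) := fun z =>
    (hd.continuousOn_ouSemigroup_forcing hF hab ht z).mono Ioo_subset_Ico_self
  have hD : ∀ n, Measurable (D n) := fun n => ContinuousOn.measurable_piecewise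
    (continuousOn_const.mul ((hcont _).sub (hcont _))) continuousOn_const measurableSet_Ioo
  refine measurable_of_tendsto_metrizable hD (tendsto_pi_nhds.2 fun s => ?_)
  by_cases hs : s ∈ Ioo t b
  · have hs' : s ∈ Ico a b := ⟨ht.trans hs.1.le, hs.2⟩
    have h1 := hd.hasGradAlong (τ := s - t) ⟨by linarith [hs.1], by linarith [hs.2]⟩
      (hF.continuous hs') (hF.abs_le s hs') x ξ
    rw [indicator_of_mem hs]
    have h2 : Tendsto (fun n : ℕ => 1 / ((n : ℝ) + 1)) atTop (𝓝[≠] 0) :=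
      tendsto_nhdsWithin_iff.2 ⟨tendsto_one_div_add_atTop_nhds_zero_nat,
        Eventually.of_forall fun n => by
          have : (0 : ℝ) < (n : ℝ) + 1 := by positivity
          simp only [mem_compl_iff, mem_singleton_iff]; positivity⟩
    have h3 := (hasDerivAt_iff_tendsto_slope_zero.1 h1).comp h2
    refine h3.congr fun n => ?_
    simp [D, piecewise_eq_of_mem _ _ _ hs]
  · rw [indicator_of_notMem hs, inner_zero_left]
    simp only [D, piecewise_eq_of_notMem _ _ _ hs]
    exact tendsto_const_nhds

omit [TopologicalSpace.SeparableSpace H] in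
lemma IsSmoothOU.norm_ouGrad_forcing_le (hd : IsSmoothOU S Q R T α M)
    (hF : IsForcing F a b B) (hab : b - a ≤ T) {t s : ℝ} (ht : a ≤ t) (hs : s ∈ Ioo t b) (x : H) :
    ‖ouGrad S Q R (s - t) (F s) x‖ ≤ M * B / (s - t) ^ α := by
  have hs' : s ∈ Ico a b := ⟨ht.trans hs.1.le, hs.2⟩
  refine (hd.norm_ouGrad_le (τ := s - t) ⟨by linarith [hs.1], by linarith [hs.2]⟩
      (hF.continuous hs') (hF.abs_le s hs') x).trans (le_of_eq ?_)
  ring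

lemma IsSmoothOU.intervalIntegrable_ouGrad_forcing (hd : IsSmoothOU S Q R T α M) (hα1 : α < 1)
    (hF : IsForcing F a b B) (hab : b - a ≤ T) {t : ℝ} (ht : t ∈ Icc a b) (x : H) :
    IntervalIntegrable (fun s => ouGrad S Q R (s - t) (F s) x) volume t b := by
  rw [intervalIntegrable_iff_integrableOn_Ioo_of_le ht.2]
  refine Integrable.mono' ((intervalIntegrable_iff_integrableOn_Ioo_of_le ht.2).1
    (intervalIntegrable_div_rpow hα1 (M * B) t b ht.2))
    (hd.aestronglyMeasurable_ouGrad_forcing hF hab ht.1 x) ?_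
  filter_upwards [ae_restrict_mem measurableSet_Ioo] with s hs
  exact hd.norm_ouGrad_forcing_le hF hab ht.1 hs x

/-- The Duhamel integral is differentiable in the directions of the range of `R`, and its gradient is
the integral of the gradients. -/
theorem IsSmoothOU.hasGradAlong_duhamel (hd : IsSmoothOU S Q R T α M) (hα1 : α < 1)
    (hF : IsForcing F a b B) (hab : b - a ≤ T) {t : ℝ} (ht : t ∈ Ico a b) (x : H) :
    HasGradAlong R (fun x => ∫ s in t..b, ouSemigroup S Q (s - t) (F s) x)
      (∫ s in t..b, ouGrad S Q R (s - t) (F s) x) x := by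
  intro ξ
  have ht' := Ico_subset_Icc_self ht
  have hint := hd.intervalIntegrable_ouGrad_forcing hα1 hF hab ht' x
  have h1 : ⟪∫ s in t..b, ouGrad S Q R (s - t) (F s) x, ξ⟫
      = ∫ s in t..b, ⟪ouGrad S Q R (s - t) (F s) x, ξ⟫ := by
    rw [real_inner_comm, ← innerSL_apply_apply ℝ,
      ← ContinuousLinearMap.intervalIntegral_comp_comm _ hint]
    simp only [innerSL_apply_apply, real_inner_comm]
  have hae : ∀ᵐ s : ℝ, s ∈ uIoc t b → s ∈ Ioo t b := by
    have hne : ∀ᵐ s : ℝ, s ≠ b := by simp [ae_iff]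
    filter_upwards [hne] with s hs hs'
    rw [uIoc_of_le ht'.2] at hs'
    exact ⟨hs'.1, lt_of_le_of_ne hs'.2 hs⟩
  rw [HasLineDerivAt, h1]
  refine (intervalIntegral.hasDerivAt_integral_of_dominated_loc_of_lip (s := univ)
    (bound := fun s => M * B * ‖ξ‖ / (s - t) ^ α)
    (F := fun r s => ouSemigroup S Q (s - t) (F s) (x + r • R ξ)) univ_mem ?_ ?_ ?_ ?_ ?_ ?_).2
  · refine Eventually.of_forall fun r => ?_
    rw [uIoc_of_le ht'.2, ← restrict_Ioo_eq_restrict_Ioc]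
    exact hd.aestronglyMeasurable_ouSemigroup_forcing hF hab ht.1 _
  · simpa using hd.intervalIntegrable_ouSemigroup_forcing hF hab ht' x
  · rw [uIoc_of_le ht'.2, ← restrict_Ioo_eq_restrict_Ioc]
    exact (hd.aestronglyMeasurable_ouGrad_forcing hF hab ht.1 x).inner aestronglyMeasurable_const
  · filter_upwards [hae] with s hs hs'
    have hs := hs hs'
    have hs' : s ∈ Ico a b := ⟨ht.1.trans hs.1.le, hs.2⟩
    refine LipschitzOnWith.of_dist_le_mul fun r _ r' _ => ?_
    rw [Real.dist_eq, Real.dist_eq, Real.coe_nnabs]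
    have h2 := hd.sup_bound (s - t) ⟨by linarith [hs.1], by linarith [hs.2, ht.1]⟩ (F s)
      (hF.continuous hs').measurable B (hF.abs_le s hs') (x + r' • R ξ) ξ (r - r')
    rw [show x + r' • R ξ + (r - r') • R ξ = x + r • R ξ by module] at h2
    refine h2.trans (mul_le_mul_of_nonneg_right ?_ (abs_nonneg _))
    exact (le_of_eq (by ring)).trans (le_abs_self _)
  · exact intervalIntegrable_div_rpow hα1 _ t b ht'.2
  · filter_upwards [hae] with s hs hs'
    have hs := hs hs'
    have hs' : s ∈ Ico a b := ⟨ht.1.trans hs.1.le, hs.2⟩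
    exact hd.hasGradAlong (τ := s - t) ⟨by linarith [hs.1], by linarith [hs.2, ht.1]⟩
      (hF.continuous hs') (hF.abs_le s hs') x ξ

omit [CompleteSpace H] [TopologicalSpace.SeparableSpace H] [MeasurableSpace H] [BorelSpace H]
  [InnerProductSpace ℝ H] in
lemma tendsto_add_nhdsWithin_Ico {r : ℝ} (hr : 0 < r) {t₀ : ℝ} {x₀ : H} :
    Tendsto (fun q : ℝ × H => q.1 + r) (𝓝[Ico a (b - r) ×ˢ univ] (t₀, x₀)) (𝓝[Ico a b] (t₀ + r)) := by
  have : Continuous fun q : ℝ × H => q.1 + r := by fun_prop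
  refine tendsto_nhdsWithin_iff.2 ⟨(this.tendsto (t₀, x₀)).mono_left nhdsWithin_le_nhds, ?_⟩
  filter_upwards [self_mem_nhdsWithin] with q hq
  exact ⟨by linarith [hq.1.1], by linarith [hq.1.2]⟩

/-- The Duhamel integral is continuous up to the final time. -/
theorem IsOUData.continuousOn_duhamel (hd : IsOUData S Q R T)
    (hF : IsForcing F a b B) (hab : b - a ≤ T) :
    ContinuousOn (fun q : ℝ × H => ∫ s in q.1..b, ouSemigroup S Q (s - q.1) (F s) q.2)
      (Icc a b ×ˢ univ) := by
  have h1 : ∀ t x, ∫ s in t..b, ouSemigroup S Q (s - t) (F s) x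
      = ∫ r in (0 : ℝ)..(b - t), ouSemigroup S Q r (F (t + r)) x := fun t x => by
    have := intervalIntegral.integral_comp_sub_right (a := t) (b := b)
      (fun r => ouSemigroup S Q r (F (t + r)) x) t
    simpa using this
  simp only [h1]
  refine continuousOn_integral_kernel (k := fun r t x => ouSemigroup S Q r (F (t + r)) x)
    (g := fun _ => B) (integrableOn_const (by simp)) ?_ ?_ ?_
  · intro t ht x r hr
    exact hd.abs_ouSemigroup_le ⟨hr.1.le, by linarith [hr.2, ht.1]⟩
      (hF.abs_le _ ⟨by linarith [hr.1, ht.1], by linarith [hr.2]⟩) x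
  · intro t ht x
    have h2 : ContinuousOn (fun r => ouSemigroup S Q (t + r - t) (F (t + r)) x) (Ioo 0 (b - t)) :=
      (hd.continuousOn_ouSemigroup_forcing hF hab ht.1 x).comp (f := fun r => t + r) (by fun_prop)
        fun r hr => ⟨by linarith [hr.1], by linarith [hr.2]⟩
    simp only [add_sub_cancel_left] at h2
    exact h2.aestronglyMeasurable measurableSet_Ioo
  · rintro r hr ⟨t₀, x₀⟩ ⟨ht₀, -⟩
    simp only at ht₀
    have hmem : t₀ + r ∈ Ico a b := ⟨by linarith [ht₀.1], by linarith [ht₀.2]⟩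
    have hrT : r ∈ Icc 0 T := ⟨hr.le, by linarith [ht₀.1, ht₀.2]⟩
    refine hd.tendsto_ouSemigroup (B := B) (τ := fun _ => r) (x := fun q : ℝ × H => q.2) hrT
      (Eventually.of_forall fun _ => hrT) tendsto_const_nhds
      ((continuous_snd.tendsto (t₀, x₀)).mono_left nhdsWithin_le_nhds)
      (F := fun q : ℝ × H => F (q.1 + r)) (F₀ := F (t₀ + r)) ?_ (hF.continuous hmem).measurable ?_
      (hF.tendsto hmem (tendsto_add_nhdsWithin_Ico hr))
    · filter_upwards [self_mem_nhdsWithin] with q hq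
      exact (hF.continuous ⟨by linarith [hq.1.1], by linarith [hq.1.2]⟩).measurable
    · filter_upwards [self_mem_nhdsWithin] with q hq
      exact hF.abs_le _ ⟨by linarith [hq.1.1], by linarith [hq.1.2]⟩

/-- The gradient of the Duhamel integral is norm continuous. -/
theorem IsSmoothOU.continuousOn_ouGrad_duhamel (hd : IsSmoothOU S Q R T α M) (hα1 : α < 1)
    (hF : IsForcing F a b B) (hab : b - a ≤ T) (hle : a ≤ b) :
    ContinuousOn (fun q : ℝ × H => ∫ s in q.1..b, ouGrad S Q R (s - q.1) (F s) q.2)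
      (Icc a b ×ˢ univ) := by
  have h1 : ∀ t x, ∫ s in t..b, ouGrad S Q R (s - t) (F s) x
      = ∫ r in (0 : ℝ)..(b - t), ouGrad S Q R r (F (t + r)) x := fun t x => by
    have := intervalIntegral.integral_comp_sub_right (a := t) (b := b)
      (fun r => ouGrad S Q R r (F (t + r)) x) t
    simpa using this
  simp only [h1]
  refine continuousOn_integral_kernel (k := fun r t x => ouGrad S Q R r (F (t + r)) x)
    (g := fun r => M * B / (r - 0) ^ α) ?_ ?_ ?_ ?_
  · rw [← intervalIntegrable_iff_integrableOn_Ioo_of_le (by linarith)]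
    exact intervalIntegrable_div_rpow hα1 _ 0 (b - a) (by linarith)
  · intro t ht x r hr
    have h2 := hd.norm_ouGrad_forcing_le hF hab ht.1 (s := t + r)
      ⟨by linarith [hr.1], by linarith [hr.2]⟩ x
    simpa using h2
  · intro t ht x
    have h2 := hd.aestronglyMeasurable_ouGrad_forcing hF hab ht.1 x
    have h3 : MeasurePreserving (fun r : ℝ => t + r) (volume.restrict (Ioo 0 (b - t)))
        (volume.restrict (Ioo t b)) := by
      have := (measurePreserving_add_left volume t).restrict_preimage
        (measurableSet_Ioo (a := t) (b := b))
      simpa using this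
    have h4 := h2.comp_measurePreserving h3
    simpa [Function.comp_def] using h4
  · rintro r hr ⟨t₀, x₀⟩ ⟨ht₀, -⟩
    simp only at ht₀
    have hmem : t₀ + r ∈ Ico a b := ⟨by linarith [ht₀.1], by linarith [ht₀.2]⟩
    have hrT : r ∈ Ioc 0 T := ⟨hr, by linarith [ht₀.1, ht₀.2]⟩
    refine hd.tendsto_ouGrad (B := B) (x := fun q : ℝ × H => q.2) hrT
      (F := fun q : ℝ × H => F (q.1 + r)) (F₀ := F (t₀ + r)) ?_ (hF.continuous hmem) ?_
      (hF.abs_le _ hmem) fun y => ?_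
    · filter_upwards [self_mem_nhdsWithin] with q hq
      exact (hF.continuous ⟨by linarith [hq.1.1], by linarith [hq.1.2]⟩)
    · filter_upwards [self_mem_nhdsWithin] with q hq
      exact hF.abs_le _ ⟨by linarith [hq.1.1], by linarith [hq.1.2]⟩
    · have h2 : Tendsto (fun q : ℝ × H => S r q.2 + y) (𝓝[Ico a (b - r) ×ˢ univ] (t₀, x₀))
          (𝓝 (S r x₀ + y)) := by
        have : Continuous fun q : ℝ × H => S r q.2 + y := by fun_prop
        exact (this.tendsto (t₀, x₀)).mono_left nhdsWithin_le_nhds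
      exact (hF.tendsto hmem (tendsto_add_nhdsWithin_Ico hr) (S r x₀ + y)).comp (tendsto_id.prodMk h2)

omit [TopologicalSpace.SeparableSpace H] in
lemma IsSmoothOU.norm_integral_ouGrad_le (hd : IsSmoothOU S Q R T α M) (hα1 : α < 1)
    (hF : IsForcing F a b B) (hab : b - a ≤ T) {t : ℝ} (ht : t ∈ Icc a b) (x : H) :
    ‖∫ s in t..b, ouGrad S Q R (s - t) (F s) x‖ ≤ M * B * ((b - t) ^ (1 - α) / (1 - α)) := by
  rw [← integral_div_rpow hα1 _ t b ht.2]
  refine intervalIntegral.norm_integral_le_of_norm_le ht.2 ?_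
    (intervalIntegrable_div_rpow hα1 _ t b ht.2)
  have hne : ∀ᵐ s : ℝ, s ≠ b := by simp [ae_iff]
  filter_upwards [hne] with s hs hs'
  exact hd.norm_ouGrad_forcing_le hF hab ht.1 ⟨hs'.1, lt_of_le_of_ne hs'.2 hs⟩ x

end Duhamel

section Existence

variable {H : Type*} [NormedAddCommGroup H] [InnerProductSpace ℝ H] [CompleteSpace H]
  [TopologicalSpace.SeparableSpace H] [MeasurableSpace H] [BorelSpace H]
  {S : ℝ → H →L[ℝ] H} {Q R : H →L[ℝ] H} {T α M : ℝ}

/-! ### The terminal datum -/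

omit [CompleteSpace H] [TopologicalSpace.SeparableSpace H] [MeasurableSpace H] [BorelSpace H] in
/-- A function with bounded Gateaux gradient is Lipschitz. -/
lemma abs_sub_le_of_hasGradAlong_id {f : H → ℝ} {D : H → H} {K : ℝ}
    (hf : ∀ x, HasGradAlong (ContinuousLinearMap.id ℝ H) f (D x) x) (hD : ∀ x, ‖D x‖ ≤ K) (x y : H) :
    |f x - f y| ≤ K * ‖x - y‖ := by
  have hder : ∀ t : ℝ, HasDerivAt (fun t : ℝ => f (y + t • (x - y))) ⟪D (y + t • (x - y)), x - y⟫ t := by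
    intro t
    have h1 : HasDerivAt (fun r : ℝ => f (y + t • (x - y) + r • (x - y)))
        ⟪D (y + t • (x - y)), x - y⟫ 0 := hf (y + t • (x - y)) (x - y)
    have h2 : HasDerivAt (fun r : ℝ => r - t) 1 t := (hasDerivAt_id t).sub_const t
    have h3 := HasDerivAt.scomp_of_eq t h1 h2 (by simp)
    rw [one_smul] at h3
    refine h3.congr_of_eventuallyEq (Eventually.of_forall fun r => ?_)
    simp only [Function.comp]
    congr 1
    module
  have h4 := Convex.norm_image_sub_le_of_norm_hasDerivWithin_le (s := univ) (x := 0) (y := 1)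
    (C := K * ‖x - y‖) (fun t _ => (hder t).hasDerivWithinAt)
    (fun t _ => (norm_inner_le_norm _ _).trans
      (mul_le_mul_of_nonneg_right (hD _) (norm_nonneg _)))
    convex_univ (mem_univ _) (mem_univ _)
  simpa using h4

/-- For Lipschitz data the gradient of the Ornstein-Uhlenbeck semigroup is bounded uniformly up to
time `0`. -/
lemma IsSmoothOU.exists_norm_ouGrad_le_of_lipschitz (hd : IsSmoothOU S Q R T α M) {f : H → ℝ}
    (hf : Continuous f) {B : ℝ} (hB : ∀ y, |f y| ≤ B) {K : ℝ} (hK : 0 ≤ K)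
    (hL : ∀ x y, |f x - f y| ≤ K * ‖x - y‖) :
    ∃ K₀, 0 ≤ K₀ ∧ ∀ τ ∈ Ioc 0 T, ∀ x, ‖ouGrad S Q R τ f x‖ ≤ K₀ := by
  obtain ⟨N, hN0, hN⟩ := hd.semigroup.exists_norm_le T
  refine ⟨K * (N * ‖R‖), by positivity, fun τ hτ x => ?_⟩
  refine (hd.hasGradAlong hτ hf hB x).norm_le (by positivity) fun ξ =>
    Eventually.of_forall fun r => ?_
  have hτ' := Ioc_subset_Icc_self hτ
  have := hd.isProbabilityMeasure hτ' 0
  have hc : ∀ z, Continuous fun y => f (S τ z + y) := fun z => by fun_prop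
  rw [hd.ouSemigroup_eq_zero hτ' hf.measurable, hd.ouSemigroup_eq_zero hτ' hf.measurable x,
    ← hd.ouSemigroup_sub hτ' (hc _).measurable (fun y => hB _) (hc x).measurable fun y => hB _]
  refine hd.abs_ouSemigroup_le hτ' (fun y => (hL _ _).trans ?_) 0
  have h1 : S τ (x + r • R ξ) + y - (S τ x + y) = r • S τ (R ξ) := by
    rw [map_add, map_smul]; abel
  rw [h1, norm_smul, Real.norm_eq_abs, mul_assoc K, mul_assoc K]
  refine mul_le_mul_of_nonneg_left ?_ hK
  rw [mul_comm]
  refine mul_le_mul_of_nonneg_right ?_ (abs_nonneg _)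
  rw [mul_assoc]
  exact (S τ).le_of_opNorm_le_of_le (hN τ hτ') (R.le_opNorm ξ)

lemma IsOUData.tendsto_ouSemigroup_const (hd : IsOUData S Q R T) {f : H → ℝ}
    (hf : Continuous f) {B : ℝ} (hB : ∀ y, |f y| ≤ B) {A : Type*} {l : Filter A}
    [l.IsCountablyGenerated] {τ : A → ℝ} {τ₀ : ℝ} (hτ₀ : τ₀ ∈ Icc 0 T) (hτ : ∀ᶠ a in l, τ a ∈ Icc 0 T)
    (hτl : Tendsto τ l (𝓝 τ₀)) {x : A → H} {x₀ : H} (hx : Tendsto x l (𝓝 x₀)) :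
    Tendsto (fun a => ouSemigroup S Q (τ a) f (x a)) l (𝓝 (ouSemigroup S Q τ₀ f x₀)) :=
  hd.tendsto_ouSemigroup (F := fun _ => f) hτ₀ hτ hτl hx (Eventually.of_forall fun _ => hf.measurable)
    hf.measurable (Eventually.of_forall fun _ => hB) fun y => (hf.tendsto y).comp tendsto_snd

lemma IsOUData.continuousOn_ouSemigroup_terminal (hd : IsOUData S Q R T) {f : H → ℝ}
    (hf : Continuous f) {B : ℝ} (hB : ∀ y, |f y| ≤ B) {a b : ℝ} (hab : b - a ≤ T) :
    ContinuousOn (fun q : ℝ × H => ouSemigroup S Q (b - q.1) f q.2) (Icc a b ×ˢ univ) := by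
  rintro ⟨t₀, x₀⟩ ⟨ht₀, -⟩
  simp only at ht₀
  have hmem : ∀ t ∈ Icc a b, b - t ∈ Icc 0 T := fun t ht => ⟨by linarith [ht.2], by linarith [ht.1]⟩
  have h1 : Continuous fun q : ℝ × H => b - q.1 := by fun_prop
  refine hd.tendsto_ouSemigroup_const hf hB (hmem t₀ ht₀) ?_
    ((h1.tendsto (t₀, x₀)).mono_left nhdsWithin_le_nhds)
    ((continuous_snd.tendsto (t₀, x₀)).mono_left nhdsWithin_le_nhds)
  filter_upwards [self_mem_nhdsWithin] with q hq using hmem _ hq.1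

/-- Joint norm continuity of the gradient of the Ornstein-Uhlenbeck semigroup at positive times. By
the semigroup law the time dependence is moved into the function to which a fixed `P_ε` is
applied. -/
lemma IsSmoothOU.continuousOn_ouGrad_terminal (hd : IsSmoothOU S Q R T α M) {f : H → ℝ}
    (hf : Continuous f) {B : ℝ} (hB : ∀ y, |f y| ≤ B) {a b : ℝ} (hab : b - a ≤ T) :
    ContinuousOn (fun q : ℝ × H => ouGrad S Q R (b - q.1) f q.2) (Ico a b ×ˢ univ) := by
  rintro ⟨t₀, x₀⟩ ⟨ht₀, -⟩
  simp only at ht₀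
  set ε := (b - t₀) / 2 with hε
  have hε0 : 0 < ε := by linarith [ht₀.2]
  have hεT : ε ∈ Ioc 0 T := ⟨hε0, by linarith [ht₀.1]⟩
  have hsplit : ∀ t, a ≤ t → ε ≤ b - t → ouSemigroup S Q (b - t) f
      = ouSemigroup S Q ε (ouSemigroup S Q (b - t - ε) f) := fun t ha ht => by
    have := hd.ouSemigroup_add (σ := b - t - ε) (τ := ε) (by linarith) hε0.le (by linarith)
      hf.measurable hB
    rw [show ε + (b - t - ε) = b - t by ring] at this
    exact funext this
  have hcont : ∀ t, a ≤ t → ε ≤ b - t → Continuous (ouSemigroup S Q (b - t - ε) f) := fun t ha ht => by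
    have hmem : b - t - ε ∈ Icc 0 T := ⟨by linarith, by linarith⟩
    refine continuous_iff_continuousAt.2 fun x => ?_
    exact hd.tendsto_ouSemigroup_const (τ := fun _ => b - t - ε) hf hB hmem
      (Eventually.of_forall fun _ => hmem) tendsto_const_nhds tendsto_id
  have hbd : ∀ t, a ≤ t → ε ≤ b - t → ∀ y, |ouSemigroup S Q (b - t - ε) f y| ≤ B := fun t ha ht y =>
    hd.abs_ouSemigroup_le ⟨by linarith, by linarith⟩ hB y
  have hgrad : ∀ t x, a ≤ t → ε ≤ b - t → ouGrad S Q R (b - t) f x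
      = ouGrad S Q R ε (ouSemigroup S Q (b - t - ε) f) x := fun t x ha ht => by
    refine HasGradAlong.ouGrad_eq ?_
    rw [hsplit t ha ht]
    exact hd.hasGradAlong hεT (hcont t ha ht) (hbd t ha ht) x
  have hnear : ∀ᶠ q : ℝ × H in 𝓝[Ico a b ×ˢ univ] (t₀, x₀), a ≤ q.1 ∧ ε ≤ b - q.1 := by
    have h1 : Continuous fun q : ℝ × H => b - q.1 := by fun_prop
    have h2 : ∀ᶠ q : ℝ × H in 𝓝[Ico a b ×ˢ univ] (t₀, x₀), ε < b - q.1 :=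
      ((h1.tendsto (t₀, x₀)).mono_left nhdsWithin_le_nhds).eventually
        (lt_mem_nhds (by simp only; linarith))
    filter_upwards [h2, self_mem_nhdsWithin] with q hq hq' using ⟨hq'.1.1, hq.le⟩
  have hε₀ : ε ≤ b - t₀ := by linarith
  have hmain := hd.tendsto_ouGrad (A := ℝ × H) (l := 𝓝[Ico a b ×ˢ univ] (t₀, x₀)) hεT
    (x := fun q => q.2) (x₀ := x₀) (F := fun q => ouSemigroup S Q (b - q.1 - ε) f)
    (F₀ := ouSemigroup S Q (b - t₀ - ε) f) (hnear.mono fun q hq => hcont q.1 hq.1 hq.2)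
    (hcont t₀ ht₀.1 hε₀) (B := B) (hnear.mono fun q hq => hbd q.1 hq.1 hq.2)
    (hbd t₀ ht₀.1 hε₀) fun y => by
      have h1 : Continuous fun q : ℝ × H => b - q.1 - ε := by fun_prop
      have h2 : Continuous fun q : ℝ × H => S ε q.2 + y := by fun_prop
      refine hd.tendsto_ouSemigroup_const hf hB ⟨by linarith, by linarith [ht₀.1]⟩ ?_
        ((h1.tendsto (t₀, x₀)).mono_left nhdsWithin_le_nhds)
        ((h2.tendsto (t₀, x₀)).mono_left nhdsWithin_le_nhds)
      filter_upwards [hnear] with q hq using ⟨by linarith [hq.2], by linarith [hq.1]⟩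
  rw [ContinuousWithinAt, hgrad t₀ x₀ ht₀.1 hε₀]
  refine hmain.congr' ?_
  filter_upwards [hnear] with q hq using (hgrad q.1 q.2 hq.1 hq.2).symm

/-! ### The fixed point -/

/-- The time-space function on `ℝ × H` that extends a function on `[a, b) × H` by `0`. -/
noncomputable def extendIco {a b : ℝ} (w : Ico a b × H → H) (s : ℝ) (y : H) : H := by
  classical exact if h : s ∈ Ico a b then w (⟨s, h⟩, y) else 0

omit [InnerProductSpace ℝ H] [CompleteSpace H] [TopologicalSpace.SeparableSpace H]
  [MeasurableSpace H] [BorelSpace H] in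
lemma extendIco_of_mem {a b : ℝ} (w : Ico a b × H → H) {s : ℝ} (h : s ∈ Ico a b) (y : H) :
    extendIco w s y = w (⟨s, h⟩, y) := by
  simp [extendIco, h]

omit [InnerProductSpace ℝ H] [CompleteSpace H] [TopologicalSpace.SeparableSpace H]
  [MeasurableSpace H] [BorelSpace H] in
lemma continuousOn_extendIco {a b : ℝ} {w : Ico a b × H → H} (hw : Continuous w) :
    ContinuousOn (fun q : ℝ × H => extendIco w q.1 q.2) (Ico a b ×ˢ univ) := by
  rw [continuousOn_iff_continuous_domRestrict]
  have h1 : (Ico a b ×ˢ (univ : Set H)).domRestrict (fun q : ℝ × H => extendIco w q.1 q.2)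
      = fun q : (Ico a b ×ˢ (univ : Set H) : Set (ℝ × H)) => w (⟨q.1.1, q.2.1⟩, q.1.2) := by
    ext q
    exact extendIco_of_mem w q.2.1 q.1.2
  rw [h1]
  fun_prop

omit [CompleteSpace H] [TopologicalSpace.SeparableSpace H] [MeasurableSpace H] [BorelSpace H]
  [InnerProductSpace ℝ H] in
lemma isForcing_const (l : BoundedContinuousFunction H ℝ) (a b : ℝ) :
    IsForcing (fun _ => l) a b ‖l‖ :=
  ⟨by fun_prop, fun _ _ y => l.norm_coe_le_norm y⟩

omit [InnerProductSpace ℝ H] [CompleteSpace H] [TopologicalSpace.SeparableSpace H]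
  [MeasurableSpace H] [BorelSpace H] in
lemma abs_sub_le_of_norm_le {ψ : H → ℝ} {p C : ℝ} (hp : 2 ≤ p)
    (hψ : ∀ ξ₁ ξ₂ : H, |ψ ξ₁ - ψ ξ₂| ≤ C * (1 + ‖ξ₁‖ ^ (p - 1) + ‖ξ₂‖ ^ (p - 1)) * ‖ξ₁ - ξ₂‖)
    {ρ : ℝ} {ξ₁ ξ₂ : H} (h₁ : ‖ξ₁‖ ≤ ρ) (h₂ : ‖ξ₂‖ ≤ ρ) :
    |ψ ξ₁ - ψ ξ₂| ≤ |C| * (1 + 2 * ρ ^ (p - 1)) * ‖ξ₁ - ξ₂‖ := by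
  refine (hψ ξ₁ ξ₂).trans (mul_le_mul_of_nonneg_right ?_ (norm_nonneg _))
  have e1 := Real.rpow_le_rpow (norm_nonneg ξ₁) h₁ (show 0 ≤ p - 1 by linarith)
  have e2 := Real.rpow_le_rpow (norm_nonneg ξ₂) h₂ (show 0 ≤ p - 1 by linarith)
  have e3 := Real.rpow_nonneg (norm_nonneg ξ₁) (p - 1)
  have e4 := Real.rpow_nonneg (norm_nonneg ξ₂) (p - 1)
  calc C * (1 + ‖ξ₁‖ ^ (p - 1) + ‖ξ₂‖ ^ (p - 1))
      ≤ |C| * (1 + ‖ξ₁‖ ^ (p - 1) + ‖ξ₂‖ ^ (p - 1)) :=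
        mul_le_mul_of_nonneg_right (le_abs_self C) (by positivity)
    _ ≤ _ := mul_le_mul_of_nonneg_left (by linarith) (abs_nonneg C)

/-- Local existence: for small `δ` the gradient of a solution is found as the fixed point of a
contraction on a ball of norm continuous vector fields. -/
theorem IsSmoothOU.exists_isMildSolution (hd : IsSmoothOU S Q R T α M) (hα1 : α < 1)
    {ψ : H → ℝ} {p C : ℝ} (hp : 2 ≤ p) (hψc : Continuous ψ)
    (hψ : ∀ ξ₁ ξ₂ : H, |ψ ξ₁ - ψ ξ₂| ≤ C * (1 + ‖ξ₁‖ ^ (p - 1) + ‖ξ₂‖ ^ (p - 1)) * ‖ξ₁ - ξ₂‖)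
    (hψ0 : ψ 0 = 0) (l φ : BoundedContinuousFunction H ℝ) {K : ℝ} (hK : 0 ≤ K)
    (hφ : ∀ x y, |φ x - φ y| ≤ K * ‖x - y‖) :
    ∃ δ : ℝ, 0 < δ ∧ δ < T ∧ ∃ u, IsMildSolution S Q R ψ l φ (T - δ) T 0 u := by
  have hφB : ∀ y, |φ y| ≤ ‖φ‖ := φ.norm_coe_le_norm
  obtain ⟨K₀, hK₀, hgradφ⟩ := hd.exists_norm_ouGrad_le_of_lipschitz φ.continuous hφB hK hφ
  have hM := hd.const_pos
  have hT := hd.pos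
  set ρ := K₀ + 1 with hρ
  have hρ0 : 0 < ρ := by linarith
  set L := |C| * (1 + 2 * ρ ^ (p - 1)) with hLdef
  have hL0 : 0 ≤ L := by positivity
  have hψL : ∀ {ξ₁ ξ₂ : H}, ‖ξ₁‖ ≤ ρ → ‖ξ₂‖ ≤ ρ → |ψ ξ₁ - ψ ξ₂| ≤ L * ‖ξ₁ - ξ₂‖ :=
    fun h₁ h₂ => abs_sub_le_of_norm_le hp hψ h₁ h₂
  have hψB : ∀ {ξ : H}, ‖ξ‖ ≤ ρ → |ψ ξ| ≤ L * ρ := fun {ξ} h => by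
    have := hψL h (ξ₂ := 0) (by simpa using hρ0.le)
    rw [hψ0, sub_zero, sub_zero] at this
    exact this.trans (mul_le_mul_of_nonneg_left h hL0)
  -- `δ` is so small that the map preserves the ball of radius `ρ` and contracts by `1 / 2`
  obtain ⟨δ, hδ0, hδT, hδ1, hδ2⟩ : ∃ δ : ℝ, 0 < δ ∧ δ < T ∧
      M * (L * ρ + ‖l‖) * (δ ^ (1 - α) / (1 - α)) ≤ 1 ∧ M * L * (δ ^ (1 - α) / (1 - α)) ≤ 1 / 2 := by
    have h0 : Tendsto (fun δ : ℝ => δ ^ (1 - α) / (1 - α)) (𝓝[>] 0) (𝓝 0) := by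
      have h1 : ContinuousAt (fun δ : ℝ => δ ^ (1 - α) / (1 - α)) 0 :=
        (Real.continuousAt_rpow_const 0 (1 - α) (Or.inr (by linarith))).div_const _
      have h2 := h1.tendsto.mono_left (nhdsWithin_le_nhds (s := Ioi 0))
      rwa [Real.zero_rpow (by linarith), zero_div] at h2
    have h3 := (h0.const_mul (M * (L * ρ + ‖l‖))).eventually
      (ge_mem_nhds (show M * (L * ρ + ‖l‖) * 0 < 1 by simp))
    have h4 := (h0.const_mul (M * L)).eventually
      (ge_mem_nhds (show M * L * 0 < 1 / 2 by simp))
    have h5 : ∀ᶠ δ : ℝ in 𝓝[>] 0, δ < T := nhdsWithin_le_nhds (gt_mem_nhds hT)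
    obtain ⟨δ, h3, h4, h5, h6⟩ := (h3.and (h4.and (h5.and self_mem_nhdsWithin))).exists
    exact ⟨δ, h6, h5, h3, h4⟩
  refine ⟨δ, hδ0, hδT, ?_⟩
  set a := T - δ with ha
  have haT : T - a ≤ T := by linarith
  have hale : a ≤ T := by linarith
  have hpow : ∀ t ∈ Icc a T, (T - t) ^ (1 - α) / (1 - α) ≤ δ ^ (1 - α) / (1 - α) := fun t ht => by
    have h1 : 0 < 1 - α := by linarith
    exact div_le_div_of_nonneg_right (Real.rpow_le_rpow (by linarith [ht.2]) (by linarith [ht.1]) h1.le)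
      h1.le
  let E := BoundedContinuousFunction (Ico a T × H) H
  have hball : ∀ w ∈ Metric.closedBall (0 : E) ρ, ∀ s ∈ Ico a T, ∀ y, ‖extendIco w s y‖ ≤ ρ :=
    fun w hw s hs y => by
      rw [extendIco_of_mem w hs]
      exact (w.norm_coe_le_norm _).trans (by simpa using hw)
  have hforc : ∀ w ∈ Metric.closedBall (0 : E) ρ,
      IsForcing (fun s y => ψ (extendIco w s y)) a T (L * ρ) := fun w hw =>
    ⟨hψc.comp_continuousOn (continuousOn_extendIco w.continuous),
      fun s hs y => hψB (hball w hw s hs y)⟩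
  have hl := isForcing_const l a T
  let G : E → ℝ → H → H := fun w t x => ouGrad S Q R (T - t) φ x
    - (∫ s in t..T, ouGrad S Q R (s - t) (fun y => ψ (extendIco w s y)) x)
    - ∫ s in t..T, ouGrad S Q R (s - t) l x
  have hGnorm : ∀ w ∈ Metric.closedBall (0 : E) ρ, ∀ t ∈ Ico a T, ∀ x, ‖G w t x‖ ≤ ρ :=
    fun w hw t ht x => by
      have ht' := Ico_subset_Icc_self ht
      have h1 := hgradφ (T - t) ⟨by linarith [ht.2], by linarith [ht.1]⟩ x
      have h2 := hd.norm_integral_ouGrad_le hα1 (hforc w hw) haT ht' x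
      have h3 := hd.norm_integral_ouGrad_le hα1 hl haT ht' x
      have h4 : M * (L * ρ) * ((T - t) ^ (1 - α) / (1 - α)) + M * ‖l‖ * ((T - t) ^ (1 - α) / (1 - α))
          ≤ 1 := by
        refine le_trans (le_of_eq ?_) ((mul_le_mul_of_nonneg_left (hpow t ht') ?_).trans hδ1)
        · ring
        · positivity
      calc ‖G w t x‖ ≤ _ := (norm_sub_le _ _).trans (add_le_add_left (norm_sub_le _ _) _)
        _ ≤ ρ := by linarith
  have hGcont : ∀ w ∈ Metric.closedBall (0 : E) ρ,
      ContinuousOn (fun q : ℝ × H => G w q.1 q.2) (Ico a T ×ˢ univ) := fun w hw => by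
    have hsub : Ico a T ×ˢ (univ : Set H) ⊆ Icc a T ×ˢ univ := prod_mono_left Ico_subset_Icc_self
    exact ((hd.continuousOn_ouGrad_terminal φ.continuous hφB haT).sub
      ((hd.continuousOn_ouGrad_duhamel hα1 (hforc w hw) haT hale).mono hsub)).sub
      ((hd.continuousOn_ouGrad_duhamel hα1 hl haT hale).mono hsub)
  have hΓ : ∀ w : Metric.closedBall (0 : E) ρ, ∃ w' : Metric.closedBall (0 : E) ρ,
      ∀ (t : Ico a T) (x : H), (w' : E) (t, x) = G w t x := fun w => by
    have hc : Continuous fun q : Ico a T × H => G w q.1 q.2 :=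
      (hGcont w w.2).comp_continuous (f := fun q : Ico a T × H => ((q.1 : ℝ), q.2)) (by fun_prop)
        fun q => ⟨q.1.2, mem_univ _⟩
    have hb : ∀ q : Ico a T × H, ‖G w q.1 q.2‖ ≤ ρ := fun q => hGnorm w w.2 q.1 q.1.2 q.2
    refine ⟨⟨BoundedContinuousFunction.ofNormedAddCommGroup _ hc ρ hb, ?_⟩, fun t x => rfl⟩
    rw [mem_closedBall_zero_iff]
    exact BoundedContinuousFunction.norm_ofNormedAddCommGroup_le hc hρ0.le hb
  choose Γ hΓ using hΓ
  have hcontr : ContractingWith (1 / 2) Γ := by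
    refine ⟨by rw [← NNReal.coe_lt_coe]; norm_num, LipschitzWith.of_dist_le_mul fun w w' => ?_⟩
    rw [Subtype.dist_eq, BoundedContinuousFunction.dist_le (by positivity)]
    rintro ⟨t, x⟩
    have ht' := Ico_subset_Icc_self t.2
    have hdist : ∀ s ∈ Ico a T, ∀ y, ‖extendIco (w : E) s y - extendIco (w' : E) s y‖ ≤ dist w w' :=
      fun s hs y => by
        rw [extendIco_of_mem _ hs, extendIco_of_mem _ hs, ← dist_eq_norm]
        exact BoundedContinuousFunction.dist_coe_le_dist _
    have hdiff : IsForcing (fun s y => ψ (extendIco (w : E) s y) - ψ (extendIco (w' : E) s y)) a T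
        (L * dist w w') :=
      ⟨(hforc w w.2).continuousOn.sub (hforc w' w'.2).continuousOn, fun s hs y =>
        (hψL (hball w w.2 s hs y) (hball w' w'.2 s hs y)).trans
          (mul_le_mul_of_nonneg_left (hdist s hs y) hL0)⟩
    have hint := fun w : Metric.closedBall (0 : E) ρ =>
      hd.intervalIntegrable_ouGrad_forcing hα1 (hforc w w.2) haT ht' x
    have h1 : G w' t x - G w t x = ∫ s in (t : ℝ)..T, ouGrad S Q R (s - t)
        (fun y => ψ (extendIco (w : E) s y) - ψ (extendIco (w' : E) s y)) x := by
      have h2 : G w' t x - G w t x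
          = (∫ s in (t : ℝ)..T, ouGrad S Q R (s - t) (fun y => ψ (extendIco (w : E) s y)) x)
            - ∫ s in (t : ℝ)..T, ouGrad S Q R (s - t) (fun y => ψ (extendIco (w' : E) s y)) x := by
        simp only [G]; abel
      rw [h2, ← intervalIntegral.integral_sub (hint w) (hint w')]
      refine intervalIntegral.integral_congr_ae ?_
      have hne : ∀ᵐ s : ℝ, s ≠ T := by simp [ae_iff]
      filter_upwards [hne] with s hs hs'
      rw [uIoc_of_le ht'.2] at hs'
      have hs'' : s ∈ Ico a T := ⟨t.2.1.trans hs'.1.le, lt_of_le_of_ne hs'.2 hs⟩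
      exact (hd.ouGrad_sub (τ := s - t) ⟨by linarith [hs'.1], by linarith [hs'.2, t.2.1]⟩
        ((hforc w w.2).continuous hs'') ((hforc w w.2).abs_le s hs'')
        ((hforc w' w'.2).continuous hs'') ((hforc w' w'.2).abs_le s hs'') x).symm
    rw [hΓ, hΓ, dist_comm, dist_eq_norm, h1]
    refine (hd.norm_integral_ouGrad_le hα1 hdiff haT ht' x).trans ?_
    calc M * (L * dist w w') * ((T - t) ^ (1 - α) / (1 - α))
        = M * L * ((T - t) ^ (1 - α) / (1 - α)) * dist w w' := by ring
      _ ≤ 1 / 2 * dist w w' := by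
        refine mul_le_mul_of_nonneg_right ?_ dist_nonneg
        exact (mul_le_mul_of_nonneg_left (hpow t ht') (by positivity)).trans hδ2
      _ = _ := by norm_num
  have : CompleteSpace (Metric.closedBall (0 : E) ρ) :=
    Metric.isClosed_closedBall.completeSpace_coe
  have : Nonempty (Metric.closedBall (0 : E) ρ) := ⟨⟨0, by simpa using hρ0.le⟩⟩
  let w := hcontr.fixedPoint
  have hw : ∀ t ∈ Ico a T, ∀ x, extendIco (w : E) t x = G w t x := fun t ht x => by
    rw [extendIco_of_mem _ ht]
    have h1 : Γ w = w := hcontr.fixedPoint_isFixedPt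
    have h2 := hΓ w ⟨t, ht⟩ x
    rwa [h1] at h2
  have hFw := hforc w w.2
  refine ⟨fun t x => ouSemigroup S Q (T - t) φ x
    - (∫ s in t..T, ouSemigroup S Q (s - t) (fun y => ψ (extendIco (w : E) s y)) x)
    - ∫ s in t..T, ouSemigroup S Q (s - t) l x, ?_, ?_, extendIco (w : E), ?_, ?_, ?_, ?_⟩
  · exact ((hd.continuousOn_ouSemigroup_terminal φ.continuous hφB haT).sub
      (hd.continuousOn_duhamel hFw haT)).sub (hd.continuousOn_duhamel hl haT)
  · refine ⟨‖φ‖ + L * ρ * δ + ‖l‖ * δ, fun t ht x => ?_⟩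
    have hdu : ∀ {F : ℝ → H → ℝ} {B : ℝ}, 0 ≤ B → IsForcing F a T B →
        |∫ s in t..T, ouSemigroup S Q (s - t) (F s) x| ≤ B * δ := fun {F B} hB hF => by
      have h1 := intervalIntegral.norm_integral_le_of_norm_le_const_ae (a := t) (b := T) (C := B)
        (f := fun s => ouSemigroup S Q (s - t) (F s) x) (by
          have hne : ∀ᵐ s : ℝ, s ≠ T := by simp [ae_iff]
          filter_upwards [hne] with s hs hs'
          rw [uIoc_of_le ht.2] at hs'
          exact hd.abs_ouSemigroup_le ⟨by linarith [hs'.1], by linarith [hs'.2, ht.1]⟩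
            (hF.abs_le s ⟨ht.1.trans hs'.1.le, lt_of_le_of_ne hs'.2 hs⟩) x)
      refine h1.trans (mul_le_mul_of_nonneg_left ?_ hB)
      rw [abs_of_nonneg (by linarith [ht.2])]
      linarith [ht.1]
    have h1 := hd.abs_ouSemigroup_le (τ := T - t) ⟨by linarith [ht.2], by linarith [ht.1]⟩ hφB x
    exact (abs_sub _ _).trans (add_le_add ((abs_sub _ _).trans
      (add_le_add h1 (hdu (by positivity) hFw))) (hdu (norm_nonneg l) hl))
  · intro t ht x
    rw [hw t ht x]
    exact ((hd.hasGradAlong (τ := T - t) ⟨by linarith [ht.2], by linarith [ht.1]⟩ φ.continuous hφB x).sub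
      (hd.hasGradAlong_duhamel hα1 hFw haT ht x)).sub (hd.hasGradAlong_duhamel hα1 hl haT ht x)
  · exact fun ξ => (continuousOn_extendIco (w : E).continuous).inner continuousOn_const
  · refine ⟨ρ, fun t ht x => ?_⟩
    rw [Real.rpow_zero, one_mul]
    exact hball w w.2 t ht x
  · intro t ht x
    refine ⟨fun s hs => ?_, hd.intervalIntegrable_ouSemigroup_forcing hFw haT ht x,
      hd.intervalIntegrable_ouSemigroup_forcing hl haT ht x, rfl⟩
    have hs' : s ∈ Ico a T := ⟨ht.1.trans hs.1.le, hs.2⟩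
    exact hd.integrable_ouLaw ⟨by linarith [hs.1], by linarith [hs.2, ht.1]⟩
      (hFw.continuous hs').measurable (hFw.abs_le s hs') x

end Existence

section Uniqueness

variable {H : Type*} [NormedAddCommGroup H] [InnerProductSpace ℝ H] [CompleteSpace H]
  [MeasurableSpace H] [BorelSpace H]
  {S : ℝ → H →L[ℝ] H} {Q R : H →L[ℝ] H} {T α M : ℝ}

/-! ### Uniqueness -/

lemma IsMildSolution.of_exponent_zero {ψ l φ : H → ℝ} {a : ℝ} {v : ℝ → H → ℝ}
    (hv : IsMildSolution S Q R ψ l φ a T 0 v) {β : ℝ} (hβ : 0 ≤ β) :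
    IsMildSolution S Q R ψ l φ a T β v := by
  obtain ⟨h1, h2, w, h3, h4, ⟨K, hK⟩, h5⟩ := hv
  refine ⟨h1, h2, w, h3, h4, ⟨(T - a) ^ β * K, fun t ht x => ?_⟩, h5⟩
  have h6 := hK t ht x
  rw [Real.rpow_zero, one_mul] at h6
  exact mul_le_mul (Real.rpow_le_rpow (by linarith [ht.2]) (by linarith [ht.1]) hβ) h6
    (norm_nonneg _) (Real.rpow_nonneg (by linarith [ht.1, ht.2]) _)

/-- The kernel of the Duhamel integral for a forcing that blows up at the right end point: the
larger of the two factors is bounded by the other one. -/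
lemma div_mul_div_rpow_le {α γ : ℝ} (hα : 0 ≤ α) (hγ : 0 ≤ γ) {c : ℝ} (hc : 0 ≤ c) {x y : ℝ}
    (hx : 0 < x) (hy : 0 < y) : c / (x ^ α * y ^ γ) ≤ c / x ^ (α + γ) + c / y ^ (α + γ) := by
  have hx1 := Real.rpow_pos_of_pos hx α
  have hy1 := Real.rpow_pos_of_pos hy γ
  have hx2 := Real.rpow_pos_of_pos hx (α + γ)
  have hy2 := Real.rpow_pos_of_pos hy (α + γ)
  rcases le_total x y with h | h
  · refine le_add_of_le_of_nonneg (div_le_div_of_nonneg_left hc hx2 ?_) (by positivity)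
    rw [Real.rpow_add hx]
    exact mul_le_mul_of_nonneg_left (Real.rpow_le_rpow hx.le h hγ) hx1.le
  · refine le_add_of_nonneg_of_le (by positivity) (div_le_div_of_nonneg_left hc hy2 ?_)
    rw [Real.rpow_add hy]
    exact mul_le_mul_of_nonneg_right (Real.rpow_le_rpow hy.le h hα) hy1.le

/-- Gradient bound for a Duhamel integral whose forcing is merely measurable in space and may blow
up at the right end point `b`. -/
lemma IsSmoothOU.norm_le_of_hasGradAlong_duhamel (hd : IsSmoothOU S Q R T α M) (hα : 0 ≤ α) {γ : ℝ}
    (hγ : 0 ≤ γ) (hαγ : α + γ < 1) {t b : ℝ} (htb : t ≤ b) (hbT : b - t ≤ T) {g : ℝ → H → ℝ}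
    (hgm : ∀ s ∈ Ioo t b, Measurable (g s)) {N : ℝ} (hN : 0 ≤ N)
    (hg : ∀ s ∈ Ioo t b, ∀ y, |g s y| ≤ N / (b - s) ^ γ)
    (hint : ∀ x, IntervalIntegrable (fun s => ouSemigroup S Q (s - t) (g s) x) volume t b)
    {x z : H} (hz : HasGradAlong R (fun x => -∫ s in t..b, ouSemigroup S Q (s - t) (g s) x) z x) :
    ‖z‖ ≤ 2 * (M * N) * ((b - t) ^ (1 - (α + γ)) / (1 - (α + γ))) := by
  have hM := hd.const_pos
  have hpos : 0 ≤ (b - t) ^ (1 - (α + γ)) / (1 - (α + γ)) :=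
    div_nonneg (Real.rpow_nonneg (by linarith) _) (by linarith)
  refine hz.norm_le (by positivity) fun ξ => Eventually.of_forall fun r => ?_
  set c := M * N * ‖ξ‖ * |r| with hc
  have hc0 : 0 ≤ c := by positivity
  have hsum : ∀ s, b + t - s - t = b - s := fun s => by ring
  have i1 := intervalIntegrable_div_rpow hαγ c t b htb
  have i2 : IntervalIntegrable (fun s => c / (b - s) ^ (α + γ)) volume t b := by
    have := (i1.comp_sub_left (b + t)).symm
    simpa [hsum] using this
  have e2 : ∫ s in t..b, c / (b - s) ^ (α + γ) = ∫ s in t..b, c / (s - t) ^ (α + γ) := by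
    have := intervalIntegral.integral_comp_sub_left (a := t) (b := b)
      (fun s => c / (s - t) ^ (α + γ)) (b + t)
    simpa [hsum] using this
  have hle : ‖∫ s in t..b, (ouSemigroup S Q (s - t) (g s) (x + r • R ξ)
      - ouSemigroup S Q (s - t) (g s) x)‖
      ≤ ∫ s in t..b, (c / (s - t) ^ (α + γ) + c / (b - s) ^ (α + γ)) := by
    refine intervalIntegral.norm_integral_le_of_norm_le htb ?_ (i1.add i2)
    filter_upwards [volume.ae_ne b] with s hsb hs
    have hs : s ∈ Ioo t b := ⟨hs.1, lt_of_le_of_ne hs.2 hsb⟩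
    have h1 : 0 < s - t := by linarith [hs.1]
    have h2 : 0 < b - s := by linarith [hs.2]
    refine (hd.sup_bound (s - t) ⟨h1, by linarith⟩ (g s) (hgm s hs) _ (hg s hs) x ξ r).trans ?_
    refine le_trans (le_of_eq ?_) (div_mul_div_rpow_le hα hγ hc0 h1 h2)
    rw [hc]
    ring
  rw [intervalIntegral.integral_add i1 i2, e2, integral_div_rpow hαγ c t b htb,
    intervalIntegral.integral_sub (hint _) (hint _), Real.norm_eq_abs] at hle
  rw [neg_sub_neg, abs_sub_comm]
  refine hle.trans (le_of_eq ?_)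
  rw [hc]
  ring

variable [TopologicalSpace.SeparableSpace H]

/-- Two mild solutions agree. The weighted norm of the difference of their gradients is halved
infinitely often on a short interval that ends where the gradients are already known to agree, and
the length of that interval does not depend on its position. -/
theorem IsSmoothOU.eq_of_isMildSolution (hd : IsSmoothOU S Q R T α M) (hα : 0 ≤ α)
    {ψ : H → ℝ} {p C : ℝ} (hp : 2 ≤ p) (hψc : Continuous ψ)
    (hψ : ∀ ξ₁ ξ₂ : H, |ψ ξ₁ - ψ ξ₂| ≤ C * (1 + ‖ξ₁‖ ^ (p - 1) + ‖ξ₂‖ ^ (p - 1)) * ‖ξ₁ - ξ₂‖)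
    {l φ : H → ℝ} {a β : ℝ} (ha : 0 ≤ a) (hβ : 0 ≤ β) (hαβ : α + β * p < 1) {v₁ v₂ : ℝ → H → ℝ}
    (h₁ : IsMildSolution S Q R ψ l φ a T β v₁) (h₂ : IsMildSolution S Q R ψ l φ a T β v₂)
    {t : ℝ} (ht : t ∈ Icc a T) (x : H) : v₁ t x = v₂ t x := by
  obtain ⟨-, -, w₁, hg₁, hc₁, ⟨K₁, hK₁⟩, hm₁⟩ := h₁
  obtain ⟨-, -, w₂, hg₂, hc₂, ⟨K₂, hK₂⟩, hm₂⟩ := h₂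
  have hM := hd.const_pos
  have hT := hd.pos
  obtain ⟨K, hK0, hK₁, hK₂⟩ : ∃ K, 0 ≤ K ∧ (∀ s ∈ Ico a T, ∀ y, (T - s) ^ β * ‖w₁ s y‖ ≤ K) ∧
      ∀ s ∈ Ico a T, ∀ y, (T - s) ^ β * ‖w₂ s y‖ ≤ K :=
    ⟨max 0 (max K₁ K₂), le_max_left _ _,
      fun s hs y => (hK₁ s hs y).trans ((le_max_left _ _).trans (le_max_right _ _)),
      fun s hs y => (hK₂ s hs y).trans ((le_max_right _ _).trans (le_max_right _ _))⟩
  have hmeas : ∀ {w : ℝ → H → H},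
      (∀ ξ : H, ContinuousOn (fun q : ℝ × H => ⟪w q.1 q.2, ξ⟫) (Ico a T ×ˢ univ)) →
      ∀ s ∈ Ico a T, Measurable (w s) := fun {w} hw s hs => by
    refine measurable_of_forall_inner fun ξ => ?_
    exact ((hw ξ).comp_continuous (f := fun y : H => (s, y)) (by fun_prop)
      fun y => ⟨hs, mem_univ _⟩).measurable
  set g : ℝ → H → ℝ := fun s y => ψ (w₁ s y) - ψ (w₂ s y) with hgdef
  have hgm : ∀ s ∈ Ico a T, Measurable (g s) := fun s hs =>
    (hψc.measurable.comp (hmeas hc₁ s hs)).sub (hψc.measurable.comp (hmeas hc₂ s hs))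
  set L := |C| * (T ^ (β * (p - 1)) + 2 * K ^ (p - 1)) with hL
  have hL0 : 0 ≤ L := by
    have := Real.rpow_nonneg hT.le (β * (p - 1))
    positivity
  have hγ : 0 ≤ β * p := by positivity
  -- if the weighted difference of the gradients is at most `N`, the forcing is at most
  -- `L N (T - s) ^ (-β p)`
  have hgb : ∀ s ∈ Ico a T, ∀ y, ∀ N, (T - s) ^ β * ‖w₁ s y - w₂ s y‖ ≤ N →
      |g s y| ≤ L * N / (T - s) ^ (β * p) := fun s hs y N hN => by
    have hs0 : 0 < T - s := by linarith [hs.2]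
    have hsβ := Real.rpow_pos_of_pos hs0 β
    have hsβp := Real.rpow_pos_of_pos hs0 (β * (p - 1))
    have e1 := abs_sub_le_of_norm_le hp hψ (ρ := K / (T - s) ^ β)
      ((le_div_iff₀' hsβ).2 (hK₁ s hs y)) ((le_div_iff₀' hsβ).2 (hK₂ s hs y))
    have e2 : 1 + 2 * (K / (T - s) ^ β) ^ (p - 1)
        ≤ (T ^ (β * (p - 1)) + 2 * K ^ (p - 1)) / (T - s) ^ (β * (p - 1)) := by
      rw [Real.div_rpow hK0 hsβ.le, ← Real.rpow_mul hs0.le, add_div, mul_div_assoc]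
      gcongr
      rw [one_le_div₀ hsβp]
      exact Real.rpow_le_rpow hs0.le (by linarith [hs.1])
        (mul_nonneg hβ (by linarith))
    have e3 : ‖w₁ s y - w₂ s y‖ ≤ N / (T - s) ^ β := (le_div_iff₀' hsβ).2 hN
    have e4 : (T - s) ^ (β * p) = (T - s) ^ (β * (p - 1)) * (T - s) ^ β := by
      rw [← Real.rpow_add hs0]; ring_nf
    calc |g s y| ≤ |C| * (1 + 2 * (K / (T - s) ^ β) ^ (p - 1)) * ‖w₁ s y - w₂ s y‖ := e1
      _ ≤ |C| * ((T ^ (β * (p - 1)) + 2 * K ^ (p - 1)) / (T - s) ^ (β * (p - 1)))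
          * (N / (T - s) ^ β) := by gcongr
      _ = L * N / (T - s) ^ (β * p) := by rw [e4, hL]; field_simp
  have hdN : ∀ s ∈ Ico a T, ∀ y, (T - s) ^ β * ‖w₁ s y - w₂ s y‖ ≤ 2 * K := fun s hs y => by
    have hsβ := Real.rpow_nonneg (show 0 ≤ T - s by linarith [hs.2]) β
    have := mul_le_mul_of_nonneg_left (norm_sub_le (w₁ s y) (w₂ s y)) hsβ
    linarith [hK₁ s hs y, hK₂ s hs y]
  have hdiff : ∀ t ∈ Icc a T, ∀ x,
      IntervalIntegrable (fun s => ouSemigroup S Q (s - t) (g s) x) volume t T ∧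
        v₁ t x - v₂ t x = -∫ s in t..T, ouSemigroup S Q (s - t) (g s) x := fun t ht x => by
    obtain ⟨j₁, k₁, -, f₁⟩ := hm₁ t ht x
    obtain ⟨j₂, k₂, -, f₂⟩ := hm₂ t ht x
    have heq : EqOn (fun s => ouSemigroup S Q (s - t) (fun y => ψ (w₁ s y)) x
        - ouSemigroup S Q (s - t) (fun y => ψ (w₂ s y)) x)
        (fun s => ouSemigroup S Q (s - t) (g s) x) (Ioo t T) := fun s hs =>
      (integral_sub (j₁ s hs) (j₂ s hs)).symm
    refine ⟨(k₁.sub k₂).congr_uIoo (by rwa [uIoo_of_le ht.2]), ?_⟩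
    rw [← intervalIntegral.integral_congr_Ioo_of_le ht.2 heq, intervalIntegral.integral_sub k₁ k₂,
      f₁, f₂]
    ring
  -- the gradients agree
  suffices hw : ∀ s ∈ Ico a T, ∀ y, w₁ s y = w₂ s y by
    have h0 : ∫ s in t..T, ouSemigroup S Q (s - t) (g s) x = ∫ s in t..T, (0 : ℝ) := by
      refine intervalIntegral.integral_congr_Ioo_of_le ht.2 fun s hs => ?_
      have : g s = fun _ => 0 := by
        funext y
        rw [hgdef]
        simp only [hw s ⟨ht.1.trans hs.1.le, hs.2⟩ y, sub_self]
      simp only [this, ouSemigroup, integral_zero]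
    have := (hdiff t ht x).2
    rw [h0, intervalIntegral.integral_zero, neg_zero, sub_eq_zero] at this
    exact this
  have hgrad : ∀ b ∈ Ioc a T, (∀ s ∈ Ico b T, ∀ y, w₁ s y = w₂ s y) → ∀ N, 0 ≤ N → ∀ t ∈ Ico a b,
      (∀ s ∈ Ioo t b, ∀ y, (T - s) ^ β * ‖w₁ s y - w₂ s y‖ ≤ N) → ∀ x,
      ‖w₁ t x - w₂ t x‖ ≤ 2 * (M * (L * N)) * ((b - t) ^ (1 - (α + β * p)) / (1 - (α + β * p))) := by
    intro b hb hbw N hN t ht htN x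
    have htT : t ∈ Icc a T := ⟨ht.1, ht.2.le.trans hb.2⟩
    have hab : ∀ s ∈ Ioo t b, s ∈ Ico a T := fun s hs => ⟨ht.1.trans hs.1.le, hs.2.trans_le hb.2⟩
    have hsub₁ : uIcc t b ⊆ uIcc t T := by
      rw [uIcc_of_le ht.2.le, uIcc_of_le htT.2]; exact Icc_subset_Icc_right hb.2
    have hsub₂ : uIcc b T ⊆ uIcc t T := by
      rw [uIcc_of_le hb.2, uIcc_of_le htT.2]; exact Icc_subset_Icc_left ht.2.le
    refine hd.norm_le_of_hasGradAlong_duhamel hα hγ hαβ ht.2.le (by linarith [hb.2, ht.1]) (g := g)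
      (fun s hs => hgm s (hab s hs)) (by positivity) (fun s hs y => ?_)
      (fun x => (hdiff t htT x).1.mono_set hsub₁) (x := x) ?_
    · refine (hgb s (hab s hs) y N (htN s hs y)).trans ?_
      have hbs : 0 < b - s := by linarith [hs.2]
      exact div_le_div_of_nonneg_left (by positivity) (Real.rpow_pos_of_pos hbs _)
        (Real.rpow_le_rpow hbs.le (by linarith [hb.2]) hγ)
    · have hfun : (fun z => -∫ s in t..b, ouSemigroup S Q (s - t) (g s) z)
          = fun z => v₁ t z - v₂ t z := by
        funext z
        have hz := (hdiff t htT z).1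
        rw [(hdiff t htT z).2, ← intervalIntegral.integral_add_adjacent_intervals
          (hz.mono_set hsub₁) (hz.mono_set hsub₂)]
        have h0 : ∫ s in b..T, ouSemigroup S Q (s - t) (g s) z = ∫ s in b..T, (0 : ℝ) := by
          refine intervalIntegral.integral_congr_Ioo_of_le hb.2 fun s hs => ?_
          have : g s = fun _ => 0 := by
            funext y
            rw [hgdef]
            simp only [hbw s ⟨hs.1.le, hs.2⟩ y, sub_self]
          simp only [this, ouSemigroup, integral_zero]
        rw [h0, intervalIntegral.integral_zero, add_zero]
      rw [hfun]
      have ht' : t ∈ Ico a T := ⟨ht.1, ht.2.trans_le hb.2⟩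
      exact (hg₁ t ht' x).sub (hg₂ t ht' x)
  have hθ : 0 < 1 - (α + β * p) := by linarith
  obtain ⟨ε, hε0, hε⟩ : ∃ ε : ℝ, 0 < ε ∧
      T ^ β * (2 * (M * L)) * (ε ^ (1 - (α + β * p)) / (1 - (α + β * p))) ≤ 1 / 2 := by
    have h1 : ContinuousAt (fun ε : ℝ => T ^ β * (2 * (M * L))
        * (ε ^ (1 - (α + β * p)) / (1 - (α + β * p)))) 0 :=
      ((Real.continuousAt_rpow_const 0 _ (Or.inr hθ.le)).div_const _).const_mul _
    have h2 := h1.tendsto.mono_left (nhdsWithin_le_nhds (s := Ioi 0))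
    rw [Real.zero_rpow hθ.ne', zero_div, mul_zero] at h2
    obtain ⟨ε, h3, h4⟩ := ((h2.eventually (ge_mem_nhds (show (0 : ℝ) < 1 / 2 by norm_num))).and
      self_mem_nhdsWithin).exists
    exact ⟨ε, h4, h3⟩
  have hstep : ∀ b ∈ Ioc a T, (∀ s ∈ Ico b T, ∀ y, w₁ s y = w₂ s y) →
      ∀ t ∈ Ico a b, b - ε ≤ t → ∀ x, w₁ t x = w₂ t x := by
    intro b hb hbw t ht htε x
    have hn : ∀ n : ℕ, ∀ t ∈ Ico a b, b - ε ≤ t → ∀ x,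
        (T - t) ^ β * ‖w₁ t x - w₂ t x‖ ≤ 2 * K * (1 / 2) ^ n := by
      intro n
      induction n with
      | zero =>
        intro t ht _ x
        simpa using hdN t ⟨ht.1, ht.2.trans_le hb.2⟩ x
      | succ n ih =>
        intro t ht htε x
        have h1 := hgrad b hb hbw (2 * K * (1 / 2) ^ n) (by positivity) t ht
          (fun s hs y => ih s ⟨ht.1.trans hs.1.le, hs.2⟩ (htε.trans hs.1.le) y) x
        have h2 : (b - t) ^ (1 - (α + β * p)) ≤ ε ^ (1 - (α + β * p)) :=
          Real.rpow_le_rpow (by linarith [ht.2]) (by linarith) hθ.le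
        have h3 : (T - t) ^ β ≤ T ^ β :=
          Real.rpow_le_rpow (by linarith [ht.2, hb.2]) (by linarith [ht.1]) hβ
        have hTβ := Real.rpow_nonneg hT.le β
        calc (T - t) ^ β * ‖w₁ t x - w₂ t x‖
            ≤ T ^ β * (2 * (M * (L * (2 * K * (1 / 2) ^ n)))
              * (ε ^ (1 - (α + β * p)) / (1 - (α + β * p)))) := by
              refine mul_le_mul h3 (h1.trans ?_) (norm_nonneg _) hTβ
              gcongr
          _ = T ^ β * (2 * (M * L)) * (ε ^ (1 - (α + β * p)) / (1 - (α + β * p)))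
              * (2 * K * (1 / 2) ^ n) := by ring
          _ ≤ 1 / 2 * (2 * K * (1 / 2) ^ n) := mul_le_mul_of_nonneg_right hε (by positivity)
          _ = 2 * K * (1 / 2) ^ (n + 1) := by ring
    have hlim : Tendsto (fun n : ℕ => 2 * K * (1 / 2 : ℝ) ^ n) atTop (𝓝 (2 * K * 0)) :=
      (tendsto_pow_atTop_nhds_zero_of_lt_one (by norm_num) (by norm_num)).const_mul _
    have h0 : (T - t) ^ β * ‖w₁ t x - w₂ t x‖ ≤ 0 := by
      rw [mul_zero] at hlim
      exact ge_of_tendsto' hlim fun n => hn n t ht htε x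
    have h1 := Real.rpow_pos_of_pos (show 0 < T - t by linarith [ht.2, hb.2]) β
    have h2 : ‖w₁ t x - w₂ t x‖ ≤ 0 := nonpos_of_mul_nonpos_right h0 h1
    exact sub_eq_zero.1 (norm_le_zero_iff.1 h2)
  have hall : ∀ n : ℕ, ∀ s ∈ Ico a T, T - n * ε ≤ s → ∀ y, w₁ s y = w₂ s y := by
    intro n
    induction n with
    | zero =>
      intro s hs hs'
      simp only [Nat.cast_zero, zero_mul, sub_zero] at hs'
      exact absurd hs.2 hs'.not_gt
    | succ n ih =>
      intro s hs hs' y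
      rcases le_or_gt (T - n * ε) s with h | h
      · exact ih s hs h y
      · refine hstep (T - n * ε) ⟨hs.1.trans_lt h, ?_⟩ (fun r hr => ih r ?_ hr.1) s ⟨hs.1, h⟩ ?_ y
        · have : (0 : ℝ) ≤ n * ε := by positivity
          linarith
        · exact ⟨(hs.1.trans h.le).trans hr.1, hr.2⟩
        · push_cast at hs'
          linarith
  intro s hs y
  obtain ⟨n, hn⟩ := exists_nat_ge ((T - s) / ε)
  refine hall n s hs ?_ y
  rw [div_le_iff₀ hε0] at hn
  linarith

end Uniqueness

end SemilinearKolmogorov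

theorem mainTheorem9 {H : Type*} [NormedAddCommGroup H] [InnerProductSpace ℝ H] [CompleteSpace H]
    [TopologicalSpace.SeparableSpace H] [MeasurableSpace H] [BorelSpace H]
    (T : ℝ) (hT : 0 < T)
    -- `A` generates a strongly continuous semigroup `S t = e^{tA}`; `R = √Q`; `Q_σ` is trace class
    (A : H →ₗ.[ℝ] H) (S : ℝ → H →L[ℝ] H)
    (hS : SemilinearKolmogorov.IsC0Semigroup S) (hA : SemilinearKolmogorov.IsGenerator A S)
    (Q R : H →L[ℝ] H) (hR : R.IsPositive) (hRQ : R.comp R = Q)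
    (htr : ∀ σ : ℝ, 0 ≤ σ →
      SemilinearKolmogorov.HasFiniteTrace (SemilinearKolmogorov.covOp S Q σ))
    -- smoothing property of the Ornstein-Uhlenbeck semigroup
    (α : ℝ) (hα0 : 0 ≤ α) (hα1 : α < 1) (hsm : SemilinearKolmogorov.IsSmoothing S Q R T α)
    -- the nonlinearity `ψ`
    (ψ : H → ℝ) (p C : ℝ) (hp : 2 ≤ p)
    (hψ : ∃ D : H → H, SemilinearKolmogorov.IsGateauxC1 ψ D)
    (hψ_lip : ∀ ξ₁ ξ₂ : H,
      |ψ ξ₁ - ψ ξ₂| ≤ C * (1 + ‖ξ₁‖ ^ (p - 1) + ‖ξ₂‖ ^ (p - 1)) * ‖ξ₁ - ξ₂‖)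
    (hψ_zero : ψ 0 = 0)
    -- `l` and `φ` are bounded and continuous, of class `𝒢(H)`, with bounded derivative
    (l φ : BoundedContinuousFunction H ℝ)
    (hl : ∃ D : H → H, SemilinearKolmogorov.IsGateauxC1 l D ∧ ∃ K : ℝ, ∀ x, ‖D x‖ ≤ K)
    (hφ : ∃ D : H → H, SemilinearKolmogorov.IsGateauxC1 φ D ∧ ∃ K : ℝ, ∀ x, ‖D x‖ ≤ K) :
    ∃ δ : ℝ, 0 < δ ∧ δ < T ∧ ∃ u : ℝ → H → ℝ,
      SemilinearKolmogorov.IsMildSolution S Q R ψ l φ (T - δ) T 0 u ∧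
      ∀ β : ℝ, 0 ≤ β → α + β * p < 1 → ∀ v : ℝ → H → ℝ,
        SemilinearKolmogorov.IsMildSolution S Q R ψ l φ (T - δ) T β v →
          ∀ t ∈ Icc (T - δ) T, ∀ x : H, v t x = u t x := by
  have hd₀ : SemilinearKolmogorov.IsOUData S Q R T := ⟨hS, hR, hRQ, hT, htr T hT.le⟩
  obtain ⟨M, hd⟩ := hd₀.exists_isSmoothOU hsm
  obtain ⟨Dψ, hψc, -, -⟩ := hψ
  obtain ⟨D, ⟨-, hD, -⟩, K, hK⟩ := hφ
  obtain ⟨δ, hδ0, hδT, u, hu⟩ := hd.exists_isMildSolution hα1 hp hψc hψ_lip hψ_zero l φ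
    ((norm_nonneg _).trans (hK 0)) (SemilinearKolmogorov.abs_sub_le_of_hasGradAlong_id hD hK)
  refine ⟨δ, hδ0, hδT, u, hu, fun β hβ hαβ v hv t ht x => ?_⟩
  exact hd.eq_of_isMildSolution hα0 hp hψc hψ_lip (by linarith) hβ hαβ hv (hu.of_exponent_zero hβ)
    ht x
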